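/- **Theorem (sufficiency of mixed threshold rules).** Let $I\subseteq\mathbb R$ be an interval, $y$ an interior point of $I$, and $\bar I$ the closure of $I$ in $[-\infty,\infty]$. On a filtered probability space $(\Omega,\mathcal F,(\mathcal F_t)_{t\ge 0},\mathbb P)$ let $Y=(Y_t)_{t\ge0}$ be a regular time-homogeneous diffusion on $I$ with $Y_0=y$ almost surely. That is, $Y$ is an adapted process with continuous paths in $I$; there is a Markov kernel $x\mapsto\kappa_x$ from $I$ to the space of continuous $I$-valued paths, $\kappa_x$ being carried by paths that start at $x$, such that for every stopping time $\tau$ the conditional law of $(Y_{\tau+t})_{t\ge0}$ given $\mathcal F_\tau$ is $\kappa_{Y_\tau}$ on $\{\tau<\infty\}$; under $\kappa_x$, for $x$ in the interior of $I$, each point of $I$ is reached with positive probability; and the end-points of $I$ that belong to $I$ are absorbing. Assume that $\mathcal F_0$ carries a real random variable with continuous (atomless) law that is independent of the process $Y$. Let $\mathcal T$ be the set of stopping times $\tau$, with values in $[0,\infty]$, such that $Y_\tau:=\lim_{t\to\infty}Y_{t\wedge\tau}$ exists in $[-\infty,\infty]$ almost surely. Let $\mathcal T_R\subseteq\mathcal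 T$ be the set of those $\tau\in\mathcal T$ that are of the form $\tau=\inf\{u\ge0: Y_u\notin(A,B)\}$, where $(A,B)$ is an $\mathcal F_0$-measurable random pair, independent of $Y$, with values in $([-\infty,y]\cap\bar I)\times([y,\infty]\cap\bar I)$ (its law is arbitrary). Let $V$ be a real-valued function of stopping times which is law invariant: $V(\tau)=H(\mathcal L(Y_\tau))$ for every $\tau\in\mathcal T$, for some function $H$ from $\{\mathcal L(Y_\tau):\tau\in\mathcal T\}$ to $\mathbb R$. Then $$\sup_{\tau\in\mathcal T}V(\tau)=\sup_{\tau\in\mathcal T_R}V(\tau),$$ where both sides may be $+\infty$. No other condition, such as quasi-convexity or continuity, is imposed on $H$. -/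

import Mathlib

open MeasureTheory ProbabilityTheory Filter Set
open scoped NNReal ENNReal Topology

namespace ThresholdStopping

/-- Continuous paths with values in `I`; it carries the σ-algebra generated by the coordinates. -/
abbrev PathSpace (I : Set ℝ) : Type := {w : ℝ≥0 → I // Continuous w}

/-- The path shifted by the time `t`: `u ↦ w (t + u)`. -/
def shift {I : Set ℝ} (t : ℝ≥0) (w : PathSpace I) : PathSpace I :=
  ⟨fun u => w.1 (t + u), w.2.comp (continuous_const.add continuous_id)⟩

/-- `Y`, a process with continuous paths in the interval `I`, is a regular time-homogeneous
diffusion on `(Ω, F, P)` started at the interior point `y` of `I`; `κ x` is the law on path space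
of the diffusion started at `x`. The end-points of `I` that belong to `I` are absorbing. -/
structure IsRegularDiffusion {Ω : Type*} {mΩ : MeasurableSpace Ω} (F : Filtration ℝ≥0 mΩ)
    (P : Measure Ω) (I : Set ℝ) (y : ℝ) (κ : Kernel I (PathSpace I)) (Y : Ω → PathSpace I) :
    Prop where
  /-- The state space is an interval. -/
  ordConnected : I.OrdConnected
  mem_interior : y ∈ interior I
  adapted : ∀ t : ℝ≥0, Measurable[F t] (fun ω => (Y ω).1 t)
  initial : ∀ᵐ ω ∂P, ((Y ω).1 0 : ℝ) = y
  markovKernel : IsMarkovKernel κ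
  start : ∀ x : I, ∀ᵐ w ∂(κ x), w.1 0 = x
  /-- Strong Markov property: at every stopping time `τ`, on `{τ < ∞}`, the conditional law of
  the path after `τ` given `F_τ` is `κ (Y_τ)`. -/
  strongMarkov : ∀ (τ : Ω → WithTop ℝ≥0) (hτ : IsStoppingTime F τ) (E : Set Ω)
    (B : Set (PathSpace I)), MeasurableSet[hτ.measurableSpace] E → MeasurableSet B →
    P (E ∩ {ω | τ ω ≠ ⊤} ∩ {ω | shift (τ ω).untopA (Y ω) ∈ B})
      = ∫⁻ ω in E ∩ {ω | τ ω ≠ ⊤}, κ ((Y ω).1 (τ ω).untopA) B ∂P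
  /-- Regularity: from each interior point, each point of `I` is reached with positive
  probability. -/
  regular : ∀ x z : I, (x : ℝ) ∈ interior I → 0 < κ x {w | ∃ t, w.1 t = z}
  /-- An end-point of `I` that belongs to `I` is absorbing. -/
  absorbing : ∀ x : I, (x : ℝ) ∉ interior I → ∀ᵐ w ∂(κ x), ∀ t, w.1 t = x

/-- `F_0` carries a random variable with a continuous (atomless) law, independent of `Y`. -/
def IsRich {Ω : Type*} {mΩ : MeasurableSpace Ω} (F : Filtration ℝ≥0 mΩ) (P : Measure Ω)
    {I : Set ℝ} (Y : Ω → PathSpace I) : Prop :=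
  ∃ U : Ω → ℝ, Measurable[F 0] U ∧ (∀ x, P (U ⁻¹' {x}) = 0) ∧ IndepFun U Y P

/-- The stopped path `t ↦ w (t ∧ τ)`, in the extended real line. -/
noncomputable def stoppedPath {I : Set ℝ} (w : PathSpace I) (τ : WithTop ℝ≥0) (t : ℝ≥0) : EReal :=
  ((w.1 (min (t : WithTop ℝ≥0) τ).untopA : ℝ) : EReal)

/-- The class `𝒯` of stopping times `τ` for which `lim_{t → ∞} Y_{t ∧ τ}` exists almost surely,
in the extended real line. -/
def stoppingTimes {Ω : Type*} {mΩ : MeasurableSpace Ω} (F : Filtration ℝ≥0 mΩ) (P : Measure Ω)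
    {I : Set ℝ} (Y : Ω → PathSpace I) : Set (Ω → WithTop ℝ≥0) :=
  {τ | IsStoppingTime F τ ∧ ∀ᵐ ω ∂P, ∃ l : EReal, Tendsto (stoppedPath (Y ω) (τ ω)) atTop (𝓝 l)}

/-- `Y_τ = lim_{t → ∞} Y_{t ∧ τ}`, which is the value of `Y` at time `τ` where `τ < ∞`. -/
noncomputable def stoppedAt {Ω : Type*} {I : Set ℝ} (Y : Ω → PathSpace I)
    (τ : Ω → WithTop ℝ≥0) (ω : Ω) : EReal :=
  limUnder atTop (stoppedPath (Y ω) (τ ω))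

/-- The law of `Y_τ`. -/
noncomputable def stoppedLaw {Ω : Type*} {mΩ : MeasurableSpace Ω} (P : Measure Ω) {I : Set ℝ}
    (Y : Ω → PathSpace I) (τ : Ω → WithTop ℝ≥0) : Measure EReal :=
  P.map (stoppedAt Y τ)

/-- The set `Q(S)` of laws of `Y_τ`, `τ ∈ S`. -/
def attainableLaws {Ω : Type*} {mΩ : MeasurableSpace Ω} (P : Measure Ω) {I : Set ℝ}
    (Y : Ω → PathSpace I) (S : Set (Ω → WithTop ℝ≥0)) : Set (Measure EReal) :=
  {μ | ∃ τ ∈ S, μ = stoppedLaw P Y τ}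

/-- The set of pairs `(a, b)` with `a ≤ y ≤ b` and `a`, `b` in the closure of `I` in the extended
real line. -/
def thresholds (I : Set ℝ) (y : ℝ) : Set (EReal × EReal) :=
  (closure (Real.toEReal '' I) ∩ Iic (y : EReal)) ×ˢ (closure (Real.toEReal '' I) ∩ Ici (y : EReal))

/-- `inf {u ≥ 0 : w u ∉ (a, b)}`, equal to `∞` if the path never leaves `(a, b)`. -/
noncomputable def exitTime {I : Set ℝ} (a b : EReal) (w : PathSpace I) : WithTop ℝ≥0 :=
  ⨅ u ∈ {u : ℝ≥0 | ((w.1 u : ℝ) : EReal) ∉ Ioo a b}, (u : WithTop ℝ≥0)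

/-- The class `𝒯_R` of randomized threshold stopping times: members of `𝒯` that are the first
exit time of `Y` from a random interval `(A, B)`, where the pair `(A, B)` of thresholds is
`F_0`-measurable and independent of `Y` (its law on the set of thresholds is arbitrary). -/
def randomizedThresholdTimes {Ω : Type*} {mΩ : MeasurableSpace Ω} (F : Filtration ℝ≥0 mΩ)
    (P : Measure Ω) {I : Set ℝ} (y : ℝ) (Y : Ω → PathSpace I) : Set (Ω → WithTop ℝ≥0) :=
  {τ | τ ∈ stoppingTimes F P Y ∧ ∃ Θ : Ω → thresholds I y, Measurable[F 0] Θ ∧ IndepFun Θ Y P ∧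
    ∀ ω, τ ω = exitTime (Θ ω).1.1 (Θ ω).1.2 (Y ω)}

/-- Law invariance: `V τ = H (law of Y_τ)` on `𝒯`, for some function `H : Q(𝒯) → ℝ`. -/
def LawInvariant {Ω : Type*} {mΩ : MeasurableSpace Ω} (F : Filtration ℝ≥0 mΩ) (P : Measure Ω)
    {I : Set ℝ} (Y : Ω → PathSpace I) (V : (Ω → WithTop ℝ≥0) → ℝ) : Prop :=
  ∃ H : attainableLaws P Y (stoppingTimes F P Y) → ℝ,
    ∀ (τ : Ω → WithTop ℝ≥0) (hτ : τ ∈ stoppingTimes F P Y),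
      V τ = H ⟨stoppedLaw P Y τ, τ, hτ, rfl⟩

/-- `V_*(S) = sup_{τ ∈ S} V τ`, possibly `+∞`. -/
noncomputable def optimalValue {Ω : Type*} (V : (Ω → WithTop ℝ≥0) → ℝ)
    (S : Set (Ω → WithTop ℝ≥0)) : EReal :=
  ⨆ τ ∈ S, (V τ : EReal)

end ThresholdStopping

namespace ThresholdStopping

/-! ### Hitting times of continuous paths and measurability of path events. -/

section Paths

variable {I : Set ℝ}

/-! Every law attained by a time in `stoppingTimes` is attained by a time in
`randomizedThresholdTimes` (`exists_randomizedThresholdTime`). Since `V` sees only the law, the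
suprema then agree, whatever `H` is.

The tool is a scale function. The strong Markov property ties the exit probabilities of nested
intervals together so tightly that they all come from one monotone `s` with `s y = 0`: from `x`, the
path reaches `b` before `a` with probability `(s x - s a) / (s b - s a)`
(`exists_scale_of_exit_probabilities`, `exists_isScale`). Up to the exit from a compact interval,
the stopped scale is bounded with mean zero (`lintegral_scale`). Let the intervals exhaust `I`, with
dominated convergence for one sign of `s` and Fatou for the other: a law `ν` of a stopped value
satisfies `∫ s⁻ dν ≤ ∫ s⁺ dν` if `s` is bounded above, and the reverse inequality if `s` is bounded
below. Moreover `ν` does not charge an end of `I` at infinite distance in scale, because then the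
path visits the opposite side of `y` at arbitrarily large times (`GoodPath.ne_leftEnd`,
`GoodPath.ne_rightEnd`).

Conversely, such a `ν` is a mixture of exit laws. For `A < y < B` with `u = s⁻(A)` and `v = s⁺(B)`
finite, the exit law from `(A, B)` is `(v δ_A + u δ_B) / (u + v)`. Choose `(A, B)` with density `k
(u + v)` against the product of `ν` below `y` and `ν` above `y`: the denominator cancels, and the
mixture is `k ∫ s⁺ dν` times `ν` below `y` plus `k ∫ s⁻ dν` times `ν` above `y`. If both integrals
equal a finite `m > 0`, then `k = 1 / m` reproduces `ν` off `y`, and the mass at `y` comes from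
immediate stopping. If they differ, one side lacks mass; the inequalities above then force the
opposite end to be at infinite distance in scale, so that a one-sided threshold is reached almost
surely and supplies Dirac masses on the deficient side. If both ends are at infinite distance,
one-sided thresholds suffice. (`exists_mixture_weights`, `exists_thresholdLaw`.)

The atomless variable in `F 0` realizes any law of thresholds independently of `Y`
(`IsRich.exists_map_eq`), and independence turns the stopped law into the mixture
(`stoppedLaw_randomized_apply`). -/

lemma continuous_path (w : PathSpace I) : Continuous fun t => (w.1 t : ℝ) :=
  continuous_subtype_val.comp w.2

lemma measurable_path (t : ℝ≥0) : Measurable fun w : PathSpace I => (w.1 t : ℝ) :=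
  measurable_subtype_coe.comp ((measurable_pi_apply t).comp measurable_subtype_coe)

lemma exists_path_eq (w : PathSpace I) {s t : ℝ≥0} (hst : s ≤ t) {z : ℝ}
    (hz : z ∈ uIcc (w.1 s : ℝ) (w.1 t)) : ∃ u, s ≤ u ∧ u ≤ t ∧ (w.1 u : ℝ) = z := by
  obtain ⟨u, hu, h⟩ := intermediate_value_uIcc (continuous_path w).continuousOn hz
  rw [uIcc_of_le hst] at hu
  exact ⟨u, hu.1, hu.2, h⟩

/-- The first element of a set of times. -/
noncomputable def firstTime (S : Set ℝ≥0) : WithTop ℝ≥0 := ⨅ u ∈ S, (u : WithTop ℝ≥0)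

lemma firstTime_empty : firstTime ∅ = ⊤ :=
  le_antisymm le_top (le_iInf₂ fun _ h => absurd h (notMem_empty _))

lemma firstTime_eq {S : Set ℝ≥0} {u : ℝ≥0} (hu : u ∈ S) (h : ∀ v ∈ S, u ≤ v) :
    firstTime S = u :=
  le_antisymm (iInf₂_le u hu) (le_iInf₂ fun v hv => WithTop.coe_le_coe.2 (h v hv))

lemma firstTime_cases {S : Set ℝ≥0} (hS : IsClosed S) :
    (S = ∅ ∧ firstTime S = ⊤) ∨ ∃ u ∈ S, (∀ v ∈ S, u ≤ v) ∧ firstTime S = u := by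
  rcases S.eq_empty_or_nonempty with rfl | h
  · exact Or.inl ⟨rfl, firstTime_empty⟩
  · have h1 := hS.csInf_mem h (OrderBot.bddBelow S)
    have h2 : ∀ v ∈ S, sInf S ≤ v := fun v hv => csInf_le (OrderBot.bddBelow S) hv
    exact Or.inr ⟨_, h1, h2, firstTime_eq h1 h2⟩

lemma firstTime_le_iff {S : Set ℝ≥0} (hS : IsClosed S) (t : ℝ≥0) :
    firstTime S ≤ t ↔ ∃ u ≤ t, u ∈ S := by
  rcases firstTime_cases hS with ⟨rfl, h⟩ | ⟨u, hu, hm, h⟩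
  · rw [h]
    exact ⟨fun k => absurd k (WithTop.coe_lt_top t).not_ge, fun ⟨v, _, hv⟩ => absurd hv (notMem_empty v)⟩
  · rw [h, WithTop.coe_le_coe]
    exact ⟨fun k => ⟨u, k, hu⟩, fun ⟨v, hv, hvS⟩ => (hm v hvS).trans hv⟩

lemma zero_le_coe (u : ℝ≥0) : ((0 : ℝ≥0) : WithTop ℝ≥0) ≤ u := WithTop.coe_le_coe.2 zero_le

lemma isClosed_le_coe (s : WithTop ℝ≥0) : IsClosed {u : ℝ≥0 | s ≤ u} :=
  isClosed_Ici.preimage WithTop.continuous_coe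

/-- The first time after `s` at which the path is at `z`. -/
noncomputable def hitAfter (s : WithTop ℝ≥0) (z : ℝ) (w : PathSpace I) : WithTop ℝ≥0 :=
  firstTime {u | s ≤ u ∧ (w.1 u : ℝ) = z}

lemma isClosed_hitAfter (s : WithTop ℝ≥0) (z : ℝ) (w : PathSpace I) :
    IsClosed {u : ℝ≥0 | s ≤ u ∧ (w.1 u : ℝ) = z} :=
  (isClosed_le_coe s).inter (isClosed_singleton.preimage (continuous_path w))

lemma hitAfter_le_iff (s : WithTop ℝ≥0) (z : ℝ) (w : PathSpace I) (t : ℝ≥0) :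
    hitAfter s z w ≤ t ↔ ∃ u ≤ t, s ≤ u ∧ (w.1 u : ℝ) = z :=
  firstTime_le_iff (isClosed_hitAfter s z w) t

lemma hitAfter_cases (s : WithTop ℝ≥0) (z : ℝ) (w : PathSpace I) :
    ((∀ u : ℝ≥0, s ≤ u → (w.1 u : ℝ) ≠ z) ∧ hitAfter s z w = ⊤) ∨
      ∃ u : ℝ≥0, s ≤ u ∧ (w.1 u : ℝ) = z ∧ (∀ v : ℝ≥0, s ≤ v → (w.1 v : ℝ) = z → u ≤ v) ∧
        hitAfter s z w = u := by
  rcases firstTime_cases (isClosed_hitAfter s z w) with ⟨h, h'⟩ | ⟨u, hu, hm, h⟩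
  · exact Or.inl ⟨fun u hu hz => (h ▸ (⟨hu, hz⟩ : u ∈ {u : ℝ≥0 | s ≤ u ∧ (w.1 u : ℝ) = z}) :
      u ∈ (∅ : Set ℝ≥0)), h'⟩
  · exact Or.inr ⟨u, hu.1, hu.2, fun v h1 h2 => hm v ⟨h1, h2⟩, h⟩

lemma le_hitAfter (s : WithTop ℝ≥0) (z : ℝ) (w : PathSpace I) : s ≤ hitAfter s z w :=
  le_iInf₂ fun _ hu => hu.1

lemma hitAfter_ne_top {s : WithTop ℝ≥0} {z : ℝ} {w : PathSpace I} {u : ℝ≥0} (hs : s ≤ u)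
    (hz : (w.1 u : ℝ) = z) : hitAfter s z w ≠ ⊤ :=
  ne_top_of_le_ne_top WithTop.coe_ne_top ((hitAfter_le_iff s z w u).2 ⟨u, le_rfl, hs, hz⟩)

lemma path_hitAfter {s : WithTop ℝ≥0} {z : ℝ} {w : PathSpace I} (h : hitAfter s z w ≠ ⊤) :
    (w.1 (hitAfter s z w).untopA : ℝ) = z := by
  rcases hitAfter_cases s z w with ⟨-, h'⟩ | ⟨u, -, hz, -, h'⟩
  · exact absurd h' h
  · rw [h']; exact hz

/-- Measurability of the event that a continuous process is at most `A` at some time between a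
random time `σ` and `t`. -/
lemma measurableSet_exists_le {Ω : Type*} {m : MeasurableSpace Ω} {Z : Ω → ℝ≥0 → EReal}
    (hc : ∀ ω, Continuous (Z ω)) {A : Ω → EReal} (hA : Measurable A) {t : ℝ≥0}
    (hZ : ∀ u ≤ t, Measurable fun ω => Z ω u) {σ : Ω → WithTop ℝ≥0}
    (hσ : ∀ u ≤ t, MeasurableSet {ω | σ ω ≤ (u : WithTop ℝ≥0)}) :
    MeasurableSet {ω | ∃ u ≤ t, σ ω ≤ (u : WithTop ℝ≥0) ∧ Z ω u ≤ A ω} := by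
  obtain ⟨C, hCc, hCd⟩ := TopologicalSpace.exists_countable_dense EReal
  obtain ⟨D, hDc, hDd⟩ := TopologicalSpace.exists_countable_dense ℝ≥0
  -- The approximating times lie to the right of `u`, so that `σ ≤ u` survives; `t` is added because
  -- no admissible time lies to its right.
  set D' : Set ℝ≥0 := (D ∩ Iic t) ∪ {t}
  have hD'c : D'.Countable := (hDc.mono inter_subset_left).union (countable_singleton t)
  have hD't : ∀ q ∈ D', q ≤ t := by
    rintro q (hq | rfl)
    exacts [hq.2, le_rfl]
  have key : {ω | ∃ u ≤ t, σ ω ≤ (u : WithTop ℝ≥0) ∧ Z ω u ≤ A ω} =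
      {ω | σ ω ≤ (t : WithTop ℝ≥0)} ∩ ⋂ c ∈ C, ({ω | c ≤ A ω} ∪
        ⋃ q ∈ D', {ω | σ ω ≤ (q : WithTop ℝ≥0)} ∩ {ω | Z ω q < c}) := by
    ext ω
    simp only [mem_ofPred_eq, mem_inter_iff, mem_iInter, mem_union, mem_iUnion, exists_prop]
    constructor
    · rintro ⟨u, hut, hσu, hu⟩
      refine ⟨hσu.trans (WithTop.coe_le_coe.2 hut), fun c _ => ?_⟩
      by_cases hcA : c ≤ A ω
      · exact Or.inl hcA
      right
      have hlt : Z ω u < c := hu.trans_lt (not_le.1 hcA)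
      have hopen : IsOpen {v | Z ω v < c} := isOpen_Iio.preimage (hc ω)
      rcases hut.eq_or_lt with rfl | hut
      · exact ⟨u, Or.inr rfl, hσu, hlt⟩
      · obtain ⟨e, he, hsub⟩ := exists_Ico_subset_of_mem_nhds (hopen.mem_nhds hlt) ⟨t, hut⟩
        obtain ⟨q, hq, hqD⟩ := hDd.inter_open_nonempty (Ioo u (min e t)) isOpen_Ioo
          (nonempty_Ioo.2 (lt_min he hut))
        exact ⟨q, Or.inl ⟨hqD, (hq.2.trans_le (min_le_right _ _)).le⟩,
          hσu.trans (WithTop.coe_le_coe.2 hq.1.le),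
          hsub ⟨hq.1.le, hq.2.trans_le (min_le_left _ _)⟩⟩
    · rintro ⟨hσt, h⟩
      -- Compactness gives the converse: the minimum over the admissible times is attained and lies
      -- below every `c > A ω` of the countable dense set.
      have hK : IsCompact ({u : ℝ≥0 | σ ω ≤ u} ∩ Icc 0 t) :=
        isCompact_Icc.inter_left (isClosed_le_coe _)
      obtain ⟨u, ⟨hu1, hu2⟩, hmin⟩ := hK.exists_isMinOn ⟨t, hσt, zero_le, le_rfl⟩
        (hc ω).continuousOn
      refine ⟨u, hu2.2, hu1, ?_⟩
      by_contra hlt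
      obtain ⟨c, hcm, hcC⟩ := hCd.inter_open_nonempty (Ioo (A ω) (Z ω u)) isOpen_Ioo
        (nonempty_Ioo.2 (not_le.1 hlt))
      rcases h c hcC with h | ⟨q, hq, hσq, hlt'⟩
      · exact absurd hcm.1 (not_lt.2 h)
      · exact absurd (hmin ⟨hσq, zero_le, hD't q hq⟩) (not_le.2 (hlt'.trans hcm.2))
  rw [key]
  refine (hσ t le_rfl).inter (MeasurableSet.biInter hCc fun c _ => ?_)
  refine (measurableSet_le measurable_const hA).union (MeasurableSet.biUnion hD'c fun q hq => ?_)
  exact (hσ q (hD't q hq)).inter (measurableSet_lt (hZ q (hD't q hq)) measurable_const)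

lemma measurableSet_exists_path_eq {Ω : Type*} {m : MeasurableSpace Ω} {X : Ω → PathSpace I}
    {t : ℝ≥0} (hX : ∀ u ≤ t, Measurable fun ω => (X ω).1 u) {σ : Ω → WithTop ℝ≥0}
    (hσ : ∀ u ≤ t, MeasurableSet {ω | σ ω ≤ (u : WithTop ℝ≥0)}) (z : ℝ) :
    MeasurableSet {ω | ∃ u ≤ t, σ ω ≤ (u : WithTop ℝ≥0) ∧ ((X ω).1 u : ℝ) = z} := by
  have := measurableSet_exists_le (Z := fun ω u => ((|((X ω).1 u : ℝ) - z| : ℝ) : EReal))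
    (A := fun _ => 0) (t := t) (σ := σ)
    (fun ω => continuous_coe_real_ereal.comp (((continuous_path (X ω)).sub continuous_const).abs))
    measurable_const
    (fun u hu => measurable_coe_real_ereal.comp
      (((measurable_subtype_coe.comp (hX u hu)).sub measurable_const).abs)) hσ
  convert this using 6 with ω u
  rw [← EReal.coe_zero, EReal.coe_le_coe_iff, abs_nonpos_iff, sub_eq_zero]

/-- The paths that visit `z` no later than `t`. -/
def hitsBy (t : ℝ≥0) (z : ℝ) : Set (PathSpace I) := {w | ∃ u ≤ t, (w.1 u : ℝ) = z}

/-- The paths that visit `z`. -/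
def hits (z : ℝ) : Set (PathSpace I) := {w | ∃ u, (w.1 u : ℝ) = z}

/-- The paths that visit `b`, and do so before visiting `a`. -/
def before (b a : ℝ) : Set (PathSpace I) := {w | ∃ t, (w.1 t : ℝ) = b ∧ ∀ u ≤ t, (w.1 u : ℝ) ≠ a}

lemma measurable_path' (t : ℝ≥0) : Measurable fun w : PathSpace I => w.1 t :=
  (measurable_pi_apply t).comp measurable_subtype_coe

lemma measurableSet_hitsBy (t : ℝ≥0) (z : ℝ) : MeasurableSet (hitsBy t z : Set (PathSpace I)) := by
  have := measurableSet_exists_path_eq (X := fun w : PathSpace I => w) (t := t)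
    (σ := fun _ => ((0 : ℝ≥0) : WithTop ℝ≥0)) (fun u _ => measurable_path' u)
    (fun u _ => MeasurableSet.const _) z
  convert this using 1
  ext w
  exact exists_congr fun u => and_congr_right fun _ => (and_iff_right (zero_le_coe u)).symm

lemma hits_eq_iUnion (z : ℝ) : (hits z : Set (PathSpace I)) = ⋃ n : ℕ, hitsBy n z := by
  ext w
  simp only [hits, hitsBy, mem_ofPred_eq, mem_iUnion]
  constructor
  · rintro ⟨u, hu⟩
    obtain ⟨n, hn⟩ := exists_nat_ge u
    exact ⟨n, u, hn, hu⟩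
  · rintro ⟨n, u, -, hu⟩
    exact ⟨u, hu⟩

lemma measurableSet_hits (z : ℝ) : MeasurableSet (hits z : Set (PathSpace I)) := by
  rw [hits_eq_iUnion]
  exact MeasurableSet.iUnion fun n => measurableSet_hitsBy _ z

lemma hitsBy_mono {s t : ℝ≥0} (h : s ≤ t) (z : ℝ) : (hitsBy s z : Set (PathSpace I)) ⊆ hitsBy t z :=
  fun _ ⟨u, hu, hz⟩ => ⟨u, hu.trans h, hz⟩

lemma hitsBy_subset_hits (t : ℝ≥0) (z : ℝ) : (hitsBy t z : Set (PathSpace I)) ⊆ hits z :=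
  fun _ ⟨u, _, hz⟩ => ⟨u, hz⟩

/-- If `a` is avoided up to the visit to `b`, continuity makes it avoided slightly longer, hence up
to some time of a countable dense set. -/
lemma measurableSet_before (b a : ℝ) : MeasurableSet (before b a : Set (PathSpace I)) := by
  obtain ⟨D, hDc, hDd⟩ := TopologicalSpace.exists_countable_dense ℝ≥0
  have key : (before b a : Set (PathSpace I)) = ⋃ q ∈ D, hitsBy q b \ hitsBy q a := by
    ext w
    simp only [before, hitsBy, mem_ofPred_eq, mem_iUnion, Set.mem_sdiff, exists_prop, not_exists, not_and]
    constructor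
    · rintro ⟨t, ht, h⟩
      have hopen : IsOpen {v | (w.1 v : ℝ) ≠ a} := isOpen_ne.preimage (continuous_path w)
      obtain ⟨e, he, hsub⟩ := exists_Ico_subset_of_mem_nhds (hopen.mem_nhds (h t le_rfl))
        ⟨t + 1, lt_add_one t⟩
      obtain ⟨q, hq, hqD⟩ := hDd.inter_open_nonempty (Ioo t e) isOpen_Ioo (nonempty_Ioo.2 he)
      refine ⟨q, hqD, ⟨t, hq.1.le, ht⟩, fun u hu => ?_⟩
      rcases le_total u t with hut | htu
      · exact h u hut
      · exact hsub ⟨htu, hu.trans_lt hq.2⟩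
    · rintro ⟨q, -, ⟨t, htq, ht⟩, h⟩
      exact ⟨t, ht, fun u hu => h u (hu.trans htq)⟩
  rw [key]
  exact MeasurableSet.biUnion hDc fun q _ =>
    (measurableSet_hitsBy q b).diff (measurableSet_hitsBy q a)

lemma before_subset_hits (b a : ℝ) : (before b a : Set (PathSpace I)) ⊆ hits b :=
  fun _ ⟨t, ht, _⟩ => ⟨t, ht⟩

lemma disjoint_before {a b : ℝ} : Disjoint (before b a : Set (PathSpace I)) (before a b) := by
  rw [Set.disjoint_left]
  rintro w ⟨t, ht, h⟩ ⟨s, hs, h'⟩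
  rcases le_total s t with hst | hts
  · exact h s hst hs
  · exact h' t hts ht

lemma before_union_before {a b : ℝ} (hab : a ≠ b) :
    (before b a ∪ before a b : Set (PathSpace I)) = hits a ∪ hits b := by
  apply Subset.antisymm
  · rintro w (h | h)
    exacts [Or.inr (before_subset_hits _ _ h), Or.inl (before_subset_hits _ _ h)]
  · intro w h
    rcases hitAfter_cases ((0 : ℝ≥0) : WithTop ℝ≥0) a w with ⟨ha, -⟩ | ⟨s, -, ha, hs, -⟩
    · rcases h with ⟨u, hu⟩ | ⟨u, hu⟩
      · exact absurd hu (ha u (zero_le_coe _))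
      · exact Or.inl ⟨u, hu, fun v _ => ha v (zero_le_coe _)⟩
    · rcases hitAfter_cases ((0 : ℝ≥0) : WithTop ℝ≥0) b w with ⟨hb, -⟩ | ⟨t, -, hb, ht, -⟩
      · exact Or.inr ⟨s, ha, fun v _ => hb v (zero_le_coe _)⟩
      · rcases lt_trichotomy s t with h1 | rfl | h1
        · exact Or.inr ⟨s, ha, fun v hv hvb => (ht v (zero_le_coe _) hvb).not_gt (hv.trans_lt h1)⟩
        · exact absurd (ha.symm.trans hb) hab
        · exact Or.inl ⟨t, hb, fun v hv hva => (hs v (zero_le_coe _) hva).not_gt (hv.trans_lt h1)⟩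

/-- A path that meets a barrier `c` between its start and `a` sees `c` before `a`. -/
lemma hits_of_hits {w : PathSpace I} {a c : ℝ} (hc : c ∈ uIcc (w.1 0 : ℝ) a)
    (h : w ∈ hits a) : w ∈ hits c := by
  obtain ⟨t, ht⟩ := h
  obtain ⟨v, -, hv, hvc⟩ := exists_path_eq w (zero_le (a := t)) (ht ▸ hc)
  exact ⟨v, hvc⟩

@[simp] lemma shift_apply (t u : ℝ≥0) (w : PathSpace I) : (shift t w).1 u = w.1 (t + u) := rfl

@[simp] lemma shift_zero (w : PathSpace I) : shift 0 w = w := by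
  ext u; simp

end Paths

/-- Used with the intermediate value theorem: a path from `y` that is outside the interval has
already visited one of its ends. -/
lemma mem_uIcc_or_of_notMem {a b x y : ℝ} (hy : y ∈ uIcc a b) (hx : x ∉ uIcc a b) :
    a ∈ uIcc y x ∨ b ∈ uIcc y x := by
  simp only [mem_uIcc] at *
  grind

/-! ### The strong Markov property at hitting times and the exit from compact intervals. -/

namespace IsRegularDiffusion

variable {Ω : Type*} {mΩ : MeasurableSpace Ω} {F : Filtration ℝ≥0 mΩ} {P : Measure Ω}
  {I : Set ℝ} {y : ℝ} {κ : Kernel I (PathSpace I)} {Y : Ω → PathSpace I}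

lemma measurable_coord (hY : IsRegularDiffusion F P I y κ Y) (t : ℝ≥0) :
    Measurable fun ω => (Y ω).1 t :=
  (hY.adapted t).mono (F.le t) le_rfl

lemma measurable_coord_le (hY : IsRegularDiffusion F P I y κ Y) {s t : ℝ≥0} (h : s ≤ t) :
    Measurable[F t] fun ω => (Y ω).1 s :=
  (hY.adapted s).mono (F.mono h) le_rfl

lemma measurable (hY : IsRegularDiffusion F P I y κ Y) : Measurable Y :=
  (measurable_pi_lambda _ hY.measurable_coord).subtype_mk

lemma mem (hY : IsRegularDiffusion F P I y κ Y) : y ∈ I := interior_subset hY.mem_interior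

lemma isStoppingTime_hitAfter (hY : IsRegularDiffusion F P I y κ Y) {σ : Ω → WithTop ℝ≥0}
    (hσ : IsStoppingTime F σ) (z : ℝ) :
    IsStoppingTime F fun ω => hitAfter (σ ω) z (Y ω) := by
  intro t
  simp only [hitAfter_le_iff]
  exact measurableSet_exists_path_eq (m := F t) (fun u hu => hY.measurable_coord_le hu)
    (fun u hu => F.mono hu _ (hσ u)) z

lemma isStoppingTime_hit (hY : IsRegularDiffusion F P I y κ Y) (z : ℝ) :
    IsStoppingTime F fun ω => hitAfter ((0 : ℝ≥0) : WithTop ℝ≥0) z (Y ω) :=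
  hY.isStoppingTime_hitAfter (isStoppingTime_const F 0) z

lemma measurableSet_hitsBy (hY : IsRegularDiffusion F P I y κ Y) (t : ℝ≥0) (z : ℝ) :
    MeasurableSet[F t] (Y ⁻¹' hitsBy t z) := by
  convert hY.isStoppingTime_hit z t using 1
  ext ω
  simp only [hitAfter_le_iff]
  exact exists_congr fun u => and_congr_right fun _ => (and_iff_right (zero_le_coe u)).symm

/-- The integrand `κ (Y_σ) B` is constant on `{σ < ∞}`, so the future after `σ` is independent of
the past. -/
lemma strongMarkov_of_eq (hY : IsRegularDiffusion F P I y κ Y) {σ : Ω → WithTop ℝ≥0}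
    (hσ : IsStoppingTime F σ) (z : I)
    (hz : ∀ᵐ ω ∂P, σ ω ≠ ⊤ → ((Y ω).1 (σ ω).untopA : ℝ) = z)
    {E : Set Ω} (hE : MeasurableSet[hσ.measurableSpace] E) {B : Set (PathSpace I)}
    (hB : MeasurableSet B) :
    P (E ∩ {ω | σ ω ≠ ⊤} ∩ {ω | shift (σ ω).untopA (Y ω) ∈ B}) =
      P (E ∩ {ω | σ ω ≠ ⊤}) * κ z B := by
  have hm : MeasurableSet (E ∩ {ω | σ ω ≠ ⊤}) :=
    (hσ.measurableSpace_le _ hE).inter (hσ.measurable' (measurableSet_singleton ⊤).compl)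
  rw [hY.strongMarkov σ hσ E B hE hB, mul_comm, ← setLIntegral_const]
  refine lintegral_congr_ae ?_
  rw [EventuallyEq, ae_restrict_iff' hm]
  filter_upwards [hz] with ω h h'
  rw [Subtype.ext (h h'.2)]

lemma strongMarkov_hitAfter (hY : IsRegularDiffusion F P I y κ Y) {σ : Ω → WithTop ℝ≥0}
    (hσ : IsStoppingTime F σ) (z : I) {E : Set Ω}
    (hE : MeasurableSet[(hY.isStoppingTime_hitAfter hσ z).measurableSpace] E)
    {B : Set (PathSpace I)} (hB : MeasurableSet B) :
    P (E ∩ {ω | hitAfter (σ ω) z (Y ω) ≠ ⊤} ∩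
        {ω | shift (hitAfter (σ ω) z (Y ω)).untopA (Y ω) ∈ B}) =
      P (E ∩ {ω | hitAfter (σ ω) z (Y ω) ≠ ⊤}) * κ z B :=
  hY.strongMarkov_of_eq (hY.isStoppingTime_hitAfter hσ z) z
    (Eventually.of_forall fun _ h => path_hitAfter h) hE hB

lemma law_eq (hY : IsRegularDiffusion F P I y κ Y) [IsProbabilityMeasure P] {B : Set (PathSpace I)}
    (hB : MeasurableSet B) : P (Y ⁻¹' B) = κ ⟨y, hY.mem⟩ B := by
  have h := hY.strongMarkov_of_eq (isStoppingTime_const F (0 : ℝ≥0)) ⟨y, hY.mem⟩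
    (by filter_upwards [hY.initial] with ω h _ using h) (E := univ) MeasurableSet.univ hB
  have h1 : {ω : Ω | ((0 : ℝ≥0) : WithTop ℝ≥0) ≠ ⊤} = univ :=
    eq_univ_of_forall fun _ => WithTop.coe_ne_top
  rw [h1, inter_self, measure_univ, one_mul, univ_inter] at h
  rw [← h]
  congr 1
  ext ω
  change _ ↔ shift 0 (Y ω) ∈ B
  rw [shift_zero]; rfl

lemma ae_absorbed (hY : IsRegularDiffusion F P I y κ Y) (z : I) (hz : (z : ℝ) ∉ interior I) :
    ∀ᵐ ω ∂P, ∀ s t : ℝ≥0, s ≤ t → ((Y ω).1 s : ℝ) = z → ((Y ω).1 t : ℝ) = z := by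
  -- A measurable hull replaces the exceptional set of paths, an uncountable union over times.
  have h0 : κ z (toMeasurable (κ z) {w | ¬ ∀ t, w.1 t = z}) = 0 := by
    rw [measure_toMeasurable]; exact hY.absorbing z hz
  have h := hY.strongMarkov_hitAfter (isStoppingTime_const F (0 : ℝ≥0)) z (E := univ)
    MeasurableSet.univ (measurableSet_toMeasurable (κ z) {w | ¬ ∀ t, w.1 t = z})
  rw [h0, mul_zero] at h
  refine measure_mono_null (fun ω hω => ?_) h
  by_contra hn
  refine hω fun s t hst hs => ?_
  rcases hitAfter_cases ((0 : ℝ≥0) : WithTop ℝ≥0) z (Y ω) with ⟨h1, -⟩ | ⟨u, -, hu, hmin, hT⟩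
  · exact absurd hs (h1 s (zero_le_coe _))
  have h3 : ∀ v, (shift u (Y ω)).1 v = z := by
    by_contra hc
    refine hn ⟨⟨trivial, ?_⟩, subset_toMeasurable _ _ ?_⟩
    · change hitAfter _ _ _ ≠ ⊤
      rw [hT]; exact WithTop.coe_ne_top
    · rw [hT]; exact hc
  have h4 := h3 (t - u)
  rw [shift_apply, add_tsub_cancel_of_le ((hmin s (zero_le_coe _) hs).trans hst)] at h4
  rw [h4]

/-- On its way from `y` to `b` the path passes `x`, after which at most the time `t` remains. This
makes the lower bound on exit probabilities uniform in the starting point. -/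
lemma prob_hitsBy_le (hY : IsRegularDiffusion F P I y κ Y) [IsProbabilityMeasure P] (t : ℝ≥0)
    {b : ℝ} (x : I) (hx : (x : ℝ) ∈ uIcc y b) :
    P (Y ⁻¹' hitsBy t b) ≤ κ x (hitsBy t b) := by
  have h := hY.strongMarkov_hitAfter (isStoppingTime_const F (0 : ℝ≥0)) x (E := univ)
    MeasurableSet.univ (ThresholdStopping.measurableSet_hitsBy t b)
  calc P (Y ⁻¹' hitsBy t b) ≤ _ := measure_mono_ae ?_
    _ = _ := h
    _ ≤ 1 * κ x (hitsBy t b) := by gcongr; exact prob_le_one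
    _ = _ := one_mul _
  filter_upwards [hY.initial] with ω h0 ⟨u, hut, hu⟩
  obtain ⟨v, -, hv, hvx⟩ := exists_path_eq (Y ω) (zero_le (a := u)) (z := x) (by rwa [h0, hu])
  rcases hitAfter_cases ((0 : ℝ≥0) : WithTop ℝ≥0) x (Y ω) with ⟨h1, -⟩ | ⟨r, -, hr, hmin, hT⟩
  · exact absurd hvx (h1 v (zero_le_coe _))
  refine ⟨⟨trivial, ?_⟩, ?_⟩
  · change hitAfter _ _ _ ≠ ⊤
    rw [hT]; exact WithTop.coe_ne_top
  · change shift (hitAfter _ _ _).untopA (Y ω) ∈ hitsBy t b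
    rw [hT]
    refine ⟨u - r, tsub_le_self.trans hut, ?_⟩
    have : (r : WithTop ℝ≥0).untopA = r := rfl
    rw [this, shift_apply, add_tsub_cancel_of_le ((hmin v (zero_le_coe _) hvx).trans hv), hu]

lemma prob_hits_pos (hY : IsRegularDiffusion F P I y κ Y) [IsProbabilityMeasure P] (b : I) :
    0 < P (Y ⁻¹' hits b) := by
  rw [hY.law_eq (measurableSet_hits _)]
  convert hY.regular ⟨y, hY.mem⟩ b hY.mem_interior using 3
  ext w
  exact exists_congr fun t => Subtype.ext_iff.symm

lemma exists_prob_hitsBy_pos (hY : IsRegularDiffusion F P I y κ Y) [IsProbabilityMeasure P]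
    (b : I) : ∃ n : ℕ, 0 < P (Y ⁻¹' hitsBy n b) := by
  by_contra! h
  refine (hY.prob_hits_pos b).ne' ?_
  rw [hits_eq_iUnion, preimage_iUnion]
  exact measure_iUnion_null fun n => nonpos_iff_eq_zero.1 (h n)

/-- The exit time from a compact interval is almost surely finite. -/
lemma ae_exit (hY : IsRegularDiffusion F P I y κ Y) [IsProbabilityMeasure P] (a b : I)
    (hy : y ∈ uIcc (a : ℝ) b) : ∀ᵐ ω ∂P, Y ω ∈ hits a ∪ hits b := by
  obtain ⟨n, hn⟩ := hY.exists_prob_hitsBy_pos a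
  obtain ⟨n', hn'⟩ := hY.exists_prob_hitsBy_pos b
  set N : ℝ≥0 := max n n'
  have hNa : 0 < P (Y ⁻¹' hitsBy N a) :=
    hn.trans_le (measure_mono (preimage_mono (hitsBy_mono (le_max_left _ _) _)))
  have hNb : 0 < P (Y ⁻¹' hitsBy N b) :=
    hn'.trans_le (measure_mono (preimage_mono (hitsBy_mono (le_max_right _ _) _)))
  set ε := min (P (Y ⁻¹' hitsBy N a)) (P (Y ⁻¹' hitsBy N b))
  have hε : 0 < ε := lt_min hNa hNb
  set B : Set (PathSpace I) := hitsBy N a ∪ hitsBy N b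
  have hB : MeasurableSet B := (ThresholdStopping.measurableSet_hitsBy _ _).union
    (ThresholdStopping.measurableSet_hitsBy _ _)
  have := hY.markovKernel
  -- From any point of the interval, the exit happens within time `N` with probability at least `ε`:
  -- `x` lies between `y` and one of the ends, and that end is reached fast enough.
  have hκ : ∀ x : I, (x : ℝ) ∈ uIcc (a : ℝ) b → κ x Bᶜ ≤ 1 - ε := by
    intro x hx
    rw [prob_compl_eq_one_sub hB]
    refine tsub_le_tsub_left ?_ _
    rcases uIcc_subset_uIcc_union_uIcc (b := y) hx with h | h
    · rw [uIcc_comm] at h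
      exact (min_le_left _ _).trans ((hY.prob_hitsBy_le N x h).trans (measure_mono subset_union_left))
    · exact (min_le_right _ _).trans
        ((hY.prob_hitsBy_le N x h).trans (measure_mono subset_union_right))
  -- No exit by time `k * N`. The Markov property at these times makes the probabilities decay
  -- geometrically.
  let S : ℕ → Set Ω := fun k => Y ⁻¹' (hitsBy (k * N) a ∪ hitsBy (k * N) b)ᶜ
  have hS : ∀ k : ℕ, MeasurableSet[F (k * N)] (S k) := fun k =>
    ((hY.measurableSet_hitsBy _ _).union (hY.measurableSet_hitsBy _ _)).compl
  have hstep : ∀ k, P (S (k + 1)) ≤ (1 - ε) * P (S k) := by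
    intro k
    have hσ := isStoppingTime_const F (k * N)
    have hE : MeasurableSet[hσ.measurableSpace] (S k) := by
      rw [IsStoppingTime.measurableSpace_const]; exact hS k
    have h := hY.strongMarkov _ hσ (S k) Bᶜ hE hB.compl
    have h1 : {ω : Ω | ((k * N : ℝ≥0) : WithTop ℝ≥0) ≠ ⊤} = univ :=
      eq_univ_of_forall fun _ => WithTop.coe_ne_top
    rw [h1, inter_univ] at h
    calc P (S (k + 1)) ≤ _ := measure_mono ?_
      _ = _ := h
      _ ≤ ∫⁻ ω in S k, (1 - ε) ∂P := by
        refine lintegral_mono_ae ?_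
        refine (ae_restrict_iff' (F.le _ _ (hS k))).2 ?_
        filter_upwards [hY.initial] with ω h0 hω
        refine hκ _ ?_
        -- A position outside the interval at time `k * N` would mean that an end has been visited
        -- already.
        by_contra hc
        have hω' : Y ω ∉ hitsBy (k * N) (a : ℝ) ∪ hitsBy (k * N) b := hω
        rcases mem_uIcc_or_of_notMem hy hc with h | h
        · rw [← h0] at h
          obtain ⟨v, -, hv, hva⟩ := exists_path_eq (Y ω) zero_le h
          exact hω' (Or.inl ⟨v, hv, hva⟩)
        · rw [← h0] at h
          obtain ⟨v, -, hv, hva⟩ := exists_path_eq (Y ω) zero_le h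
          exact hω' (Or.inr ⟨v, hv, hva⟩)
      _ = _ := setLIntegral_const _ _
    have hk : ((k + 1 : ℕ) : ℝ≥0) * N = k * N + N := by push_cast; ring
    intro ω hω
    have hω' : Y ω ∉ hitsBy ((k + 1 : ℕ) * N) (a : ℝ) ∪ hitsBy ((k + 1 : ℕ) * N) b := hω
    rw [hk] at hω'
    refine ⟨fun hc => hω' (hc.imp (fun h => hitsBy_mono le_self_add _ h)
      fun h => hitsBy_mono le_self_add _ h), fun hc => hω' (hc.imp ?_ ?_)⟩ <;>
    · rintro ⟨u, hu, h⟩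
      exact ⟨_, add_le_add_right hu _, h⟩
  have hpow : ∀ k, P (S k) ≤ (1 - ε) ^ k := by
    intro k
    induction k with
    | zero => simpa using prob_le_one
    | succ k ih =>
      rw [pow_succ, mul_comm]
      exact (hstep k).trans (by gcongr)
  have hlt : 1 - ε < 1 := ENNReal.sub_lt_self ENNReal.one_ne_top one_ne_zero hε.ne'
  have hlim := ENNReal.tendsto_pow_atTop_nhds_zero_of_lt_one hlt
  refine le_antisymm (ge_of_tendsto' hlim fun k => (measure_mono ?_).trans (hpow k)) zero_le
  intro ω hω hc
  exact hω (hc.imp (fun h => hitsBy_subset_hits _ _ h) fun h => hitsBy_subset_hits _ _ h)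

end IsRegularDiffusion

/-- The first time at which the path is at `a` or at `b`. -/
noncomputable def hitEither {I : Set ℝ} (a b : ℝ) (w : PathSpace I) : WithTop ℝ≥0 :=
  min (hitAfter ((0 : ℝ≥0) : WithTop ℝ≥0) a w) (hitAfter ((0 : ℝ≥0) : WithTop ℝ≥0) b w)

lemma hitEither_cases {I : Set ℝ} (a b : ℝ) (w : PathSpace I) :
    (w ∉ hits a ∪ hits b ∧ hitEither a b w = ⊤) ∨
      ∃ t : ℝ≥0, ((w.1 t : ℝ) = a ∨ (w.1 t : ℝ) = b) ∧
        (∀ u < t, (w.1 u : ℝ) ≠ a ∧ (w.1 u : ℝ) ≠ b) ∧ hitEither a b w = t := by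
  unfold hitEither
  rcases hitAfter_cases ((0 : ℝ≥0) : WithTop ℝ≥0) a w with ⟨ha, h⟩ | ⟨s, -, ha, hs, h⟩ <;>
  rcases hitAfter_cases ((0 : ℝ≥0) : WithTop ℝ≥0) b w with ⟨hb, h'⟩ | ⟨t, -, hb, ht, h'⟩ <;>
  rw [h, h']
  · refine Or.inl ⟨?_, min_self _⟩
    rintro (⟨u, hu⟩ | ⟨u, hu⟩)
    exacts [ha u (zero_le_coe u) hu, hb u (zero_le_coe u) hu]
  · exact Or.inr ⟨t, Or.inr hb, fun u hu =>
      ⟨ha u (zero_le_coe u), fun hc => (ht u (zero_le_coe u) hc).not_gt hu⟩, min_eq_right le_top⟩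
  · exact Or.inr ⟨s, Or.inl ha, fun u hu =>
      ⟨fun hc => (hs u (zero_le_coe u) hc).not_gt hu, hb u (zero_le_coe u)⟩, min_eq_left le_top⟩
  · refine Or.inr ⟨min s t, ?_, fun u hu => ⟨fun hc => ?_, fun hc => ?_⟩, ?_⟩
    · rcases min_choice s t with h | h <;> rw [h]
      exacts [Or.inl ha, Or.inr hb]
    · exact (hs u (zero_le_coe u) hc).not_gt (hu.trans_le (min_le_left _ _))
    · exact (ht u (zero_le_coe u) hc).not_gt (hu.trans_le (min_le_right _ _))
    · exact (WithTop.coe_min s t).symm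

/-! ### Construction of a scale function from exit probabilities. -/

/-- Existence of a scale function from the two-sided exit probabilities `π a b` (from `y`)
and `p a b x` (from `x`) through `b` out of `(a, b)`. -/
lemma exists_scale_of_exit_probabilities {I : Set ℝ} {y : ℝ} (π : I → I → ℝ) (p : I → I → I → ℝ)
    {a₀ b₀ : I} (ha₀ : (a₀ : ℝ) < y) (hb₀ : y < b₀)
    (hπ0 : ∀ a b : I, (a : ℝ) < y → y < b → 0 < π a b)
    (hπ1 : ∀ a b : I, (a : ℝ) < y → y < b → π a b < 1)
    (hpa : ∀ a b : I, (a : ℝ) < y → y < b → p a b a = 0)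
    (hpb : ∀ a b : I, (a : ℝ) < y → y < b → p a b b = 1)
    (hpy : ∀ a b x : I, (a : ℝ) < y → y < b → (x : ℝ) = y → p a b x = π a b)
    (hQ : ∀ a' a b b' : I, a' ≤ a → (a : ℝ) < y → y < b → b ≤ b' →
      π a' b' = (1 - π a b) * p a' b' a + π a b * p a' b' b) :
    ∃ s : I → ℝ, (∀ x : I, (x : ℝ) = y → s x = 0) ∧ (∀ x : I, (x : ℝ) < y → s x < 0) ∧
      (∀ x : I, y < x → 0 < s x) ∧ ∀ a b : I, (a : ℝ) < y → y < b → ∀ x, a ≤ x → x ≤ b →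
        p a b x = (s x - s a) / (s b - s a) := by
  classical
  -- The odds of leaving at `a` against `b`; for a scale with `s y = 0` they are `s b / (-s a)`.
  set ρ : I → I → ℝ := fun a b => (1 - π a b) / π a b with hρ
  have hρ0 : ∀ a b : I, (a : ℝ) < y → y < b → 0 < ρ a b := fun a b ha hb =>
    div_pos (sub_pos.2 (hπ1 a b ha hb)) (hπ0 a b ha hb)
  -- The odds have rank one. Seen from a larger interval `(a', b')`, they are a function of the
  -- right end divided by a function of the left end.
  have hmul : ∀ a b : I, (a : ℝ) < y → y < b → ρ a b * ρ a₀ b₀ = ρ a b₀ * ρ a₀ b := by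
    intro a b ha hb
    set a' := min a a₀
    set b' := max b b₀
    have ha' : (a' : ℝ) < y := by
      rcases min_choice a a₀ with h | h <;> simp only [a', h] <;> assumption
    have hb' : y < (b' : ℝ) := by
      rcases max_choice b b₀ with h | h <;> simp only [b', h] <;> assumption
    have hAB : ∀ α β : I, a' ≤ α → (α : ℝ) < y → y < β → β ≤ b' →
        ρ α β * (π a' b' - p a' b' α) = p a' b' β - π a' b' := by
      intro α β h1 h2 h3 h4
      have h5 := hQ a' α β b' h1 h2 h3 h4
      have h6 := (hπ0 α β h2 h3).ne'
      rw [hρ]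
      field_simp
      linear_combination h5
    -- The choice `α = a'` shows that the numerators are positive, so the denominators do not vanish
    -- either.
    have hB : ∀ β : I, y < β → β ≤ b' → 0 < p a' b' β - π a' b' := by
      intro β h3 h4
      rw [← hAB a' β le_rfl ha' h3 h4, hpa a' b' ha' hb', sub_zero]
      exact mul_pos (hρ0 _ _ ha' h3) (hπ0 _ _ ha' hb')
    have e1 := hAB a b (min_le_left _ _) ha hb (le_max_left _ _)
    have e2 := hAB a₀ b₀ (min_le_right _ _) ha₀ hb₀ (le_max_right _ _)
    have e3 := hAB a b₀ (min_le_left _ _) ha hb₀ (le_max_right _ _)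
    have e4 := hAB a₀ b (min_le_right _ _) ha₀ hb (le_max_left _ _)
    have hA : (π a' b' - p a' b' a) * (π a' b' - p a' b' a₀) ≠ 0 := by
      intro h
      rcases mul_eq_zero.1 h with h | h
      · rw [h, mul_zero] at e1
        exact (hB b hb (le_max_left _ _)).ne e1
      · rw [h, mul_zero] at e2
        exact (hB b₀ hb₀ (le_max_right _ _)).ne e2
    refine mul_right_cancel₀ hA ?_
    calc ρ a b * ρ a₀ b₀ * ((π a' b' - p a' b' a) * (π a' b' - p a' b' a₀))
        = (ρ a b * (π a' b' - p a' b' a)) * (ρ a₀ b₀ * (π a' b' - p a' b' a₀)) := by ring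
      _ = (ρ a b₀ * (π a' b' - p a' b' a)) * (ρ a₀ b * (π a' b' - p a' b' a₀)) := by
          rw [e1, e2, e3, e4]; ring
      _ = _ := by ring
  -- Normalized by `s a₀ = -1`; rank one then gives `ρ a b = s b / (-s a)` for all `a`, `b`.
  set s : I → ℝ := fun x => if y < x then ρ a₀ x else if (x : ℝ) < y then
    -(ρ a₀ b₀ / ρ x b₀) else 0 with hs
  have hsb : ∀ b : I, y < b → s b = ρ a₀ b := fun b hb => by simp [hs, hb]
  have hsa : ∀ a : I, (a : ℝ) < y → s a = -(ρ a₀ b₀ / ρ a b₀) := fun a ha => by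
    simp [hs, ha, ha.not_gt]
  have hsy : ∀ x : I, (x : ℝ) = y → s x = 0 := fun x hx => by simp [hs, hx]
  have hsb0 : ∀ b : I, y < b → 0 < s b := fun b hb => by rw [hsb b hb]; exact hρ0 _ _ ha₀ hb
  have hsa0 : ∀ a : I, (a : ℝ) < y → s a < 0 := fun a ha => by
    rw [hsa a ha, neg_lt_zero]; exact div_pos (hρ0 _ _ ha₀ hb₀) (hρ0 _ _ ha hb₀)
  have hodds : ∀ a b : I, (a : ℝ) < y → y < b → (1 - π a b) * (-s a) = π a b * s b := by
    intro a b ha hb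
    have h1 : ρ a b * (-s a) = s b := by
      rw [hsa a ha, hsb b hb, neg_neg]
      have := (hρ0 a b₀ ha hb₀).ne'
      field_simp
      rw [hmul a b ha hb, mul_comm]
    rw [← h1]
    have := (hπ0 a b ha hb).ne'
    rw [hρ]
    field_simp
  refine ⟨s, hsy, hsa0, hsb0, fun a b ha hb x hax hxb => ?_⟩
  have hpos : 0 < s b - s a := by linarith [hsa0 a ha, hsb0 b hb]
  have h0 := hodds a b ha hb
  have hπ : π a b * (s b - s a) = - s a := by linear_combination -h0
  rw [eq_div_iff hpos.ne']
  rcases lt_trichotomy (x : ℝ) y with hx | hx | hx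
  -- Apply consistency to the inner interval `(x, b)`: its right end is an exit point of `(a, b)`,
  -- so the equation is linear in the unknown `p a b x`. On the other side of `y` the inner interval
  -- is `(a, x)`.
  · have h1 := hQ a x b b hax hx hb le_rfl
    rw [hpb a b ha hb] at h1
    have h2 := hodds x b hx hb
    have h3 : π x b * (s b - s x) = - s x := by linear_combination -h2
    have h4 : (1 - π x b) ≠ 0 := (sub_pos.2 (hπ1 x b hx hb)).ne'
    have h5 : 0 < s b - s x := by linarith [hsa0 x hx, hsb0 b hb]
    refine mul_left_cancel₀ h4 ?_
    refine mul_right_cancel₀ h5.ne' ?_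
    linear_combination (s b - s x) * (hπ - (s b - s a) * h1) + (s x - s b) * h3
  · rw [hpy a b x ha hb hx, hsy x hx, hπ]; ring
  · have h1 := hQ a a x b le_rfl ha hx hxb
    rw [hpa a b ha hb] at h1
    have h2 := hodds a x ha hx
    refine mul_left_cancel₀ (hπ0 a x ha hx).ne' ?_
    linear_combination hπ - (s b - s a) * h1 + h2

/-! ### Positivity of exit probabilities and optional stopping. -/

namespace IsRegularDiffusion

variable {Ω : Type*} {mΩ : MeasurableSpace Ω} {F : Filtration ℝ≥0 mΩ} {P : Measure Ω}
  {I : Set ℝ} {y : ℝ} {κ : Kernel I (PathSpace I)} {Y : Ω → PathSpace I}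

/-- A path starting at `y ≠ a` cannot be at `a` at arbitrarily small times, by continuity at `0`. -/
lemma exists_prob_hitsBy_lt_one (hY : IsRegularDiffusion F P I y κ Y) [IsProbabilityMeasure P]
    {a : ℝ} (ha : a ≠ y) : ∃ δ > 0, P (Y ⁻¹' hitsBy δ a) < 1 := by
  by_contra! h
  have h1 : ∀ n : ℕ, ∀ᵐ ω ∂P, Y ω ∈ hitsBy (1 / (n + 1 : ℝ≥0)) a := fun n =>
    (mem_ae_iff_prob_eq_one (hY.measurable (ThresholdStopping.measurableSet_hitsBy _ _))).2
      (le_antisymm prob_le_one (h _ (by positivity)))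
  obtain ⟨ω, hω, h0⟩ := ((ae_all_iff.2 h1).and hY.initial).exists
  choose u hu hua using hω
  have hlim : Tendsto u atTop (𝓝 0) :=
    tendsto_of_tendsto_of_tendsto_of_le_of_le tendsto_const_nhds
      (tendsto_one_div_add_atTop_nhds_zero_nat (𝕜 := ℝ≥0)) (fun _ => zero_le) hu
  have h2 := ((continuous_path (Y ω)).tendsto 0).comp hlim
  have h3 : Tendsto (fun n => ((Y ω).1 (u n) : ℝ)) atTop (𝓝 a) := by
    simp only [hua]; exact tendsto_const_nhds
  exact ha ((tendsto_nhds_unique h3 h2).trans h0)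

/-- Each end of a compact interval around `y` is the exit point with positive probability. -/
lemma prob_before_pos (hY : IsRegularDiffusion F P I y κ Y) [IsProbabilityMeasure P] (a b : I)
    (hy : y ∈ uIcc (a : ℝ) b) (ha : (a : ℝ) ≠ y) (hb : (b : ℝ) ≠ y) :
    0 < P (Y ⁻¹' before b a) := by
  by_contra hc
  replace hc : P (Y ⁻¹' before b a) = 0 := nonpos_iff_eq_zero.1 (not_lt.1 hc)
  obtain ⟨δ, hδ, hlt⟩ := hY.exists_prob_hitsBy_lt_one ha
  have hσ := hY.isStoppingTime_hit a
  have hρ := hY.isStoppingTime_hitAfter hσ y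
  set σ : Ω → WithTop ℝ≥0 := fun ω => hitAfter ((0 : ℝ≥0) : WithTop ℝ≥0) (a : ℝ) (Y ω) with hσdef
  have hE : MeasurableSet[hρ.measurableSpace] {ω | σ ω ≤ δ} :=
    hσ.measurableSpace_mono hρ (fun ω => le_hitAfter _ _ _) _ (hσ.measurableSet_le' δ)
  have hEeq : P {ω | σ ω ≤ δ} = P (Y ⁻¹' hitsBy δ a) := by
    congr 1
    ext ω
    simp only [hσdef, hitAfter_le_iff]
    exact exists_congr fun u => and_congr_right fun _ => and_iff_right (zero_le_coe u)
  -- If `a` always comes first, every route to `b` goes from `y` to `a`, back to `y`, then on to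
  -- `b`. The event `σ > δ` leaves at most time `t` for the last leg and is null by assumption.
  -- Hence `q ≤ P (σ ≤ δ) * q` with a factor below one, and `q = 0`.
  have hstep : ∀ t : ℝ≥0, P (Y ⁻¹' hitsBy t b) = 0 → P (Y ⁻¹' hitsBy (t + δ) b) = 0 := by
    intro t ht
    have hm := ThresholdStopping.measurableSet_hitsBy (I := I)
    have h1 := hY.strongMarkov_hitAfter hσ ⟨y, hY.mem⟩ hE (hm (t + δ) b)
    have h2 := hY.strongMarkov_hitAfter hσ ⟨y, hY.mem⟩ hE.compl (hm t b)
    rw [← hY.law_eq (hm _ _)] at h1 h2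
    rw [ht, mul_zero] at h2
    set q := P (Y ⁻¹' hitsBy (t + δ) b)
    have hle : q ≤ P {ω | σ ω ≤ δ} * q := by
      calc q ≤ P (_ ∪ _) := measure_mono_ae ?_
        _ ≤ _ := measure_union_le _ _
        _ = _ := congrArg₂ (· + ·) h1 h2
        _ ≤ _ := by rw [add_zero]; gcongr; exact inter_subset_left
      filter_upwards [hY.initial, measure_eq_zero_iff_ae_notMem.1 hc] with ω h0 hnb ⟨u, hut, hu⟩
      have : ∃ v ≤ u, ((Y ω).1 v : ℝ) = a := by
        by_contra! hv
        exact hnb ⟨u, hu, hv⟩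
      obtain ⟨v, hvu, hva⟩ := this
      rcases hitAfter_cases ((0 : ℝ≥0) : WithTop ℝ≥0) a (Y ω) with ⟨k, -⟩ | ⟨s, -, hs, hsmin, hT⟩
      · exact absurd hva (k v (zero_le_coe _))
      have hσs : σ ω = s := hT
      obtain ⟨r, hsr, hru, hr⟩ := exists_path_eq (Y ω)
        ((hsmin v (zero_le_coe _) hva).trans hvu) (z := y) (by rwa [hs, hu])
      rcases hitAfter_cases (σ ω) y (Y ω) with ⟨k, -⟩ | ⟨r₀, hsr₀, hr₀, hrmin, hT'⟩
      · exact absurd hr (k r (hσs ▸ WithTop.coe_le_coe.2 hsr))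
      have hr₀r : r₀ ≤ r := hrmin r (hσs ▸ WithTop.coe_le_coe.2 hsr) hr
      have hne : hitAfter (σ ω) y (Y ω) ≠ ⊤ := by rw [hT']; exact WithTop.coe_ne_top
      have hsh : ((shift r₀ (Y ω)).1 (u - r₀) : ℝ) = b := by
        rw [shift_apply, add_tsub_cancel_of_le (hr₀r.trans hru), hu]
      have key : ∀ t', u - r₀ ≤ t' → shift (hitAfter (σ ω) y (Y ω)).untopA (Y ω) ∈ hitsBy t' b := by
        rw [hT']
        exact fun t' h => ⟨u - r₀, h, hsh⟩
      by_cases hd : σ ω ≤ δ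
      · exact Or.inl ⟨⟨hd, hne⟩, key _ (tsub_le_self.trans hut)⟩
      · refine Or.inr ⟨⟨hd, hne⟩, key _ ?_⟩
        rw [tsub_le_iff_right]
        refine hut.trans (add_le_add_right ?_ t)
        exact WithTop.coe_le_coe.1 ((not_le.1 hd).le.trans hsr₀)
    by_contra hq
    refine hle.not_gt ?_
    calc _ < 1 * q := ENNReal.mul_lt_mul_left hq (measure_ne_top _ _) (hEeq ▸ hlt)
      _ = q := one_mul q
  -- Iteration shows that `b` is never reached, against regularity.
  have hzero : ∀ n : ℕ, P (Y ⁻¹' hitsBy (n * δ) b) = 0 := by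
    intro n
    induction n with
    | zero =>
      refine measure_eq_zero_iff_ae_notMem.2 ?_
      filter_upwards [hY.initial] with ω h0 ⟨u, hu, hub⟩
      have : u = 0 := by simpa using hu
      rw [this, h0] at hub
      exact hb hub.symm
    | succ n ih =>
      have := hstep _ ih
      rwa [← add_one_mul, ← Nat.cast_succ] at this
  obtain ⟨n, hn⟩ := hY.exists_prob_hitsBy_pos b
  obtain ⟨k, hk⟩ := exists_nat_ge ((n : ℝ≥0) / δ)
  exact hn.ne' (measure_mono_null (preimage_mono (hitsBy_mono ((div_le_iff₀ hδ).1 hk) _)) (hzero k))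

lemma ae_hitEither_ne_top (hY : IsRegularDiffusion F P I y κ Y) [IsProbabilityMeasure P] (a b : I)
    (hy : y ∈ uIcc (a : ℝ) b) : ∀ᵐ ω ∂P, hitEither (a : ℝ) b (Y ω) ≠ ⊤ := by
  filter_upwards [hY.ae_exit a b hy] with ω h
  rcases hitEither_cases (a : ℝ) b (Y ω) with ⟨h1, -⟩ | ⟨t, -, -, h2⟩
  · exact absurd h h1
  · rw [h2]; exact WithTop.coe_ne_top

lemma isStoppingTime_hitEither (hY : IsRegularDiffusion F P I y κ Y) (a b : ℝ) :
    IsStoppingTime F fun ω => hitEither a b (Y ω) :=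
  (hY.isStoppingTime_hit a).min (hY.isStoppingTime_hit b)

/-- Optional stopping for the exit probability: `E [κ (Y_σ) (b before a)] = P (b before a)` for
stopping times `σ` up to the exit. -/
lemma lintegral_before (hY : IsRegularDiffusion F P I y κ Y) [IsProbabilityMeasure P] (a b : I)
    (hy : y ∈ uIcc (a : ℝ) b) {σ : Ω → WithTop ℝ≥0} (hσ : IsStoppingTime F σ)
    (hle : ∀ᵐ ω ∂P, σ ω ≤ hitEither (a : ℝ) b (Y ω)) :
    ∫⁻ ω, κ ((Y ω).1 (σ ω).untopA) (before b a) ∂P = P (Y ⁻¹' before b a) := by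
  have hne : ∀ᵐ ω ∂P, σ ω ≠ ⊤ := by
    filter_upwards [hle, hY.ae_hitEither_ne_top a b hy] with ω h h' using ne_top_of_le_ne_top h' h
  have h := hY.strongMarkov σ hσ univ (before b a) MeasurableSet.univ (measurableSet_before _ _)
  rw [univ_inter, setLIntegral_congr (t := univ) (by
    filter_upwards [hne] with ω h
    exact eq_true h), setLIntegral_univ] at h
  rw [← h]
  refine measure_congr ?_
  filter_upwards [hle, hne] with ω hω hne
  obtain ⟨s, hs⟩ := WithTop.ne_top_iff_exists.1 hne
  -- Neither end is visited before `σ`, so the order of the visits is the same for the path and for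
  -- its shift by `σ`.
  have hlt : ∀ u < s, ((Y ω).1 u : ℝ) ≠ a ∧ ((Y ω).1 u : ℝ) ≠ b := by
    rcases hitEither_cases (a : ℝ) b (Y ω) with ⟨h1, -⟩ | ⟨t, -, ht, h2⟩
    · exact fun u _ => ⟨fun hc => h1 (Or.inl ⟨u, hc⟩), fun hc => h1 (Or.inr ⟨u, hc⟩)⟩
    · rw [h2, ← hs, WithTop.coe_le_coe] at hω
      exact fun u hu => ht u (hu.trans_le hω)
  have hsh : shift (σ ω).untopA (Y ω) = shift s (Y ω) := by rw [← hs]; rfl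
  refine propext ⟨fun hh => ?_, fun hh => ?_⟩
  · have h1 : shift (σ ω).untopA (Y ω) ∈ before b a := hh.2
    rw [hsh] at h1
    obtain ⟨t, ht, h⟩ := h1
    refine ⟨s + t, ht, fun u hu => ?_⟩
    rcases lt_or_ge u s with hus | hsu
    · exact (hlt u hus).1
    · have := h (u - s) (tsub_le_iff_left.2 hu)
      rwa [shift_apply, add_tsub_cancel_of_le hsu] at this
  · refine ⟨hne, ?_⟩
    change shift (σ ω).untopA (Y ω) ∈ before b a
    rw [hsh]
    obtain ⟨t, ht, h⟩ := hh
    have hst : s ≤ t := not_lt.1 fun hc => (hlt t hc).2 ht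
    refine ⟨t - s, ?_, fun u hu => h (s + u) ?_⟩
    · rw [shift_apply, add_tsub_cancel_of_le hst, ht]
    · calc s + u ≤ s + (t - s) := add_le_add_right hu s
        _ = t := add_tsub_cancel_of_le hst

end IsRegularDiffusion

lemma measurable_eval {I : Set ℝ} :
    Measurable fun q : ℝ≥0 × PathSpace I => q.2.1 q.1 :=
  measurable_uncurry_of_continuous_of_measurable (u := fun (t : ℝ≥0) (w : PathSpace I) => w.1 t)
    (fun w => w.2) measurable_path'

lemma path_hitEither_of_before {I : Set ℝ} {a b : ℝ} {w : PathSpace I} (h : w ∈ before b a) :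
    (w.1 (hitEither a b w).untopA : ℝ) = b := by
  obtain ⟨t, ht, h⟩ := h
  rcases hitEither_cases a b w with ⟨h1, -⟩ | ⟨r, hr, hlt, h2⟩
  · exact absurd (Or.inr ⟨t, ht⟩) h1
  · rw [h2]
    change (w.1 r : ℝ) = b
    refine hr.resolve_left fun hra => ?_
    rcases lt_or_ge t r with htr | hrt
    · exact (hlt t htr).2 ht
    · exact h r hrt hra

lemma hitEither_comm {I : Set ℝ} (a b : ℝ) (w : PathSpace I) :
    hitEither a b w = hitEither b a w := min_comm _ _

lemma hitEither_le_hitEither {I : Set ℝ} {a b a' b' : ℝ} {w : PathSpace I}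
    (ha : a ∈ uIcc (w.1 0 : ℝ) a') (hb : b ∈ uIcc (w.1 0 : ℝ) b') :
    hitEither a b w ≤ hitEither a' b' w := by
  rcases hitEither_cases a' b' w with ⟨-, h⟩ | ⟨t, ht, -, h⟩
  · rw [h]; exact le_top
  rw [h]
  have key : ∃ u ≤ t, (w.1 u : ℝ) = a ∨ (w.1 u : ℝ) = b := by
    rcases ht with ht | ht
    · obtain ⟨v, -, hv, hva⟩ := exists_path_eq w (zero_le (a := t)) (ht ▸ ha)
      exact ⟨v, hv, Or.inl hva⟩
    · obtain ⟨v, -, hv, hva⟩ := exists_path_eq w (zero_le (a := t)) (ht ▸ hb)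
      exact ⟨v, hv, Or.inr hva⟩
  obtain ⟨u, hut, hu⟩ := key
  rcases hitEither_cases a b w with ⟨h1, -⟩ | ⟨r, -, hlt, h2⟩
  · exact absurd (hu.imp (fun h => ⟨u, h⟩) fun h => ⟨u, h⟩) h1
  · rw [h2, WithTop.coe_le_coe]
    refine le_trans (not_lt.1 fun hc => ?_) hut
    exact hu.elim (hlt u hc).1 (hlt u hc).2

/-- `s`, normalized by `s y = 0`, is a scale function of the diffusion with laws `κ`. -/
structure IsScale {I : Set ℝ} (κ : Kernel I (PathSpace I)) (y : ℝ) (s : I → ℝ) : Prop where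
  eq_zero : ∀ x : I, (x : ℝ) = y → s x = 0
  neg : ∀ x : I, (x : ℝ) < y → s x < 0
  pos : ∀ x : I, y < x → 0 < s x
  exit : ∀ a b : I, (a : ℝ) < y → y < b → ∀ x, a ≤ x → x ≤ b →
    (κ x).real (before b a) = (s x - s a) / (s b - s a)
  mono : Monotone s

/-! ### The scale function of the diffusion. -/

namespace IsRegularDiffusion

variable {Ω : Type*} {mΩ : MeasurableSpace Ω} {F : Filtration ℝ≥0 mΩ} {P : Measure Ω}
  {I : Set ℝ} {y : ℝ} {κ : Kernel I (PathSpace I)} {Y : Ω → PathSpace I}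

lemma measurable_stopped (hY : IsRegularDiffusion F P I y κ Y) {σ : Ω → WithTop ℝ≥0}
    (hσ : Measurable σ) : Measurable fun ω => (Y ω).1 (σ ω).untopA :=
  measurable_eval.comp (hσ.untopA.prodMk hY.measurable)

lemma ae_hitEither_le (hY : IsRegularDiffusion F P I y κ Y) {a b a' b' : ℝ}
    (ha : a ∈ uIcc y a') (hb : b ∈ uIcc y b') :
    ∀ᵐ ω ∂P, hitEither a b (Y ω) ≤ hitEither a' b' (Y ω) := by
  filter_upwards [hY.initial] with ω h0
  exact hitEither_le_hitEither (by rwa [h0]) (by rwa [h0])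

lemma prob_before_add (hY : IsRegularDiffusion F P I y κ Y) [IsProbabilityMeasure P] (a b : I)
    (hy : y ∈ uIcc (a : ℝ) b) (hab : (a : ℝ) ≠ b) :
    P (Y ⁻¹' before b a) + P (Y ⁻¹' before a b) = 1 := by
  rw [← measure_union (disjoint_before.preimage Y) (hY.measurable (measurableSet_before _ _)),
    ← preimage_union, before_union_before hab]
  exact (mem_ae_iff_prob_eq_one (hY.measurable ((measurableSet_hits _).union
    (measurableSet_hits _)))).1 (hY.ae_exit a b hy)

/-- `lintegral_before` at the exit from the inner interval, where the path is at `a` or at `b`. This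
is the consistency relation from which the scale is built. -/
lemma prob_before_eq (hY : IsRegularDiffusion F P I y κ Y) [IsProbabilityMeasure P]
    (a b a' b' : I) (hy : y ∈ uIcc (a : ℝ) b) (hab : (a : ℝ) ≠ b)
    (hy' : y ∈ uIcc (a' : ℝ) b') (ha : (a : ℝ) ∈ uIcc y a') (hb : (b : ℝ) ∈ uIcc y b') :
    P (Y ⁻¹' before b' a') = P (Y ⁻¹' before a b) * κ a (before b' a') +
      P (Y ⁻¹' before b a) * κ b (before b' a') := by
  rw [← hY.lintegral_before a' b' hy' (hY.isStoppingTime_hitEither a b) (hY.ae_hitEither_le ha hb)]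
  have hm1 := hY.measurable (measurableSet_before a b)
  have hm2 := hY.measurable (measurableSet_before b a)
  rw [mul_comm, mul_comm (P (Y ⁻¹' before b a)), ← lintegral_indicator_const hm1,
    ← lintegral_indicator_const hm2, ← lintegral_add_left (measurable_const.indicator hm1)]
  refine lintegral_congr_ae ?_
  filter_upwards [hY.ae_exit a b hy] with ω hω
  rw [← before_union_before hab] at hω
  rcases hω with h | h
  · have h' : Y ω ∉ before a b := disjoint_left.1 disjoint_before h
    simp only [indicator, mem_preimage, h, h', if_true, if_false, zero_add]
    rw [Subtype.ext (path_hitEither_of_before h)]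
  · have h' : Y ω ∉ before b a := disjoint_left.1 disjoint_before h
    simp only [indicator, mem_preimage, h, h', if_true, if_false, add_zero]
    rw [hitEither_comm, Subtype.ext (path_hitEither_of_before h)]

lemma exists_lt (hY : IsRegularDiffusion F P I y κ Y) : ∃ a : I, (a : ℝ) < y := by
  obtain ⟨l, u, h, hsub⟩ := mem_nhds_iff_exists_Ioo_subset.1 (mem_interior_iff_mem_nhds.1
    hY.mem_interior)
  obtain ⟨z, hz⟩ := exists_between h.1
  exact ⟨⟨z, hsub ⟨hz.1, hz.2.trans h.2⟩⟩, hz.2⟩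

lemma exists_gt (hY : IsRegularDiffusion F P I y κ Y) : ∃ b : I, y < b := by
  obtain ⟨l, u, h, hsub⟩ := mem_nhds_iff_exists_Ioo_subset.1 (mem_interior_iff_mem_nhds.1
    hY.mem_interior)
  obtain ⟨z, hz⟩ := exists_between h.2
  exact ⟨⟨z, hsub ⟨h.1.trans hz.1, hz.2⟩⟩, hz.1⟩

lemma exists_isScale (hY : IsRegularDiffusion F P I y κ Y) [IsProbabilityMeasure P] :
    ∃ s : I → ℝ, IsScale κ y s := by
  have := hY.markovKernel
  obtain ⟨a₀, ha₀⟩ := hY.exists_lt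
  obtain ⟨b₀, hb₀⟩ := hY.exists_gt
  have hmem : ∀ a b : I, (a : ℝ) < y → y < b → y ∈ uIcc (a : ℝ) b := fun a b ha hb =>
    mem_uIcc_of_le ha.le hb.le
  have hadd : ∀ a b : I, (a : ℝ) < y → y < b →
      P.real (Y ⁻¹' before a b) = 1 - P.real (Y ⁻¹' before b a) := by
    intro a b ha hb
    have h := congrArg ENNReal.toReal (hY.prob_before_add a b (hmem a b ha hb) (ha.trans hb).ne)
    rw [ENNReal.toReal_add (measure_ne_top _ _) (measure_ne_top _ _), ENNReal.toReal_one] at h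
    rw [eq_sub_iff_add_eq, add_comm]; exact h
  have hpos : ∀ a b : I, (a : ℝ) < y → y < b → 0 < P.real (Y ⁻¹' before b a) := fun a b ha hb =>
    ENNReal.toReal_pos (hY.prob_before_pos a b (hmem a b ha hb) ha.ne hb.ne').ne'
      (measure_ne_top _ _)
  obtain ⟨s, h1, h2, h3, h4⟩ := exists_scale_of_exit_probabilities (y := y)
    (fun a b : I => P.real (Y ⁻¹' before (b : ℝ) a))
    (fun a b x : I => (κ x).real (before (b : ℝ) a)) ha₀ hb₀ hpos
    (fun a b ha hb => by
      have := ENNReal.toReal_pos (hY.prob_before_pos b a (by rw [uIcc_comm]; exact hmem a b ha hb)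
        hb.ne' ha.ne).ne' (measure_ne_top _ _)
      have h2 := hadd a b ha hb
      unfold Measure.real at h2 ⊢
      linarith)
    (fun a b ha hb => by
      rw [measureReal_eq_zero_iff]
      refine measure_eq_zero_iff_ae_notMem.2 ?_
      filter_upwards [hY.start a] with w hw ⟨t, _, h⟩
      exact h 0 zero_le (by rw [hw]))
    (fun a b ha hb => by
      rw [measureReal_def, (mem_ae_iff_prob_eq_one (measurableSet_before _ _)).1,
        ENNReal.toReal_one]
      filter_upwards [hY.start b] with w hw
      refine ⟨0, by rw [hw], fun u hu => ?_⟩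
      rw [nonpos_iff_eq_zero.1 hu, hw]
      exact (ha.trans hb).ne')
    (fun a b x ha hb hx => by
      have : x = ⟨y, hY.mem⟩ := Subtype.ext hx
      simp only [measureReal_def]
      rw [hY.law_eq (measurableSet_before _ _), this])
    (fun a' a b b' ha' ha hb hb' => by
      have hb'' : y < b' := hb.trans_le hb'
      have ha'' : (a' : ℝ) < y := lt_of_le_of_lt (Subtype.coe_le_coe.2 ha') ha
      have h := congrArg ENNReal.toReal (hY.prob_before_eq a b a' b' (hmem _ _ ha hb)
        (ha.trans hb).ne (hmem _ _ ha'' hb'') (mem_uIcc_of_ge ha' ha.le) (mem_uIcc_of_le hb.le hb'))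
      rw [ENNReal.toReal_add (ENNReal.mul_ne_top (measure_ne_top _ _) (measure_ne_top _ _))
        (ENNReal.mul_ne_top (measure_ne_top _ _) (measure_ne_top _ _)), ENNReal.toReal_mul,
        ENNReal.toReal_mul] at h
      rw [← hadd a b ha hb]
      exact h)
  refine ⟨s, h1, h2, h3, h4, ?_⟩
  -- Monotonicity above `y` says that an exit probability is at most one; below `y`, that one is
  -- nonnegative.
  have hright : ∀ x x' : I, y < x → x ≤ x' → s x ≤ s x' := by
    intro x x' hx hxx'
    have h := h4 a₀ x' ha₀ (lt_of_lt_of_le hx hxx') x (ha₀.trans hx).le hxx'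
    have hle : (κ x).real (before (x' : ℝ) a₀) ≤ 1 := measureReal_le_one
    have := h2 a₀ ha₀
    have := h3 x' (lt_of_lt_of_le hx hxx')
    rw [h, div_le_one (by linarith)] at hle
    linarith
  have hleft : ∀ x x' : I, (x' : ℝ) < y → x ≤ x' → s x ≤ s x' := by
    intro x x' hx hxx'
    have hxy : (x : ℝ) < y := lt_of_le_of_lt (Subtype.coe_le_coe.2 hxx') hx
    have h := h4 x b₀ hxy hb₀ x' hxx' (hx.trans hb₀).le
    have hle : 0 ≤ (κ x').real (before (b₀ : ℝ) x) := measureReal_nonneg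
    have := h2 x hxy
    have := h3 b₀ hb₀
    rw [h, le_div_iff₀ (by linarith)] at hle
    linarith
  intro x x' hxx'
  have hxx : (x : ℝ) ≤ x' := hxx'
  rcases lt_trichotomy (x : ℝ) y with hx | hx | hx
  · rcases lt_trichotomy (x' : ℝ) y with hx' | hx' | hx'
    · exact hleft x x' hx' hxx'
    · exact (h1 x' hx').symm ▸ (h2 x hx).le
    · exact (h2 x hx).le.trans (h3 x' hx').le
  · rcases hxx.eq_or_lt with h | h
    · exact (congrArg s (Subtype.ext h)).le
    · exact (h1 x hx).symm ▸ (h3 x' (hx ▸ h)).le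
  · exact hright x x' hx hxx'

/-- Optional stopping in the scale: up to the exit from a compact interval, the stopped scale
process is bounded and has mean `0`. -/
lemma lintegral_scale (hY : IsRegularDiffusion F P I y κ Y) [IsProbabilityMeasure P] {s : I → ℝ}
    (hs : IsScale κ y s) {a b : I} (ha : (a : ℝ) < y) (hb : y < b) {σ : Ω → WithTop ℝ≥0}
    (hσ : IsStoppingTime F σ) (hle : ∀ᵐ ω ∂P, σ ω ≤ hitEither (a : ℝ) b (Y ω)) :
    ∫⁻ ω, ENNReal.ofReal (s ((Y ω).1 (σ ω).untopA)) ∂P =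
      ∫⁻ ω, ENNReal.ofReal (-s ((Y ω).1 (σ ω).untopA)) ∂P := by
  have := hY.markovKernel
  have hy : y ∈ uIcc (a : ℝ) b := mem_uIcc_of_le ha.le hb.le
  have hpos : 0 < s b - s a := by linarith [hs.neg a ha, hs.pos b hb]
  have hmem : ∀ᵐ ω ∂P, (Y ω).1 (σ ω).untopA ∈ Icc a b := by
    filter_upwards [hle, hY.initial, hY.ae_hitEither_ne_top a b hy] with ω hω h0 hne
    obtain ⟨r, hr⟩ := WithTop.ne_top_iff_exists.1 (ne_top_of_le_ne_top hne hω)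
    have hr' : (σ ω).untopA = r := by rw [← hr]; rfl
    rw [hr']
    change ((Y ω).1 r : ℝ) ∈ Icc (a : ℝ) b
    by_contra hc
    rw [← uIcc_of_le (ha.trans hb).le] at hc
    rcases hitEither_cases (a : ℝ) b (Y ω) with ⟨-, h2⟩ | ⟨t, ht, hlt, h2⟩
    · exact hne h2
    rw [h2, ← hr, WithTop.coe_le_coe] at hω
    have hrt : r < t := by
      refine hω.lt_of_ne ?_
      rintro rfl
      rcases ht with h | h <;> rw [h] at hc
      exacts [hc left_mem_uIcc, hc right_mem_uIcc]
    rcases mem_uIcc_or_of_notMem hy hc with h | h <;> rw [← h0] at h <;>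
      obtain ⟨v, -, hv, hv'⟩ := exists_path_eq (Y ω) zero_le h
    exacts [(hlt v (hv.trans_lt hrt)).1 hv', (hlt v (hv.trans_lt hrt)).2 hv']
  have hZ : Measurable fun ω => (Y ω).1 (σ ω).untopA := hY.measurable_stopped hσ.measurable'
  set Z : Ω → I := fun ω => (Y ω).1 (σ ω).untopA with hZdef
  -- On `[a, b]` the scale is an affine function of the exit probability, whose mean
  -- `lintegral_before` preserves. Its boundedness and measurability also come from there.
  have hseq : (fun ω => s (Z ω)) =ᵐ[P]
      fun ω => (κ (Z ω)).real (before (b : ℝ) a) * (s b - s a) + s a := by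
    filter_upwards [hmem] with ω hω
    rw [hs.exit a b ha hb _ hω.1 hω.2]
    field_simp
    ring
  have hκm : Measurable fun ω => κ (Z ω) (before (b : ℝ) a) :=
    (κ.measurable_coe (measurableSet_before _ _)).comp hZ
  have hκi : Integrable (fun ω => (κ (Z ω)).real (before (b : ℝ) a)) P :=
    Integrable.of_bound (C := 1) hκm.ennreal_toReal.aestronglyMeasurable
      (Eventually.of_forall fun ω => by
        rw [Real.norm_of_nonneg measureReal_nonneg]; exact measureReal_le_one)
  have hsi : Integrable (fun ω => s (Z ω)) P :=
    ((hκi.mul_const _).add (integrable_const _)).congr hseq.symm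
  have hint : ∫ ω, s (Z ω) ∂P = 0 := by
    rw [integral_congr_ae hseq, integral_add (hκi.mul_const _) (integrable_const _),
      integral_mul_const, integral_const, probReal_univ, one_smul]
    have h1 : ∫ ω, (κ (Z ω)).real (before (b : ℝ) a) ∂P = (κ ⟨y, hY.mem⟩).real (before (b : ℝ) a) := by
      rw [integral_eq_lintegral_of_nonneg_ae (Eventually.of_forall fun _ => measureReal_nonneg)
        hκm.ennreal_toReal.aestronglyMeasurable]
      simp only [measureReal_def, ENNReal.ofReal_toReal (measure_ne_top _ _)]
      rw [hZdef, hY.lintegral_before a b hy hσ hle, hY.law_eq (measurableSet_before _ _)]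
    rw [h1, hs.exit a b ha hb _ ha.le hb.le, hs.eq_zero _ rfl]
    field_simp
    ring
  rw [integral_eq_lintegral_pos_part_sub_lintegral_neg_part hsi, sub_eq_zero,
    ENNReal.toReal_eq_toReal_iff' ?_ ?_] at hint
  · exact hint
  · exact ((lintegral_mono fun ω => Real.ofReal_le_enorm _).trans_lt hsi.2).ne
  · exact ((lintegral_mono fun ω => (Real.ofReal_le_enorm _).trans_eq (enorm_neg _)).trans_lt
      hsi.2).ne

end IsRegularDiffusion

/-! ### Extension of the scale to the closure of `I`, and localization along exhaustions. -/

section Scale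

variable {I : Set ℝ} {s : I → ℝ}

/-- The positive part of `s`, extended to the extended real line. -/
noncomputable def sPos (s : I → ℝ) (x : EReal) : ℝ≥0∞ :=
  ⨆ b : {b : I // ((b : ℝ) : EReal) ≤ x}, ENNReal.ofReal (s b)

/-- The negative part of `s`, extended to the extended real line. -/
noncomputable def sNeg (s : I → ℝ) (x : EReal) : ℝ≥0∞ :=
  ⨆ a : {a : I // x ≤ ((a : ℝ) : EReal)}, ENNReal.ofReal (-s a)

lemma le_sPos {x : EReal} (b : I) (h : ((b : ℝ) : EReal) ≤ x) :
    ENNReal.ofReal (s b) ≤ sPos s x :=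
  le_iSup (fun b : {b : I // ((b : ℝ) : EReal) ≤ x} => ENNReal.ofReal (s b)) ⟨b, h⟩

lemma le_sNeg {x : EReal} (a : I) (h : x ≤ ((a : ℝ) : EReal)) :
    ENNReal.ofReal (-s a) ≤ sNeg s x :=
  le_iSup (fun a : {a : I // x ≤ ((a : ℝ) : EReal)} => ENNReal.ofReal (-s a)) ⟨a, h⟩

lemma sPos_mono : Monotone (sPos s) := fun _ _ h => iSup_le fun b => le_sPos b.1 (b.2.trans h)

lemma sNeg_anti : Antitone (sNeg s) := fun _ _ h => iSup_le fun b => le_sNeg b.1 (h.trans b.2)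

lemma measurable_sPos : Measurable (sPos s) := sPos_mono.measurable

lemma measurable_sNeg : Measurable (sNeg s) := sNeg_anti.measurable

lemma sPos_coe (hs : Monotone s) (x : I) : sPos s ((x : ℝ) : EReal) = ENNReal.ofReal (s x) :=
  le_antisymm (iSup_le fun b => ENNReal.ofReal_le_ofReal (hs (EReal.coe_le_coe_iff.1 b.2)))
    (le_sPos x le_rfl)

lemma sNeg_coe (hs : Monotone s) (x : I) : sNeg s ((x : ℝ) : EReal) = ENNReal.ofReal (-s x) :=
  le_antisymm (iSup_le fun b => ENNReal.ofReal_le_ofReal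
    (neg_le_neg (hs (EReal.coe_le_coe_iff.1 b.2))))
    (le_sNeg x le_rfl)

variable {κ : Kernel I (PathSpace I)} {y : ℝ}

lemma IsScale.sPos_eq_zero (hs : IsScale κ y s) {x : EReal} (hx : x ≤ y) : sPos s x = 0 := by
  refine nonpos_iff_eq_zero.1 (iSup_le fun b => ?_)
  have hb : ((b : I) : ℝ) ≤ y := EReal.coe_le_coe_iff.1 (b.2.trans hx)
  rw [ENNReal.ofReal_of_nonpos]
  exact hb.eq_or_lt.elim (fun h => (hs.eq_zero _ h).le) fun h => (hs.neg _ h).le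

lemma IsScale.sNeg_eq_zero (hs : IsScale κ y s) {x : EReal} (hx : (y : EReal) ≤ x) :
    sNeg s x = 0 := by
  refine nonpos_iff_eq_zero.1 (iSup_le fun b => ?_)
  have hb : y ≤ ((b : I) : ℝ) := EReal.coe_le_coe_iff.1 (hx.trans b.2)
  rw [ENNReal.ofReal_of_nonpos]
  rw [neg_nonpos]
  exact hb.eq_or_lt.elim (fun h => (hs.eq_zero _ h.symm).ge) fun h => (hs.pos _ h).le

end Scale

/-- Sequences `a`, `b` in `I` that decrease, increase from `y` to the ends of `I`. -/
structure IsExhaustion (I : Set ℝ) (y : ℝ) (a b : ℕ → I) : Prop where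
  anti : Antitone a
  mono : Monotone b
  lt : ∀ n, (a n : ℝ) < y
  gt : ∀ n, y < b n
  left : (∀ n x, a n ≤ x) ∨ ∀ x, ∃ n, a n < x
  right : (∀ n x, x ≤ b n) ∨ ∀ x, ∃ n, x < b n

namespace IsExhaustion

variable {I : Set ℝ} {y : ℝ} {a b : ℕ → I}

lemma exists_le (h : IsExhaustion I y a b) (x : I) : ∃ n, a n ≤ x :=
  h.left.elim (fun h => ⟨0, h 0 x⟩) fun h => (h x).imp fun _ => le_of_lt

lemma exists_ge (h : IsExhaustion I y a b) (x : I) : ∃ n, x ≤ b n :=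
  h.right.elim (fun h => ⟨0, h 0 x⟩) fun h => (h x).imp fun _ => le_of_lt

lemma mem_uIcc (h : IsExhaustion I y a b) (n m : ℕ) : y ∈ uIcc (a n : ℝ) (b m) :=
  mem_uIcc_of_le (h.lt n).le (h.gt m).le

end IsExhaustion

/-- An end that belongs to `I` is taken as a constant sequence; otherwise the half of `I` on that
side of `y` has no extreme point, and a monotone sequence escapes every point. -/
lemma exists_isExhaustion {I : Set ℝ} (hI : I.OrdConnected) {y : ℝ} {a₀ b₀ : I}
    (ha₀ : (a₀ : ℝ) < y) (hb₀ : y < b₀) : ∃ a b : ℕ → I, IsExhaustion I y a b := by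
  have hleft : ∃ a : ℕ → I, Antitone a ∧ (∀ n, (a n : ℝ) < y) ∧
      ((∀ n x, a n ≤ x) ∨ ∀ x, ∃ n, a n < x) := by
    by_cases h : ∃ z : I, ∀ x, z ≤ x
    · obtain ⟨z, hz⟩ := h
      exact ⟨fun _ => z, antitone_const, fun _ => lt_of_le_of_lt (Subtype.coe_le_coe.2 (hz a₀)) ha₀,
        Or.inl fun _ => hz⟩
    · push Not at h
      have : (I ∩ Iio y).OrdConnected := hI.inter ordConnected_Iio
      have : Nonempty ↥(I ∩ Iio y) := ⟨⟨a₀, a₀.2, ha₀⟩⟩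
      obtain ⟨u, hu, hlim⟩ := exists_seq_antitone_tendsto_atTop_atBot ↥(I ∩ Iio y)
      refine ⟨fun n => ⟨u n, (u n).2.1⟩, fun m n hmn => hu hmn, fun n => (u n).2.2,
        Or.inr fun x => ?_⟩
      obtain ⟨z, hz⟩ := h (min x a₀)
      have hzy : (z : ℝ) < y := lt_of_lt_of_le (Subtype.coe_lt_coe.2 hz)
        (le_trans (Subtype.coe_le_coe.2 (min_le_right x a₀)) ha₀.le)
      obtain ⟨n, hn⟩ := (hlim.eventually (eventually_le_atBot ⟨z, z.2, hzy⟩)).exists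
      exact ⟨n, lt_of_le_of_lt (show (⟨u n, _⟩ : I) ≤ z from hn) (hz.trans_le (min_le_left _ _))⟩
  have hright : ∃ b : ℕ → I, Monotone b ∧ (∀ n, y < b n) ∧
      ((∀ n x, x ≤ b n) ∨ ∀ x, ∃ n, x < b n) := by
    by_cases h : ∃ z : I, ∀ x, x ≤ z
    · obtain ⟨z, hz⟩ := h
      exact ⟨fun _ => z, monotone_const, fun _ => lt_of_lt_of_le hb₀ (Subtype.coe_le_coe.2 (hz b₀)),
        Or.inl fun _ => hz⟩
    · push Not at h
      have : (I ∩ Ioi y).OrdConnected := hI.inter ordConnected_Ioi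
      have : Nonempty ↥(I ∩ Ioi y) := ⟨⟨b₀, b₀.2, hb₀⟩⟩
      obtain ⟨u, hu, hlim⟩ := exists_seq_monotone_tendsto_atTop_atTop ↥(I ∩ Ioi y)
      refine ⟨fun n => ⟨u n, (u n).2.1⟩, fun m n hmn => hu hmn, fun n => (u n).2.2,
        Or.inr fun x => ?_⟩
      obtain ⟨z, hz⟩ := h (max x b₀)
      have hzy : y < z := lt_of_le_of_lt
        (le_trans hb₀.le (Subtype.coe_le_coe.2 (le_max_right x b₀))) (Subtype.coe_lt_coe.2 hz)
      obtain ⟨n, hn⟩ := (hlim.eventually (eventually_ge_atTop ⟨z, z.2, hzy⟩)).exists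
      exact ⟨n, lt_of_lt_of_le ((le_max_left _ _).trans_lt hz) (show z ≤ (⟨u n, _⟩ : I) from hn)⟩
  obtain ⟨a, ha1, ha2, ha3⟩ := hleft
  obtain ⟨b, hb1, hb2, hb3⟩ := hright
  exact ⟨a, b, ha1, hb1, ha2, hb2, ha3, hb3⟩

/-- The end-points of `I` are absorbing for the path `w`. -/
def Absorbed {I : Set ℝ} (w : PathSpace I) : Prop :=
  ∀ z : I, ((∀ x, z ≤ x) ∨ ∀ x, x ≤ z) → ∀ r t : ℝ≥0, r ≤ t → w.1 r = z → w.1 t = z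

lemma stoppedPath_of_le {I : Set ℝ} (w : PathSpace I) {τ : WithTop ℝ≥0} {t : ℝ≥0}
    (h : (t : WithTop ℝ≥0) ≤ τ) : stoppedPath w τ t = ((w.1 t : ℝ) : EReal) := by
  rw [stoppedPath, min_eq_left h]; rfl

lemma stoppedPath_of_ge {I : Set ℝ} (w : PathSpace I) {r t : ℝ≥0} (h : r ≤ t) :
    stoppedPath w r t = ((w.1 r : ℝ) : EReal) := by
  rw [stoppedPath, min_eq_right (WithTop.coe_le_coe.2 h)]; rfl

lemma tendsto_stoppedPath_coe {I : Set ℝ} (w : PathSpace I) (r : ℝ≥0) :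
    Tendsto (stoppedPath w r) atTop (𝓝 ((w.1 r : ℝ) : EReal)) :=
  tendsto_const_nhds.congr' (by
    filter_upwards [eventually_ge_atTop r] with t ht using (stoppedPath_of_ge w ht).symm)

/-- Along the exit times from an exhaustion of `I`, the positive and negative parts of the scale
converge to their values at the limit of the stopped path. -/
lemma tendsto_scale_stopped {I : Set ℝ} {y : ℝ} {κ : Kernel I (PathSpace I)} {s : I → ℝ}
    (hs : IsScale κ y s) {a b : ℕ → I} (hab : IsExhaustion I y a b) {w : PathSpace I}
    (h0 : (w.1 0 : ℝ) = y) (habs : Absorbed w)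
    (hT : ∀ n, hitEither (a n : ℝ) (b n) w ≠ ⊤) {τ : WithTop ℝ≥0} {L : EReal}
    (hL : Tendsto (stoppedPath w τ) atTop (𝓝 L)) :
    Tendsto (fun n => ENNReal.ofReal (s (w.1 (min τ (hitEither (a n : ℝ) (b n) w)).untopA))) atTop
      (𝓝 (sPos s L)) ∧
    Tendsto (fun n => ENNReal.ofReal (-s (w.1 (min τ (hitEither (a n : ℝ) (b n) w)).untopA))) atTop
      (𝓝 (sNeg s L)) := by
  have hTe : ∀ n, ∃ t : ℝ≥0, ((w.1 t : ℝ) = a n ∨ (w.1 t : ℝ) = b n) ∧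
      hitEither (a n : ℝ) (b n) w = t := by
    intro n
    rcases hitEither_cases (a n : ℝ) (b n) w with ⟨-, h⟩ | ⟨t, ht, -, h⟩
    exacts [absurd h (hT n), ⟨t, ht, h⟩]
  choose T hTw hTeq using hTe
  have hTmono : Monotone T := by
    intro m n hmn
    have := hitEither_le_hitEither (w := w) (a := a m) (b := b m) (a' := a n) (b' := b n)
      (by rw [h0]; exact mem_uIcc_of_ge (hab.anti hmn) (hab.lt m).le)
      (by rw [h0]; exact mem_uIcc_of_le (hab.gt m).le (hab.mono hmn))
    rw [hTeq, hTeq, WithTop.coe_le_coe] at this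
    exact this
  simp only [hTeq]
  -- If `τ` comes before some exit, the localized values are eventually constant. Otherwise they are
  -- the exit values, all of them among `a n`, `b n`.
  by_cases hA : ∃ n, τ ≤ T n
  · obtain ⟨n₀, hn₀⟩ := hA
    obtain ⟨r, rfl⟩ := WithTop.ne_top_iff_exists.1 (ne_top_of_le_ne_top WithTop.coe_ne_top hn₀)
    rw [tendsto_nhds_unique hL (tendsto_stoppedPath_coe w r), sPos_coe hs.mono, sNeg_coe hs.mono]
    have : ∀ᶠ n in atTop, (min (r : WithTop ℝ≥0) (T n)).untopA = r := by
      filter_upwards [eventually_ge_atTop n₀] with n hn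
      rw [min_eq_left (hn₀.trans (WithTop.coe_le_coe.2 (hTmono hn)))]; rfl
    constructor <;> refine tendsto_const_nhds.congr' ?_ <;> filter_upwards [this] with n hn <;>
      rw [hn]
  push Not at hA
  have hmin : ∀ n, (min τ (T n)).untopA = T n := fun n => by rw [min_eq_right (hA n).le]; rfl
  simp only [hmin]
  have hconv : Tendsto (fun n => ((w.1 (T n) : ℝ) : EReal)) atTop (𝓝 L) := by
    -- Either the path has been absorbed at an end of `I`, or the exit times tend to infinity.
    by_cases hend : ∃ n, (∀ x, w.1 (T n) ≤ x) ∨ ∀ x, x ≤ w.1 (T n)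
    · obtain ⟨n₀, hn₀⟩ := hend
      have hst : ∀ t, T n₀ ≤ t → w.1 t = w.1 (T n₀) := fun t ht => habs _ hn₀ _ _ ht rfl
      have hL' : Tendsto (stoppedPath w τ) atTop (𝓝 ((w.1 (T n₀) : ℝ) : EReal)) := by
        refine tendsto_const_nhds.congr' ?_
        filter_upwards [eventually_ge_atTop (T n₀)] with t ht
        rcases le_total (t : WithTop ℝ≥0) τ with h | h
        · rw [stoppedPath_of_le w h, hst t ht]
        · obtain ⟨r, rfl⟩ := WithTop.ne_top_iff_exists.1 (ne_top_of_le_ne_top WithTop.coe_ne_top h)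
          rw [stoppedPath_of_ge w (WithTop.coe_le_coe.1 h),
            hst r (WithTop.coe_le_coe.1 (hA n₀).le)]
      rw [tendsto_nhds_unique hL hL']
      refine tendsto_const_nhds.congr' ?_
      filter_upwards [eventually_ge_atTop n₀] with n hn
      rw [hst _ (hTmono hn)]
    · push Not at hend
      -- Up to a bounded time the path stays in a compact part of `I`, so it cannot be at `a n` or
      -- `b n` for all large `n`, unless the exhaustion is constant there; but then it would be at
      -- an end-point, which is excluded.
      have hunb : Tendsto T atTop atTop := by
        refine tendsto_atTop_atTop_of_monotone hTmono fun t => ?_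
        by_contra! hbd
        obtain ⟨p, hp, hpmin⟩ := isCompact_Icc.exists_isMinOn (s := Icc 0 t)
          ⟨0, le_rfl, zero_le⟩ (continuous_path w).continuousOn
        obtain ⟨q, hq, hqmax⟩ := isCompact_Icc.exists_isMaxOn (s := Icc 0 t)
          ⟨0, le_rfl, zero_le⟩ (continuous_path w).continuousOn
        have h1 : ∃ N, ∀ n ≥ N, (w.1 (T n) : ℝ) ≠ a n := by
          rcases hab.left with h | h
          · refine ⟨0, fun n _ hn => ?_⟩
            obtain ⟨x, hx⟩ := (hend n).1
            rw [Subtype.ext hn] at hx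
            exact (h n x).not_gt hx
          · obtain ⟨N, hN⟩ := h (w.1 p)
            refine ⟨N, fun n hn h => ?_⟩
            have h2 : (w.1 p : ℝ) ≤ w.1 (T n) := hpmin ⟨zero_le, (hbd n).le⟩
            rw [h] at h2
            exact absurd h2 (not_le.2 (lt_of_le_of_lt (hab.anti hn) hN))
        have h2 : ∃ N, ∀ n ≥ N, (w.1 (T n) : ℝ) ≠ b n := by
          rcases hab.right with h | h
          · refine ⟨0, fun n _ hn => ?_⟩
            obtain ⟨x, hx⟩ := (hend n).2
            rw [Subtype.ext hn] at hx
            exact (h n x).not_gt hx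
          · obtain ⟨N, hN⟩ := h (w.1 q)
            refine ⟨N, fun n hn h => ?_⟩
            have h2 : (w.1 (T n) : ℝ) ≤ w.1 q := hqmax ⟨zero_le, (hbd n).le⟩
            rw [h] at h2
            exact absurd h2 (not_le.2 (lt_of_lt_of_le hN (hab.mono hn)))
        obtain ⟨N1, h1⟩ := h1
        obtain ⟨N2, h2⟩ := h2
        exact (hTw (max N1 N2)).elim (h1 _ (le_max_left _ _)) (h2 _ (le_max_right _ _))
      refine (hL.comp hunb).congr fun n => ?_
      exact stoppedPath_of_le w (hA n).le
  -- The side of `L` decides which threshold is hit for large `n`. The value at `L` is the supremum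
  -- along the exhaustion because the sequence gets to or past each point of `I` on that side. `L =
  -- y` is impossible, as exit values stay outside `(a 0, b 0)`.
  rcases lt_trichotomy L (y : EReal) with hLy | hLy | hLy
  · have hev : ∀ᶠ n in atTop, w.1 (T n) = a n := by
      filter_upwards [hconv.eventually (eventually_lt_nhds hLy)] with n hn
      refine Subtype.ext ((hTw n).resolve_right fun h => ?_)
      rw [h, EReal.coe_lt_coe_iff] at hn
      exact hn.not_gt (hab.gt n)
    have hlim : Tendsto (fun n => ((a n : ℝ) : EReal)) atTop (𝓝 L) :=
      hconv.congr' (by filter_upwards [hev] with n hn; rw [hn])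
    have hLa : ∀ n, L ≤ ((a n : ℝ) : EReal) := fun n =>
      (show Antitone fun n => ((a n : ℝ) : EReal) from
        fun i j hij => EReal.coe_le_coe_iff.2 (hab.anti hij)).le_of_tendsto hlim n
    constructor
    · rw [hs.sPos_eq_zero hLy.le]
      refine tendsto_const_nhds.congr' ?_
      filter_upwards [hev] with n hn
      rw [hn, ENNReal.ofReal_of_nonpos (hs.neg _ (hab.lt n)).le]
    · have hmono : Monotone fun n => ENNReal.ofReal (-s (a n)) := fun i j hij =>
        ENNReal.ofReal_le_ofReal (neg_le_neg (hs.mono (hab.anti hij)))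
      have hsup : sNeg s L = ⨆ n, ENNReal.ofReal (-s (a n)) := by
        refine le_antisymm (iSup_le fun x => ?_)
          (iSup_le fun n => le_sNeg (a n) (hLa n))
        obtain ⟨n, hn⟩ := hab.exists_le x.1
        exact le_iSup_of_le n (ENNReal.ofReal_le_ofReal (neg_le_neg (hs.mono hn)))
      rw [hsup]
      refine (tendsto_atTop_iSup hmono).congr' ?_
      filter_upwards [hev] with n hn
      rw [hn]
  · exfalso
    have h1 : ((a 0 : ℝ) : EReal) < L := hLy ▸ EReal.coe_lt_coe_iff.2 (hab.lt 0)
    have h2 : L < ((b 0 : ℝ) : EReal) := hLy ▸ EReal.coe_lt_coe_iff.2 (hab.gt 0)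
    obtain ⟨n, hn1, hn2⟩ := ((hconv.eventually (eventually_gt_nhds h1)).and
      (hconv.eventually (eventually_lt_nhds h2))).exists
    rw [EReal.coe_lt_coe_iff] at hn1 hn2
    rcases hTw n with h | h
    · exact hn1.not_ge (h ▸ hab.anti (Nat.zero_le n))
    · exact hn2.not_ge (h ▸ hab.mono (Nat.zero_le n))
  · have hev : ∀ᶠ n in atTop, w.1 (T n) = b n := by
      filter_upwards [hconv.eventually (eventually_gt_nhds hLy)] with n hn
      refine Subtype.ext ((hTw n).resolve_left fun h => ?_)
      rw [h, EReal.coe_lt_coe_iff] at hn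
      exact hn.not_gt (hab.lt n)
    have hlim : Tendsto (fun n => ((b n : ℝ) : EReal)) atTop (𝓝 L) :=
      hconv.congr' (by filter_upwards [hev] with n hn; rw [hn])
    have hLb : ∀ n, ((b n : ℝ) : EReal) ≤ L := fun n =>
      (show Monotone fun n => ((b n : ℝ) : EReal) from
        fun i j hij => EReal.coe_le_coe_iff.2 (hab.mono hij)).ge_of_tendsto hlim n
    constructor
    · have hmono : Monotone fun n => ENNReal.ofReal (s (b n)) := fun i j hij =>
        ENNReal.ofReal_le_ofReal (hs.mono (hab.mono hij))
      have hsup : sPos s L = ⨆ n, ENNReal.ofReal (s (b n)) := by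
        refine le_antisymm (iSup_le fun x => ?_)
          (iSup_le fun n => le_sPos (b n) (hLb n))
        obtain ⟨n, hn⟩ := hab.exists_ge x.1
        exact le_iSup_of_le n (ENNReal.ofReal_le_ofReal (hs.mono hn))
      rw [hsup]
      refine (tendsto_atTop_iSup hmono).congr' ?_
      filter_upwards [hev] with n hn
      rw [hn]
    · rw [hs.sNeg_eq_zero hLy.le]
      refine tendsto_const_nhds.congr' ?_
      filter_upwards [hev] with n hn
      rw [hn, ENNReal.ofReal_of_nonpos (neg_nonpos.2 (hs.pos _ (hab.gt n)).le)]

/-! ### The mean of the scale at a general stopping time. -/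

namespace IsRegularDiffusion

variable {Ω : Type*} {mΩ : MeasurableSpace Ω} {F : Filtration ℝ≥0 mΩ} {P : Measure Ω}
  {I : Set ℝ} {y : ℝ} {κ : Kernel I (PathSpace I)} {Y : Ω → PathSpace I}

/-- At most two points of `I` are extreme, so the null sets for the individual end-points can be
united. -/
lemma ae_absorbed_all (hY : IsRegularDiffusion F P I y κ Y) : ∀ᵐ ω ∂P, Absorbed (Y ω) := by
  have hc : {z : I | (∀ x, z ≤ x) ∨ ∀ x, x ≤ z}.Countable := by
    refine Countable.union (s := {z : I | ∀ x, z ≤ x}) (t := {z : I | ∀ x, x ≤ z}) ?_ ?_ <;>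
    exact Subsingleton.countable fun p hp q hq => le_antisymm (by first | exact hp q | exact hq p)
      (by first | exact hq p | exact hp q)
  have h : ∀ᵐ ω ∂P, ∀ z ∈ {z : I | (∀ x, z ≤ x) ∨ ∀ x, x ≤ z}, ∀ r t : ℝ≥0, r ≤ t →
      (Y ω).1 r = z → (Y ω).1 t = z := by
    refine (ae_ball_iff hc).2 fun z hz => ?_
    have hzi : (z : ℝ) ∉ interior I := by
      intro hzi
      obtain ⟨l, u, hlu, hsub⟩ := mem_nhds_iff_exists_Ioo_subset.1 (mem_interior_iff_mem_nhds.1 hzi)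
      rcases hz with hz | hz
      · obtain ⟨v, hv⟩ := exists_between hlu.1
        exact (Subtype.coe_le_coe.2 (hz ⟨v, hsub ⟨hv.1, hv.2.trans hlu.2⟩⟩)).not_gt hv.2
      · obtain ⟨v, hv⟩ := exists_between hlu.2
        exact (Subtype.coe_le_coe.2 (hz ⟨v, hsub ⟨hlu.1.trans hv.1, hv.2⟩⟩)).not_gt hv.1
    filter_upwards [hY.ae_absorbed z hzi] with ω h r t hrt hr
    exact Subtype.ext (h r t hrt (congrArg _ hr))
  exact h

lemma exists_isExhaustion (hY : IsRegularDiffusion F P I y κ Y) :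
    ∃ a b : ℕ → I, IsExhaustion I y a b := by
  obtain ⟨a₀, ha₀⟩ := hY.exists_lt
  obtain ⟨b₀, hb₀⟩ := hY.exists_gt
  exact ThresholdStopping.exists_isExhaustion hY.ordConnected ha₀ hb₀

lemma ae_tendsto_scale (hY : IsRegularDiffusion F P I y κ Y) [IsProbabilityMeasure P] {s : I → ℝ}
    (hs : IsScale κ y s) {a b : ℕ → I} (hab : IsExhaustion I y a b) {τ : Ω → WithTop ℝ≥0}
    (hτ : τ ∈ stoppingTimes F P Y) : ∀ᵐ ω ∂P,
    Tendsto (fun n => ENNReal.ofReal (s ((Y ω).1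
      (min (τ ω) (hitEither (a n : ℝ) (b n) (Y ω))).untopA))) atTop (𝓝 (sPos s (stoppedAt Y τ ω))) ∧
    Tendsto (fun n => ENNReal.ofReal (-s ((Y ω).1
      (min (τ ω) (hitEither (a n : ℝ) (b n) (Y ω))).untopA))) atTop
        (𝓝 (sNeg s (stoppedAt Y τ ω))) := by
  filter_upwards [hτ.2, hY.initial, hY.ae_absorbed_all,
    ae_all_iff.2 fun n => hY.ae_hitEither_ne_top (a n) (b n) (hab.mem_uIcc n n)]
    with ω ⟨L, hL⟩ h0 habs hT
  rw [stoppedAt, hL.limUnder_eq]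
  exact tendsto_scale_stopped hs hab h0 habs hT hL

lemma isStoppingTime_min_hitEither (hY : IsRegularDiffusion F P I y κ Y) {τ : Ω → WithTop ℝ≥0}
    (hτ : τ ∈ stoppingTimes F P Y) (a b : ℝ) :
    IsStoppingTime F fun ω => min (τ ω) (hitEither a b (Y ω)) :=
  hτ.1.min (hY.isStoppingTime_hitEither a b)

lemma measurable_sPos_stopped (hY : IsRegularDiffusion F P I y κ Y) {s : I → ℝ}
    (hs : Monotone s) {σ : Ω → WithTop ℝ≥0} (hσ : IsStoppingTime F σ) :
    Measurable fun ω => ENNReal.ofReal (s ((Y ω).1 (σ ω).untopA)) := by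
  simp only [← sPos_coe hs]
  exact measurable_sPos.comp (measurable_coe_real_ereal.comp
    (measurable_subtype_coe.comp (hY.measurable_stopped hσ.measurable')))

lemma measurable_sNeg_stopped (hY : IsRegularDiffusion F P I y κ Y) {s : I → ℝ}
    (hs : Monotone s) {σ : Ω → WithTop ℝ≥0} (hσ : IsStoppingTime F σ) :
    Measurable fun ω => ENNReal.ofReal (-s ((Y ω).1 (σ ω).untopA)) := by
  simp only [← sNeg_coe hs]
  exact measurable_sNeg.comp (measurable_coe_real_ereal.comp
    (measurable_subtype_coe.comp (hY.measurable_stopped hσ.measurable')))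

/-- If the scale is bounded above along the localized stopped process, then
`E [s⁻(Y_τ)] ≤ E [s⁺(Y_τ)]`. -/
lemma lintegral_sNeg_le (hY : IsRegularDiffusion F P I y κ Y) [IsProbabilityMeasure P] {s : I → ℝ}
    (hs : IsScale κ y s) {a b : ℕ → I} (hab : IsExhaustion I y a b) {τ : Ω → WithTop ℝ≥0}
    (hτ : τ ∈ stoppingTimes F P Y) {C : ℝ≥0∞} (hC : C ≠ ⊤)
    (hb : ∀ n, ∀ᵐ ω ∂P, ENNReal.ofReal (s ((Y ω).1
      (min (τ ω) (hitEither (a n : ℝ) (b n) (Y ω))).untopA)) ≤ C) :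
    ∫⁻ ω, sNeg s (stoppedAt Y τ ω) ∂P ≤ ∫⁻ ω, sPos s (stoppedAt Y τ ω) ∂P := by
  have hlim := hY.ae_tendsto_scale hs hab hτ
  have hσ := fun n => hY.isStoppingTime_min_hitEither hτ (a n : ℝ) (b n)
  -- Dominated convergence handles the bounded positive part and Fatou the negative part;
  -- `lintegral_scale` equates the two at each localized time.
  have hdom := tendsto_lintegral_of_dominated_convergence (μ := P) (fun _ => C)
    (fun n => hY.measurable_sPos_stopped hs.mono (hσ n)) hb
    (by rw [lintegral_const, measure_univ, mul_one]; exact hC) (hlim.mono fun ω h => h.1)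
  calc ∫⁻ ω, sNeg s (stoppedAt Y τ ω) ∂P = ∫⁻ ω, liminf (fun n => ENNReal.ofReal (-s ((Y ω).1
      (min (τ ω) (hitEither (a n : ℝ) (b n) (Y ω))).untopA))) atTop ∂P :=
        lintegral_congr_ae (hlim.mono fun ω h => h.2.liminf_eq.symm)
    _ ≤ _ := lintegral_liminf_le fun n => hY.measurable_sNeg_stopped hs.mono (hσ n)
    _ = liminf (fun n => ∫⁻ ω, ENNReal.ofReal (s ((Y ω).1
      (min (τ ω) (hitEither (a n : ℝ) (b n) (Y ω))).untopA)) ∂P) atTop := by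
        congr 1
        funext n
        exact (hY.lintegral_scale hs (hab.lt n) (hab.gt n) (hσ n)
          (Eventually.of_forall fun _ => min_le_right _ _)).symm
    _ = _ := hdom.liminf_eq

/-- If the scale is bounded below along the localized stopped process, then
`E [s⁺(Y_τ)] ≤ E [s⁻(Y_τ)]`. -/
lemma lintegral_sPos_le (hY : IsRegularDiffusion F P I y κ Y) [IsProbabilityMeasure P] {s : I → ℝ}
    (hs : IsScale κ y s) {a b : ℕ → I} (hab : IsExhaustion I y a b) {τ : Ω → WithTop ℝ≥0}
    (hτ : τ ∈ stoppingTimes F P Y) {C : ℝ≥0∞} (hC : C ≠ ⊤)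
    (hb : ∀ n, ∀ᵐ ω ∂P, ENNReal.ofReal (-s ((Y ω).1
      (min (τ ω) (hitEither (a n : ℝ) (b n) (Y ω))).untopA)) ≤ C) :
    ∫⁻ ω, sPos s (stoppedAt Y τ ω) ∂P ≤ ∫⁻ ω, sNeg s (stoppedAt Y τ ω) ∂P := by
  have hlim := hY.ae_tendsto_scale hs hab hτ
  have hσ := fun n => hY.isStoppingTime_min_hitEither hτ (a n : ℝ) (b n)
  have hdom := tendsto_lintegral_of_dominated_convergence (μ := P) (fun _ => C)
    (fun n => hY.measurable_sNeg_stopped hs.mono (hσ n)) hb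
    (by rw [lintegral_const, measure_univ, mul_one]; exact hC) (hlim.mono fun ω h => h.2)
  calc ∫⁻ ω, sPos s (stoppedAt Y τ ω) ∂P = ∫⁻ ω, liminf (fun n => ENNReal.ofReal (s ((Y ω).1
      (min (τ ω) (hitEither (a n : ℝ) (b n) (Y ω))).untopA))) atTop ∂P :=
        lintegral_congr_ae (hlim.mono fun ω h => h.1.liminf_eq.symm)
    _ ≤ _ := lintegral_liminf_le fun n => hY.measurable_sPos_stopped hs.mono (hσ n)
    _ = liminf (fun n => ∫⁻ ω, ENNReal.ofReal (-s ((Y ω).1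
      (min (τ ω) (hitEither (a n : ℝ) (b n) (Y ω))).untopA)) ∂P) atTop := by
        congr 1
        funext n
        exact hY.lintegral_scale hs (hab.lt n) (hab.gt n) (hσ n)
          (Eventually.of_forall fun _ => min_le_right _ _)
    _ = _ := hdom.liminf_eq

end IsRegularDiffusion

/-- The left end-point of `I` in the extended real line. -/
noncomputable def leftEnd (I : Set ℝ) : EReal := sInf (Real.toEReal '' I)

/-- The right end-point of `I` in the extended real line. -/
noncomputable def rightEnd (I : Set ℝ) : EReal := sSup (Real.toEReal '' I)

lemma leftEnd_le {I : Set ℝ} (x : I) : leftEnd I ≤ ((x : ℝ) : EReal) :=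
  sInf_le (mem_image_of_mem _ x.2)

lemma le_rightEnd {I : Set ℝ} (x : I) : ((x : ℝ) : EReal) ≤ rightEnd I :=
  le_sSup (mem_image_of_mem _ x.2)

lemma exists_coe_lt_of_leftEnd_lt {I : Set ℝ} {c : EReal} (h : leftEnd I < c) :
    ∃ x : I, ((x : ℝ) : EReal) < c := by
  obtain ⟨_, ⟨x, hx, rfl⟩, hlt⟩ := sInf_lt_iff.1 h
  exact ⟨⟨x, hx⟩, hlt⟩

lemma exists_lt_coe_of_lt_rightEnd {I : Set ℝ} {c : EReal} (h : c < rightEnd I) :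
    ∃ x : I, c < ((x : ℝ) : EReal) := by
  obtain ⟨_, ⟨x, hx, rfl⟩, hlt⟩ := lt_sSup_iff.1 h
  exact ⟨⟨x, hx⟩, hlt⟩

/-! ### Paths approaching the ends of `I`. -/

section Paths

variable {I : Set ℝ}

lemma exists_min_path (w : PathSpace I) (t : ℝ≥0) : ∃ p : I, ∀ u ≤ t, p ≤ w.1 u := by
  obtain ⟨p, -, h⟩ := isCompact_Icc.exists_isMinOn (s := Icc 0 t) ⟨0, le_rfl, zero_le⟩
    (continuous_path w).continuousOn
  exact ⟨w.1 p, fun u hu => h ⟨zero_le, hu⟩⟩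

lemma exists_max_path (w : PathSpace I) (t : ℝ≥0) : ∃ p : I, ∀ u ≤ t, w.1 u ≤ p := by
  obtain ⟨p, -, h⟩ := isCompact_Icc.exists_isMaxOn (s := Icc 0 t) ⟨0, le_rfl, zero_le⟩
    (continuous_path w).continuousOn
  exact ⟨w.1 p, fun u hu => h ⟨zero_le, hu⟩⟩

variable {y : ℝ} {a b : ℕ → I}

lemma IsExhaustion.eventually_lt (hab : IsExhaustion I y a b) (h : ∀ x, ∃ n, a n < x) (x : I) :
    ∀ᶠ n in atTop, a n < x := by
  obtain ⟨n, hn⟩ := h x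
  filter_upwards [eventually_ge_atTop n] with m hm using (hab.anti hm).trans_lt hn

lemma IsExhaustion.eventually_gt (hab : IsExhaustion I y a b) (h : ∀ x, ∃ n, x < b n) (x : I) :
    ∀ᶠ n in atTop, x < b n := by
  obtain ⟨n, hn⟩ := h x
  filter_upwards [eventually_ge_atTop n] with m hm using hn.trans_le (hab.mono hm)

/-- Up to the visit to `d` the path has a minimum in `I`, and `a n` is eventually below it. -/
lemma IsExhaustion.eventually_before_left (hab : IsExhaustion I y a b)
    (h : ∀ x, ∃ n, a n < x) {d : ℝ} {w : PathSpace I} (hw : w ∈ hits d) :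
    ∀ᶠ n in atTop, w ∈ before d (a n) := by
  obtain ⟨t, ht⟩ := hw
  obtain ⟨p, hp⟩ := exists_min_path w t
  filter_upwards [hab.eventually_lt h p] with n hn
  exact ⟨t, ht, fun u hu hc => (hp u hu).not_gt (Subtype.ext hc ▸ hn)⟩

lemma IsExhaustion.eventually_before_right (hab : IsExhaustion I y a b)
    (h : ∀ x, ∃ n, x < b n) {d : ℝ} {w : PathSpace I} (hw : w ∈ hits d) :
    ∀ᶠ n in atTop, w ∈ before d (b n) := by
  obtain ⟨t, ht⟩ := hw
  obtain ⟨p, hp⟩ := exists_max_path w t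
  filter_upwards [hab.eventually_gt h p] with n hn
  exact ⟨t, ht, fun u hu hc => (hp u hu).not_gt (Subtype.ext hc ▸ hn)⟩

/-- A path that passes every `a n` does so at arbitrarily large times. -/
lemma IsExhaustion.frequently_left (hab : IsExhaustion I y a b) {w : PathSpace I}
    (habs : Absorbed w) (hw : ∀ n, w ∈ hits (a n)) (t : ℝ≥0) (n : ℕ) :
    ∃ u ≥ t, w.1 u ≤ a n := by
  rcases hab.left with h | h
  · obtain ⟨u, hu⟩ := hw n
    refine ⟨max t u, le_max_left _ _, ?_⟩
    rw [habs (a n) (Or.inl (h n)) u _ (le_max_right _ _) (Subtype.ext hu)]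
  · obtain ⟨p, hp⟩ := exists_min_path w t
    obtain ⟨m, hm⟩ := ((hab.eventually_lt h p).and (eventually_ge_atTop n)).exists
    obtain ⟨u, hu⟩ := hw m
    refine ⟨u, ?_, ?_⟩
    · by_contra hc
      exact (hp u (not_le.1 hc).le).not_gt (Subtype.ext hu ▸ hm.1)
    · rw [Subtype.ext hu]; exact hab.anti hm.2

lemma IsExhaustion.frequently_right (hab : IsExhaustion I y a b) {w : PathSpace I}
    (habs : Absorbed w) (hw : ∀ n, w ∈ hits (b n)) (t : ℝ≥0) (n : ℕ) :
    ∃ u ≥ t, b n ≤ w.1 u := by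
  rcases hab.right with h | h
  · obtain ⟨u, hu⟩ := hw n
    refine ⟨max t u, le_max_left _ _, ?_⟩
    rw [habs (b n) (Or.inr (h n)) u _ (le_max_right _ _) (Subtype.ext hu)]
  · obtain ⟨p, hp⟩ := exists_max_path w t
    obtain ⟨m, hm⟩ := ((hab.eventually_gt h p).and (eventually_ge_atTop n)).exists
    obtain ⟨u, hu⟩ := hw m
    refine ⟨u, ?_, ?_⟩
    · by_contra hc
      exact (hp u (not_le.1 hc).le).not_gt (Subtype.ext hu ▸ hm.1)
    · rw [Subtype.ext hu]; exact hab.mono hm.2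

/-- Once the path is at or below `a k` and no longer visits `a k`, continuity keeps it below. Every
level is treated by some `k`. -/
lemma IsExhaustion.tendsto_leftEnd (hab : IsExhaustion I y a b) {w : PathSpace I}
    (habs : Absorbed w) (hw : ∀ n, w ∈ hits (a n))
    (hret : ∀ k, ∃ t : ℝ≥0, ∀ u ≥ t, w.1 u ≠ a k) (h : ∀ x, ∃ n, a n < x) :
    Tendsto (fun t => ((w.1 t : ℝ) : EReal)) atTop (𝓝 (leftEnd I)) := by
  refine tendsto_order.2 ⟨fun c hc => Eventually.of_forall fun t => hc.trans_le (leftEnd_le _),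
    fun c hc => ?_⟩
  obtain ⟨x, hx⟩ := exists_coe_lt_of_leftEnd_lt hc
  obtain ⟨k, hk⟩ := h x
  obtain ⟨t, ht⟩ := hret k
  obtain ⟨u, hut, hu⟩ := hab.frequently_left habs hw t k
  filter_upwards [eventually_ge_atTop u] with v hv
  refine lt_trans (EReal.coe_lt_coe_iff.2 ?_) hx
  by_contra hc
  have h1 : (w.1 u : ℝ) ≤ a k := hu
  have h2 : (a k : ℝ) < x := hk
  obtain ⟨r, hr, -, hra⟩ := exists_path_eq w hv (mem_uIcc_of_le h1 (h2.le.trans (not_lt.1 hc)))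
  exact ht r (le_trans hut hr) (Subtype.ext hra)

lemma IsExhaustion.tendsto_rightEnd (hab : IsExhaustion I y a b) {w : PathSpace I}
    (habs : Absorbed w) (hw : ∀ n, w ∈ hits (b n))
    (hret : ∀ k, ∃ t : ℝ≥0, ∀ u ≥ t, w.1 u ≠ b k) (h : ∀ x, ∃ n, x < b n) :
    Tendsto (fun t => ((w.1 t : ℝ) : EReal)) atTop (𝓝 (rightEnd I)) := by
  refine tendsto_order.2 ⟨fun c hc => ?_,
    fun c hc => Eventually.of_forall fun t => (le_rightEnd _).trans_lt hc⟩
  obtain ⟨x, hx⟩ := exists_lt_coe_of_lt_rightEnd hc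
  obtain ⟨k, hk⟩ := h x
  obtain ⟨t, ht⟩ := hret k
  obtain ⟨u, hut, hu⟩ := hab.frequently_right habs hw t k
  filter_upwards [eventually_ge_atTop u] with v hv
  refine lt_trans hx (EReal.coe_lt_coe_iff.2 ?_)
  by_contra hc
  have h1 : (b k : ℝ) ≤ w.1 u := hu
  have h2 : (x : ℝ) < b k := hk
  obtain ⟨r, hr, -, hra⟩ := exists_path_eq w hv (mem_uIcc_of_ge ((not_lt.1 hc).trans h2.le) h1)
  exact ht r (le_trans hut hr) (Subtype.ext hra)

end Paths

/-- Almost sure properties of the paths of the diffusion: they leave the members of an exhaustion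
`(a n, b n)`, are absorbed at the end-points that belong to `I`, and converge to an inaccessible
end-point at a finite distance in scale when they approach it. -/
structure GoodPath {I : Set ℝ} (y : ℝ) (s : I → ℝ) (a b : ℕ → I) (w : PathSpace I) : Prop where
  start : (w.1 0 : ℝ) = y
  absorbed : Absorbed w
  exit : ∀ n, w ∈ hits (a n) ∪ hits (b n)
  hits_right : sNeg s (leftEnd I) = ⊤ → ∀ n, w ∈ hits (b n)
  hits_left : sPos s (rightEnd I) = ⊤ → ∀ n, w ∈ hits (a n)
  tendsto_left : (∀ x, ∃ n, a n < x) → sNeg s (leftEnd I) ≠ ⊤ → (∀ n, w ∈ hits (a n)) →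
    Tendsto (fun t => ((w.1 t : ℝ) : EReal)) atTop (𝓝 (leftEnd I))
  tendsto_right : (∀ x, ∃ n, x < b n) → sPos s (rightEnd I) ≠ ⊤ → (∀ n, w ∈ hits (b n)) →
    Tendsto (fun t => ((w.1 t : ℝ) : EReal)) atTop (𝓝 (rightEnd I))

/-! ### Boundary behaviour of the diffusion. -/

namespace IsRegularDiffusion

variable {Ω : Type*} {mΩ : MeasurableSpace Ω} {F : Filtration ℝ≥0 mΩ} {P : Measure Ω}
  {I : Set ℝ} {y : ℝ} {κ : Kernel I (PathSpace I)} {Y : Ω → PathSpace I}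

lemma prob_before_mul (hY : IsRegularDiffusion F P I y κ Y) [IsProbabilityMeasure P] {s : I → ℝ}
    (hs : IsScale κ y s) {a b : I} (ha : (a : ℝ) < y) (hb : y < b) :
    P (Y ⁻¹' before a b) * ENNReal.ofReal (-s a) = P (Y ⁻¹' before b a) * ENNReal.ofReal (s b) := by
  have := hY.markovKernel
  have hsa := hs.neg a ha
  have hsb := hs.pos b hb
  have h1 : P (Y ⁻¹' before b a) = ENNReal.ofReal (-s a / (s b - s a)) := by
    have h := hs.exit a b ha hb ⟨y, hY.mem⟩ ha.le hb.le
    rw [hs.eq_zero _ rfl, zero_sub] at h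
    rw [hY.law_eq (measurableSet_before _ _), ← h, measureReal_def,
      ENNReal.ofReal_toReal (measure_ne_top _ _)]
  have h2 : P (Y ⁻¹' before a b) = ENNReal.ofReal (s b / (s b - s a)) := by
    have h := hY.prob_before_add a b (mem_uIcc_of_le ha.le hb.le) (ha.trans hb).ne
    have h3 : P (Y ⁻¹' before a b) = 1 - P (Y ⁻¹' before b a) :=
      ENNReal.eq_sub_of_add_eq (measure_ne_top _ _) (by rw [add_comm]; exact h)
    rw [h3, h1, ← ENNReal.ofReal_one, ← ENNReal.ofReal_sub _ (div_nonneg (by linarith) (by linarith))]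
    congr 1
    have : s b - s a ≠ 0 := by linarith
    field_simp
    ring
  rw [h1, h2, ← ENNReal.ofReal_mul (div_nonneg (by linarith) (by linarith)),
    ← ENNReal.ofReal_mul (div_nonneg (by linarith) (by linarith))]
  congr 1
  ring

/-- If the left end of `I` is at infinite distance in scale, all points above `y` are reached. -/
lemma ae_hits_right (hY : IsRegularDiffusion F P I y κ Y) [IsProbabilityMeasure P] {s : I → ℝ}
    (hs : IsScale κ y s) (h : sNeg s (leftEnd I) = ⊤) {b : I} (hb : y < b) :
    ∀ᵐ ω ∂P, Y ω ∈ hits b := by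
  -- Missing `b` forces the exit from `(a, b)` at `a`, of probability at most `s b / (-s a)`; this
  -- tends to zero as `-s a` becomes unbounded.
  have hle : ∀ a : I, P {ω | Y ω ∉ hits b} * ENNReal.ofReal (-s a) ≤ ENNReal.ofReal (s b) := by
    intro a
    rcases lt_or_ge (a : ℝ) y with ha | ha
    · calc _ ≤ P (Y ⁻¹' before a b) * ENNReal.ofReal (-s a) := by
            refine mul_le_mul_left (measure_mono_ae ?_) _
            filter_upwards [hY.ae_exit a b (mem_uIcc_of_le ha.le hb.le)] with ω h1 h2
            rw [← before_union_before (ha.trans hb).ne] at h1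
            exact h1.resolve_left fun h3 => h2 (before_subset_hits _ _ h3)
        _ = _ := hY.prob_before_mul hs ha hb
        _ ≤ 1 * ENNReal.ofReal (s b) := by gcongr; exact prob_le_one
        _ = _ := one_mul _
    · have : 0 ≤ s a := ha.eq_or_lt.elim (fun h => (hs.eq_zero a h.symm).ge) fun h => (hs.pos a h).le
      rw [ENNReal.ofReal_of_nonpos (neg_nonpos.2 this), mul_zero]
      exact zero_le
  have hsup : P {ω | Y ω ∉ hits b} * sNeg s (leftEnd I) ≤ ENNReal.ofReal (s b) := by
    rw [sNeg, ENNReal.mul_iSup]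
    exact iSup_le fun a => hle a
  rw [h] at hsup
  by_contra hc
  rw [ENNReal.mul_top (show P {ω | Y ω ∉ hits (b : ℝ)} ≠ 0 from hc)] at hsup
  exact ENNReal.ofReal_ne_top (top_le_iff.1 hsup)

/-- If the right end of `I` is at infinite distance in scale, all points below `y` are reached. -/
lemma ae_hits_left (hY : IsRegularDiffusion F P I y κ Y) [IsProbabilityMeasure P] {s : I → ℝ}
    (hs : IsScale κ y s) (h : sPos s (rightEnd I) = ⊤) {a : I} (ha : (a : ℝ) < y) :
    ∀ᵐ ω ∂P, Y ω ∈ hits a := by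
  have hle : ∀ b : I, P {ω | Y ω ∉ hits a} * ENNReal.ofReal (s b) ≤ ENNReal.ofReal (-s a) := by
    intro b
    rcases lt_or_ge y (b : ℝ) with hb | hb
    · calc _ ≤ P (Y ⁻¹' before b a) * ENNReal.ofReal (s b) := by
            refine mul_le_mul_left (measure_mono_ae ?_) _
            filter_upwards [hY.ae_exit a b (mem_uIcc_of_le ha.le hb.le)] with ω h1 h2
            rw [← before_union_before (ha.trans hb).ne] at h1
            exact h1.resolve_right fun h3 => h2 (before_subset_hits _ _ h3)
        _ = _ := (hY.prob_before_mul hs ha hb).symm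
        _ ≤ 1 * ENNReal.ofReal (-s a) := by gcongr; exact prob_le_one
        _ = _ := one_mul _
    · have : s b ≤ 0 := hb.eq_or_lt.elim (fun h => (hs.eq_zero b h).le) fun h => (hs.neg b h).le
      rw [ENNReal.ofReal_of_nonpos this, mul_zero]
      exact zero_le
  have hsup : P {ω | Y ω ∉ hits a} * sPos s (rightEnd I) ≤ ENNReal.ofReal (-s a) := by
    rw [sPos, ENNReal.mul_iSup]
    exact iSup_le fun b => hle b
  rw [h] at hsup
  by_contra hc
  rw [ENNReal.mul_top (show P {ω | Y ω ∉ hits (a : ℝ)} ≠ 0 from hc)] at hsup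
  exact ENNReal.ofReal_ne_top (top_le_iff.1 hsup)

/-- Let the points `c n` approach an inaccessible end of `I` that is attracting, in the sense that
the exit probabilities through `c n` do not vanish against those through `d`. Then the path does
not return to `c k` after it has been at `c n`, for `n` large. -/
lemma ae_not_return (hY : IsRegularDiffusion F P I y κ Y) [IsProbabilityMeasure P] (c : ℕ → I)
    (d : I) (hy : ∀ n, y ∈ uIcc (c n : ℝ) d) (hne : ∀ n, (c n : ℝ) ≠ d)
    (hint : ∀ n, (c n : ℝ) ∈ interior I)
    (hlim : ∀ w : PathSpace I, w ∈ hits d → ∀ᶠ n in atTop, w ∈ before d (c n))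
    {v α : ℝ≥0∞} (hv : v ≠ 0) (hv' : v ≠ ⊤) (hα : α ≠ ⊤)
    (hodds : ∀ n, P (Y ⁻¹' before d (c n)) * v ≤ P (Y ⁻¹' before (c n) d) * α) :
    ∀ᵐ ω ∂P, ∀ k, ∃ n,
      hitAfter (hitAfter ((0 : ℝ≥0) : WithTop ℝ≥0) (c n) (Y ω)) (c k) (Y ω) = ⊤ := by
  have := hY.markovKernel
  set x : ℕ → ℝ≥0∞ := fun n => P (Y ⁻¹' before d (c n)) with hx
  set x' : ℝ≥0∞ := P (Y ⁻¹' hits d) with hx'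
  have hbm : ∀ p q, MeasurableSet (Y ⁻¹' before p q) := fun p q =>
    hY.measurable (measurableSet_before p q)
  have hxlim : Tendsto x atTop (𝓝 x') := by
    refine tendsto_measure_of_tendsto_indicator_of_isFiniteMeasure atTop P (fun n => hbm _ _)
      fun ω => ?_
    by_cases hω : Y ω ∈ hits d
    · filter_upwards [hlim _ hω] with n hn using iff_of_true hn hω
    · exact Eventually.of_forall fun n => iff_of_false (fun h => hω (before_subset_hits _ _ h)) hω
  have hcomp : ∀ n, P (Y ⁻¹' before (c n) d) = 1 - x n := fun n =>
    ENNReal.eq_sub_of_add_eq (measure_ne_top _ _) (by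
      rw [add_comm]; exact hY.prob_before_add (c n) d (hy n) (hne n))
  -- If `d` were reached almost surely, the exit probabilities through `c n` would tend to zero,
  -- against the bound on the odds.
  have hlt : x' < 1 := by
    refine lt_of_le_of_ne prob_le_one fun h1 => hv ?_
    have h2 : Tendsto (fun n => x n * v) atTop (𝓝 (x' * v)) :=
      ENNReal.Tendsto.mul_const hxlim (Or.inr hv')
    have h3 : Tendsto (fun n => (1 - x n) * α) atTop (𝓝 ((1 - x') * α)) :=
      ENNReal.Tendsto.mul_const (ENNReal.Tendsto.sub tendsto_const_nhds hxlim
        (Or.inl ENNReal.one_ne_top)) (Or.inr hα)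
    have h4 := le_of_tendsto_of_tendsto' h2 h3 fun n => (hodds n).trans_eq (by rw [hcomp])
    rw [h1, one_mul, tsub_self, zero_mul] at h4
    exact nonpos_iff_eq_zero.1 h4
  -- Split the visits to `d` according to whether `c n` comes first: `x n + (1 - x n) * κ (c n)
  -- (hits d) ≤ x'`. Thus from `c n` the point `d` is reached with vanishing probability.
  have hh : ∀ n, κ (c n) (hits d) ≤ (x' - x n) / (1 - x') := by
    intro n
    have hσ := hY.isStoppingTime_hit (c n)
    have hE := hσ.measurableSet_le_stopping_time (hY.isStoppingTime_hit d)
    have h := hY.strongMarkov_hitAfter (isStoppingTime_const F (0 : ℝ≥0)) (c n) hE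
      (measurableSet_hits (d : ℝ))
    have hEeq : P ({ω | hitAfter ((0 : ℝ≥0) : WithTop ℝ≥0) (c n : ℝ) (Y ω) ≤
        hitAfter ((0 : ℝ≥0) : WithTop ℝ≥0) (d : ℝ) (Y ω)} ∩
        {ω | hitAfter ((0 : ℝ≥0) : WithTop ℝ≥0) (c n : ℝ) (Y ω) ≠ ⊤}) =
        P (Y ⁻¹' before (c n) d) := by
      congr 1
      ext ω
      rcases hitAfter_cases ((0 : ℝ≥0) : WithTop ℝ≥0) (c n : ℝ) (Y ω) with
        ⟨h1, h2⟩ | ⟨t, -, ht, htm, h2⟩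
      · refine iff_of_false (fun h => h.2 h2) fun h => ?_
        obtain ⟨u, hu⟩ := before_subset_hits _ _ h
        exact h1 u (zero_le_coe _) hu
      · simp only [mem_inter_iff, mem_ofPred_eq, mem_preimage]
        rw [h2]
        constructor
        · rintro ⟨h3, -⟩
          refine ⟨t, ht, fun u hu hud => ?_⟩
          have h4 := h3.trans ((hitAfter_le_iff _ _ _ u).2 ⟨u, le_rfl, zero_le_coe _, hud⟩)
          have h5 : u = t := le_antisymm hu (WithTop.coe_le_coe.1 h4)
          rw [h5, ht] at hud
          exact hne n hud
        · rintro ⟨r, hr, hrd⟩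
          refine ⟨?_, WithTop.coe_ne_top⟩
          rcases hitAfter_cases ((0 : ℝ≥0) : WithTop ℝ≥0) (d : ℝ) (Y ω) with
            ⟨-, h3⟩ | ⟨t', -, ht', -, h3⟩
          · rw [h3]; exact le_top
          · rw [h3, WithTop.coe_le_coe]
            by_contra hc
            exact hrd t' ((not_le.1 hc).le.trans (htm r (zero_le_coe _) hr)) ht'
    rw [hEeq, hcomp] at h
    have h1 : x n + (1 - x n) * κ (c n) (hits d) ≤ x' := by
      rw [← h, hx, ← measure_union' ?_ (hbm _ _)]
      · refine measure_mono (union_subset (preimage_mono (before_subset_hits _ _)) ?_)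
        rintro ω ⟨-, u, hu⟩
        exact ⟨_, hu⟩
      · rw [Set.disjoint_left]
        rintro ω ⟨t, ht, hω⟩ ⟨⟨h3, h4⟩, -⟩
        obtain ⟨r, hr⟩ := WithTop.ne_top_iff_exists.1 h4
        have h5 := path_hitAfter h4
        have h6 := le_trans h3 ((hitAfter_le_iff _ _ _ t).2 ⟨t, le_rfl, zero_le_coe _, ht⟩)
        rw [← hr] at h5 h6
        exact hω r (WithTop.coe_le_coe.1 h6) h5
    have hxn : x n ≤ x' := measure_mono (preimage_mono (before_subset_hits _ _))
    rw [ENNReal.le_div_iff_mul_le (Or.inl (tsub_pos_of_lt hlt).ne')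
      (Or.inl (ENNReal.sub_ne_top ENNReal.one_ne_top)), mul_comm]
    refine ENNReal.le_sub_of_add_le_left (measure_ne_top _ _) (le_trans ?_ h1)
    gcongr
  have hhlim : Tendsto (fun n => (x' - x n) / (1 - x')) atTop (𝓝 0) := by
    have h1 : Tendsto (fun n => x' - x n) atTop (𝓝 (x' - x')) :=
      ENNReal.Tendsto.sub tendsto_const_nhds hxlim (Or.inl (measure_ne_top _ _))
    rw [tsub_self] at h1
    simpa using ENNReal.Tendsto.div_const h1 (Or.inr (tsub_pos_of_lt hlt).ne')
  refine ae_all_iff.2 fun k => ?_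
  have hpos : 0 < κ (c k) (hits d) := by
    convert hY.regular (c k) d (hint k) using 2
    ext w
    exact exists_congr fun t => Subtype.ext_iff.symm
  -- A return from `c n` to `c k`, followed by a trip to `d`, is one way of reaching `d` from `c n`.
  -- The second factor is positive and does not depend on `n`, so returns become unlikely.
  have hbad : ∀ n, P {ω | hitAfter (hitAfter ((0 : ℝ≥0) : WithTop ℝ≥0) (c n) (Y ω)) (c k) (Y ω) ≠ ⊤}
      * κ (c k) (hits d) ≤ (x' - x n) / (1 - x') := by
    intro n
    have hσ := hY.isStoppingTime_hit (c n)
    have h1 := hY.strongMarkov_hitAfter hσ (c k) (E := univ) MeasurableSet.univ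
      (measurableSet_hits (d : ℝ))
    have h2 := hY.strongMarkov_hitAfter (isStoppingTime_const F (0 : ℝ≥0)) (c n) (E := univ)
      MeasurableSet.univ (measurableSet_hits (d : ℝ))
    rw [univ_inter] at h1 h2
    rw [← h1]
    refine le_trans ?_ (hh n)
    calc _ ≤ _ := measure_mono ?_
      _ = _ := h2
      _ ≤ 1 * κ (c n) (hits d) := by gcongr; exact prob_le_one
      _ = _ := one_mul _
    rintro ω ⟨h3, u, hu⟩
    have hle := le_hitAfter (hitAfter ((0 : ℝ≥0) : WithTop ℝ≥0) (c n : ℝ) (Y ω)) (c k : ℝ) (Y ω)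
    have h3' : hitAfter (hitAfter ((0 : ℝ≥0) : WithTop ℝ≥0) (c n : ℝ) (Y ω)) (c k : ℝ) (Y ω) ≠ ⊤ :=
      h3
    have h4 := ne_top_of_le_ne_top h3' hle
    refine ⟨h4, ?_⟩
    obtain ⟨r, hr⟩ := WithTop.ne_top_iff_exists.1 h3'
    obtain ⟨r', hr'⟩ := WithTop.ne_top_iff_exists.1 h4
    change shift (hitAfter _ _ _).untopA (Y ω) ∈ hits (d : ℝ)
    rw [← hr] at hu hle
    rw [← hr'] at hle ⊢
    refine ⟨r + u - r', ?_⟩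
    have h5 : r' ≤ r + u := (WithTop.coe_le_coe.1 hle).trans le_self_add
    change ((Y ω).1 (r' + (r + u - r')) : ℝ) = d
    rw [add_tsub_cancel_of_le h5]
    exact hu
  have hfin : P {ω | ∀ n, hitAfter (hitAfter ((0 : ℝ≥0) : WithTop ℝ≥0) (c n) (Y ω)) (c k) (Y ω) ≠ ⊤}
      * κ (c k) (hits d) ≤ 0 :=
    ge_of_tendsto' hhlim fun n => le_trans (by gcongr; exact fun h => h n) (hbad n)
  have h0 := (mul_eq_zero.1 (nonpos_iff_eq_zero.1 hfin)).resolve_right hpos.ne'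
  refine measure_mono_null (fun ω hω => ?_) h0
  exact not_exists.1 hω

lemma eventually_ne_of_hitAfter_eq_top {w : PathSpace I} {p q : I} (hp : w ∈ hits p)
    (h : hitAfter (hitAfter ((0 : ℝ≥0) : WithTop ℝ≥0) (p : ℝ) w) (q : ℝ) w = ⊤) :
    ∃ t : ℝ≥0, ∀ u ≥ t, w.1 u ≠ q := by
  obtain ⟨t, ht⟩ := hp
  refine ⟨t, fun u hu huq => hitAfter_ne_top (s := hitAfter ((0 : ℝ≥0) : WithTop ℝ≥0) (p : ℝ) w)
    (u := u) ?_ (congrArg _ huq) h⟩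
  exact (hitAfter_le_iff _ _ _ u).2 ⟨t, hu, zero_le_coe _, ht⟩

lemma mem_interior_of_lt_of_lt (hY : IsRegularDiffusion F P I y κ Y) {x₁ x x₂ : I} (h₁ : x₁ < x)
    (h₂ : x < x₂) : (x : ℝ) ∈ interior I :=
  mem_interior_iff_mem_nhds.2 (mem_of_superset (Ioo_mem_nhds h₁ h₂)
    (Ioo_subset_Icc_self.trans (hY.ordConnected.out x₁.2 x₂.2)))

lemma ae_goodPath (hY : IsRegularDiffusion F P I y κ Y) [IsProbabilityMeasure P] {s : I → ℝ}
    (hs : IsScale κ y s) {a b : ℕ → I} (hab : IsExhaustion I y a b) :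
    ∀ᵐ ω ∂P, GoodPath y s a b (Y ω) := by
  have h1 : ∀ᵐ ω ∂P, sNeg s (leftEnd I) = ⊤ → ∀ n, Y ω ∈ hits (b n) := by
    by_cases h : sNeg s (leftEnd I) = ⊤
    · filter_upwards [ae_all_iff.2 fun n => hY.ae_hits_right hs h (hab.gt n)] with ω hω _ using hω
    · exact Eventually.of_forall fun ω h' => absurd h' h
  have h2 : ∀ᵐ ω ∂P, sPos s (rightEnd I) = ⊤ → ∀ n, Y ω ∈ hits (a n) := by
    by_cases h : sPos s (rightEnd I) = ⊤
    · filter_upwards [ae_all_iff.2 fun n => hY.ae_hits_left hs h (hab.lt n)] with ω hω _ using hω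
    · exact Eventually.of_forall fun ω h' => absurd h' h
  have h3 : ∀ᵐ ω ∂P, (∀ x, ∃ n, a n < x) → sNeg s (leftEnd I) ≠ ⊤ → ∀ k, ∃ n,
      hitAfter (hitAfter ((0 : ℝ≥0) : WithTop ℝ≥0) (a n) (Y ω)) (a k) (Y ω) = ⊤ := by
    by_cases h : (∀ x, ∃ n, a n < x) ∧ sNeg s (leftEnd I) ≠ ⊤
    -- The odds of leaving `(a n, b 0)` at `b 0` are `-s (a n) / s (b 0)`, bounded because the left
    -- end is at finite distance in scale.
    · filter_upwards [hY.ae_not_return a (b 0) (fun n => hab.mem_uIcc n 0)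
        (fun n => ((hab.lt n).trans (hab.gt 0)).ne)
        (fun n => by
          obtain ⟨m, hm⟩ := h.1 (a n)
          exact hY.mem_interior_of_lt_of_lt hm (x₂ := b 0) ((hab.lt n).trans (hab.gt 0)))
        (fun w hw => hab.eventually_before_left h.1 hw)
        (v := ENNReal.ofReal (s (b 0))) (α := sNeg s (leftEnd I))
        (ENNReal.ofReal_pos.2 (hs.pos _ (hab.gt 0))).ne' ENNReal.ofReal_ne_top h.2
        (fun n => by
          rw [← hY.prob_before_mul hs (hab.lt n) (hab.gt 0)]
          gcongr
          exact le_sNeg _ (leftEnd_le _))] with ω hω _ _ using hω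
    · exact Eventually.of_forall fun ω h' h'' => absurd ⟨h', h''⟩ h
  have h4 : ∀ᵐ ω ∂P, (∀ x, ∃ n, x < b n) → sPos s (rightEnd I) ≠ ⊤ → ∀ k, ∃ n,
      hitAfter (hitAfter ((0 : ℝ≥0) : WithTop ℝ≥0) (b n) (Y ω)) (b k) (Y ω) = ⊤ := by
    by_cases h : (∀ x, ∃ n, x < b n) ∧ sPos s (rightEnd I) ≠ ⊤
    · filter_upwards [hY.ae_not_return b (a 0) (fun n => uIcc_comm (a 0 : ℝ) _ ▸ hab.mem_uIcc 0 n)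
        (fun n => ((hab.lt 0).trans (hab.gt n)).ne')
        (fun n => by
          obtain ⟨m, hm⟩ := h.1 (b n)
          exact hY.mem_interior_of_lt_of_lt (x₁ := a 0) ((hab.lt 0).trans (hab.gt n)) hm)
        (fun w hw => hab.eventually_before_right h.1 hw)
        (v := ENNReal.ofReal (-s (a 0))) (α := sPos s (rightEnd I))
        (ENNReal.ofReal_pos.2 (neg_pos.2 (hs.neg _ (hab.lt 0)))).ne' ENNReal.ofReal_ne_top h.2
        (fun n => by
          rw [hY.prob_before_mul hs (hab.lt 0) (hab.gt n)]
          gcongr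
          exact le_sPos _ (le_rightEnd _))] with ω hω _ _ using hω
    · exact Eventually.of_forall fun ω h' h'' => absurd ⟨h', h''⟩ h
  filter_upwards [hY.initial, hY.ae_absorbed_all,
    ae_all_iff.2 fun n => hY.ae_exit (a n) (b n) (hab.mem_uIcc n n), h1, h2, h3, h4]
    with ω k0 kabs kex k1 k2 k3 k4
  refine ⟨k0, kabs, kex, k1, k2, fun hl hfin hh => ?_, fun hr hfin hh => ?_⟩
  · refine hab.tendsto_leftEnd kabs hh (fun k => ?_) hl
    obtain ⟨n, hn⟩ := k3 hl hfin k
    exact eventually_ne_of_hitAfter_eq_top (hh n) hn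
  · refine hab.tendsto_rightEnd kabs hh (fun k => ?_) hr
    obtain ⟨n, hn⟩ := k4 hr hfin k
    exact eventually_ne_of_hitAfter_eq_top (hh n) hn

end IsRegularDiffusion

/-! ### Exit from an interval with extended real end-points. -/

section Paths

variable {I : Set ℝ} {A B : EReal} {y : ℝ} {s : I → ℝ} {a b : ℕ → I} {w : PathSpace I}

lemma isClosed_exit (A B : EReal) (w : PathSpace I) :
    IsClosed {u : ℝ≥0 | ((w.1 u : ℝ) : EReal) ∉ Ioo A B} :=
  (isOpen_Ioo.preimage (continuous_coe_real_ereal.comp (continuous_path w))).isClosed_compl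

lemma exitTime_cases (A B : EReal) (w : PathSpace I) :
    ((∀ u, ((w.1 u : ℝ) : EReal) ∈ Ioo A B) ∧ exitTime A B w = ⊤) ∨
      ∃ u, ((w.1 u : ℝ) : EReal) ∉ Ioo A B ∧ (∀ v, ((w.1 v : ℝ) : EReal) ∉ Ioo A B → u ≤ v) ∧
        exitTime A B w = u := by
  rcases firstTime_cases (isClosed_exit A B w) with ⟨h, h'⟩ | ⟨u, hu, hm, h⟩
  · refine Or.inl ⟨fun u => ?_, h'⟩
    by_contra hc
    exact (h ▸ (hc : u ∈ {u : ℝ≥0 | ((w.1 u : ℝ) : EReal) ∉ Ioo A B}) : u ∈ (∅ : Set ℝ≥0))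
  · exact Or.inr ⟨u, hu, hm, h⟩

lemma exitTime_le_iff (A B : EReal) (w : PathSpace I) (t : ℝ≥0) :
    exitTime A B w ≤ t ↔ (∃ u ≤ t, ((w.1 u : ℝ) : EReal) ≤ A) ∨
      ∃ u ≤ t, B ≤ ((w.1 u : ℝ) : EReal) := by
  rw [← exists_or]
  refine (firstTime_le_iff (isClosed_exit A B w) t).trans (exists_congr fun u => ?_)
  rw [← and_or_left]
  refine and_congr_right fun _ => ?_
  change ¬ (_ ∧ _) ↔ _
  rw [not_and_or, not_lt, not_lt]

/-- To overshoot a threshold, the path would first cross a real level strictly beyond it, which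
already counts as an exit at an earlier time. -/
lemma path_mem_Icc_of_le_exitTime (h0 : (w.1 0 : ℝ) = y) (hA : A ≤ y) (hB : (y : EReal) ≤ B)
    {v : ℝ≥0} (hv : v ≤ exitTime A B w) : ((w.1 v : ℝ) : EReal) ∈ Icc A B := by
  have key : ∀ r ≤ v, ((w.1 r : ℝ) : EReal) ∉ Ioo A B → r = v := by
    intro r hr h
    rcases exitTime_cases A B w with ⟨h1, -⟩ | ⟨u, -, hm, h2⟩
    · exact absurd (h1 r) h
    · rw [h2, WithTop.coe_le_coe] at hv
      exact le_antisymm hr (hv.trans (hm r h))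
  constructor
  · by_contra! hc
    obtain ⟨z, hz1, hz2⟩ := EReal.lt_iff_exists_real_btwn.1 hc
    obtain ⟨r, -, hr, hrz⟩ := exists_path_eq w (zero_le (a := v)) (z := z)
      (mem_uIcc_of_ge (EReal.coe_le_coe_iff.1 hz1.le)
        (h0 ▸ EReal.coe_le_coe_iff.1 (hz2.le.trans hA)))
    have := key r hr fun h => (h.1.trans_eq (congrArg _ hrz)).not_gt hz2
    rw [← this, hrz] at hz1
    exact lt_irrefl _ hz1
  · by_contra! hc
    obtain ⟨z, hz1, hz2⟩ := EReal.lt_iff_exists_real_btwn.1 hc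
    obtain ⟨r, -, hr, hrz⟩ := exists_path_eq w (zero_le (a := v)) (z := z)
      (mem_uIcc_of_le (h0 ▸ EReal.coe_le_coe_iff.1 (hB.trans hz1.le))
        (EReal.coe_le_coe_iff.1 hz2.le))
    have := key r hr fun h => (hz1.trans_eq (congrArg _ hrz.symm)).not_gt h.2
    rw [← this, hrz] at hz2
    exact lt_irrefl _ hz2

lemma leftEnd_le_of_mem_closure (hA : A ∈ closure (Real.toEReal '' I)) : leftEnd I ≤ A :=
  closure_minimal (fun _ h => sInf_le h) isClosed_Ici hA

lemma le_rightEnd_of_mem_closure (hB : B ∈ closure (Real.toEReal '' I)) : B ≤ rightEnd I :=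
  closure_minimal (fun _ h => le_sSup h) isClosed_Iic hB

/-- Separates thresholds bounded by a point of `I`, which the path meets in finite time if it goes
far enough, from an inaccessible end, which it can only approach. -/
lemma IsExhaustion.left_cases (hab : IsExhaustion I y a b) (hA : A ∈ closure (Real.toEReal '' I)) :
    (∃ n, ((a n : ℝ) : EReal) ≤ A) ∨ A = leftEnd I ∧ ∀ x, ∃ n, a n < x := by
  rcases (leftEnd_le_of_mem_closure hA).eq_or_lt with h | h
  · rcases hab.left with h' | h'
    · refine Or.inl ⟨0, h ▸ le_sInf ?_⟩
      rintro _ ⟨x, hx, rfl⟩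
      exact EReal.coe_le_coe_iff.2 (h' 0 ⟨x, hx⟩)
    · exact Or.inr ⟨h.symm, h'⟩
  · obtain ⟨x, hx⟩ := exists_coe_lt_of_leftEnd_lt h
    obtain ⟨n, hn⟩ := hab.exists_le x
    exact Or.inl ⟨n, (EReal.coe_le_coe_iff.2 hn).trans hx.le⟩

lemma IsExhaustion.right_cases (hab : IsExhaustion I y a b)
    (hB : B ∈ closure (Real.toEReal '' I)) :
    (∃ n, B ≤ ((b n : ℝ) : EReal)) ∨ B = rightEnd I ∧ ∀ x, ∃ n, x < b n := by
  rcases (le_rightEnd_of_mem_closure hB).eq_or_lt with h | h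
  · rcases hab.right with h' | h'
    · refine Or.inl ⟨0, h ▸ sSup_le ?_⟩
      rintro _ ⟨x, hx, rfl⟩
      exact EReal.coe_le_coe_iff.2 (h' 0 ⟨x, hx⟩)
    · exact Or.inr ⟨h, h'⟩
  · obtain ⟨x, hx⟩ := exists_lt_coe_of_lt_rightEnd h
    obtain ⟨n, hn⟩ := hab.exists_ge x
    exact Or.inl ⟨n, hx.le.trans (EReal.coe_le_coe_iff.2 hn)⟩

lemma IsExhaustion.hits_left_of_le (hab : IsExhaustion I y a b) (h0 : (w.1 0 : ℝ) = y) {m n : ℕ}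
    (hmn : m ≤ n) (h : w ∈ hits (a n)) : w ∈ hits (a m) :=
  hits_of_hits (h0 ▸ mem_uIcc_of_ge (hab.anti hmn) (hab.lt m).le) h

lemma IsExhaustion.hits_right_of_le (hab : IsExhaustion I y a b) (h0 : (w.1 0 : ℝ) = y) {m n : ℕ}
    (hmn : m ≤ n) (h : w ∈ hits (b n)) : w ∈ hits (b m) :=
  hits_of_hits (h0 ▸ mem_uIcc_of_le (hab.gt m).le (hab.mono hmn)) h

/-- A path stopped on exit from `(A, B)` ends up in `A` or in `B`, provided that `A`, `B` are not
both at infinite distance in scale. -/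
lemma GoodPath.tendsto_exit (hw : GoodPath y s a b w) (hab : IsExhaustion I y a b)
    (hA : A ∈ closure (Real.toEReal '' I)) (hAy : A ≤ y)
    (hB : B ∈ closure (Real.toEReal '' I)) (hBy : (y : EReal) ≤ B)
    (hfin : sNeg s A ≠ ⊤ ∨ sPos s B ≠ ⊤) :
    ∃ L, (L = A ∨ L = B) ∧ Tendsto (stoppedPath w (exitTime A B w)) atTop (𝓝 L) := by
  rcases exitTime_cases A B w with ⟨hin, htop⟩ | ⟨u, hu, hm, he⟩
  · have hst : stoppedPath w (exitTime A B w) = fun t => ((w.1 t : ℝ) : EReal) := by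
      funext t
      exact stoppedPath_of_le w (htop ▸ le_top)
    rw [hst]
    have hleft : ∀ n, ((a n : ℝ) : EReal) ≤ A → w ∉ hits (a n) := by
      rintro n hn ⟨t, ht⟩
      exact ((hin t).1.trans_eq (congrArg _ ht)).not_ge hn
    have hright : ∀ n, B ≤ ((b n : ℝ) : EReal) → w ∉ hits (b n) := by
      rintro n hn ⟨t, ht⟩
      exact (hn.trans_eq (congrArg _ ht.symm)).not_gt (hin t).2
    -- Each `(a n, b n)` is left at one of its ends, and hitting a far point implies hitting the
    -- nearer ones.
    have hor : (∀ n, w ∈ hits (a n)) ∨ ∀ n, w ∈ hits (b n) := by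
      by_contra! hc
      obtain ⟨⟨n, hn⟩, m, hm⟩ := hc
      rcases hw.exit (max n m) with h | h
      · exact hn (hab.hits_left_of_le hw.start (le_max_left _ _) h)
      · exact hm (hab.hits_right_of_le hw.start (le_max_right _ _) h)
    rcases hab.left_cases hA with ⟨n, hn⟩ | ⟨rfl, hl⟩ <;>
      rcases hab.right_cases hB with ⟨m, hm⟩ | ⟨rfl, hr⟩
    · exact (hor.elim (fun h => hleft n hn (h n)) fun h => hright m hm (h m)).elim
    · have h1 := hor.resolve_left fun h => hleft n hn (h n)
      -- If the right end were at infinite distance, the path would hit `a n`, which lies at or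
      -- beyond `A`.
      have h2 : sPos s (rightEnd I) ≠ ⊤ := fun h => hleft n hn (hw.hits_left h n)
      exact ⟨_, Or.inr rfl, hw.tendsto_right hr h2 h1⟩
    · have h1 := hor.resolve_right fun h => hright m hm (h m)
      have h2 : sNeg s (leftEnd I) ≠ ⊤ := fun h => hright m hm (hw.hits_right h m)
      exact ⟨_, Or.inl rfl, hw.tendsto_left hl h2 h1⟩
    -- Both thresholds are inaccessible ends; an end at infinite distance drives the path to the
    -- other one, which is at finite distance by `hfin`.
    · by_cases h1 : sNeg s (leftEnd I) = ⊤
      · have h2 := hfin.resolve_left (not_not.2 h1)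
        exact ⟨_, Or.inr rfl, hw.tendsto_right hr h2 (hw.hits_right h1)⟩
      by_cases h2 : sPos s (rightEnd I) = ⊤
      · exact ⟨_, Or.inl rfl, hw.tendsto_left hl h1 (hw.hits_left h2)⟩
      exact hor.elim (fun h => ⟨_, Or.inl rfl, hw.tendsto_left hl h1 h⟩)
        fun h => ⟨_, Or.inr rfl, hw.tendsto_right hr h2 h⟩
  · rw [he]
    refine ⟨_, ?_, tendsto_stoppedPath_coe w u⟩
    have h := path_mem_Icc_of_le_exitTime hw.start hAy hBy (v := u) he.ge
    by_contra! hc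
    exact hu ⟨h.1.lt_of_ne' hc.1, h.2.lt_of_ne hc.2⟩

/-- A good path, stopped or not, cannot converge to an end-point at infinite distance in scale. -/
lemma GoodPath.ne_leftEnd (hw : GoodPath y s a b w) (hab : IsExhaustion I y a b)
    (hs : Monotone s) (h : sNeg s (leftEnd I) = ⊤) {τ : WithTop ℝ≥0} {L : EReal}
    (hL : Tendsto (stoppedPath w τ) atTop (𝓝 L)) : L ≠ leftEnd I := by
  rintro rfl
  rcases eq_or_ne τ ⊤ with rfl | hτ
  · have hlt : leftEnd I < y := (leftEnd_le (a 0)).trans_lt (EReal.coe_lt_coe_iff.2 (hab.lt 0))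
    obtain ⟨t, ht⟩ := eventually_atTop.1 (hL.eventually (eventually_lt_nhds hlt))
    -- With the left end infinitely far, every `b n` is hit, so the path is above `b 0` at
    -- arbitrarily large times.
    obtain ⟨u, hut, hu⟩ := hab.frequently_right hw.absorbed (hw.hits_right h) t 0
    have h1 := ht u hut
    rw [stoppedPath_of_le w le_top, EReal.coe_lt_coe_iff] at h1
    exact (h1.trans (hab.gt 0)).not_ge hu
  · obtain ⟨r, rfl⟩ := WithTop.ne_top_iff_exists.1 hτ
    rw [tendsto_nhds_unique hL (tendsto_stoppedPath_coe w r), sNeg_coe hs] at h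
    exact ENNReal.ofReal_ne_top h

lemma GoodPath.ne_rightEnd (hw : GoodPath y s a b w) (hab : IsExhaustion I y a b)
    (hs : Monotone s) (h : sPos s (rightEnd I) = ⊤) {τ : WithTop ℝ≥0} {L : EReal}
    (hL : Tendsto (stoppedPath w τ) atTop (𝓝 L)) : L ≠ rightEnd I := by
  rintro rfl
  rcases eq_or_ne τ ⊤ with rfl | hτ
  · have hlt : (y : EReal) < rightEnd I :=
      (EReal.coe_lt_coe_iff.2 (hab.gt 0)).trans_le (le_rightEnd (b 0))
    obtain ⟨t, ht⟩ := eventually_atTop.1 (hL.eventually (eventually_gt_nhds hlt))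
    obtain ⟨u, hut, hu⟩ := hab.frequently_left hw.absorbed (hw.hits_left h) t 0
    have h1 := ht u hut
    rw [stoppedPath_of_le w le_top, EReal.coe_lt_coe_iff] at h1
    exact ((hab.lt 0).trans h1).not_ge hu
  · obtain ⟨r, rfl⟩ := WithTop.ne_top_iff_exists.1 hτ
    rw [tendsto_nhds_unique hL (tendsto_stoppedPath_coe w r), sPos_coe hs] at h
    exact ENNReal.ofReal_ne_top h

lemma stoppedPath_mem_closure (w : PathSpace I) (τ : WithTop ℝ≥0) (t : ℝ≥0) :
    stoppedPath w τ t ∈ closure (Real.toEReal '' I) :=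
  subset_closure (mem_image_of_mem _ (Subtype.prop _))

lemma sNeg_ne_top_of_leftEnd_lt {A : EReal} (hs : Monotone s) (h : leftEnd I < A) :
    sNeg s A ≠ ⊤ := by
  obtain ⟨x, hx⟩ := exists_coe_lt_of_leftEnd_lt h
  exact ne_top_of_le_ne_top ENNReal.ofReal_ne_top ((sNeg_anti hx.le).trans_eq (sNeg_coe hs x))

lemma sPos_ne_top_of_lt_rightEnd {B : EReal} (hs : Monotone s) (h : B < rightEnd I) :
    sPos s B ≠ ⊤ := by
  obtain ⟨x, hx⟩ := exists_lt_coe_of_lt_rightEnd h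
  exact ne_top_of_le_ne_top ENNReal.ofReal_ne_top ((sPos_mono hx.le).trans_eq (sPos_coe hs x))

/-- Ensures that `∫ s⁻ dν = 0` leaves `ν` without mass below `y`. -/
lemma sNeg_ne_zero {κ : Kernel I (PathSpace I)} (hI : I.OrdConnected) (hy : y ∈ I)
    (hs : IsScale κ y s) (hab : IsExhaustion I y a b) (hA : A ∈ closure (Real.toEReal '' I))
    (hAy : A < y) : sNeg s A ≠ 0 := by
  have : ∃ x : I, A ≤ ((x : ℝ) : EReal) ∧ (x : ℝ) < y := by
    rcases hab.left_cases hA with ⟨n, hn⟩ | ⟨rfl, -⟩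
    · lift A to ℝ using ⟨hAy.ne_top, ((EReal.bot_lt_coe _).trans_le hn).ne'⟩
      exact ⟨⟨A, hI.out (a n).2 hy ⟨EReal.coe_le_coe_iff.1 hn, EReal.coe_le_coe_iff.1 hAy.le⟩⟩,
        le_rfl, EReal.coe_lt_coe_iff.1 hAy⟩
    · exact ⟨a 0, leftEnd_le _, hab.lt 0⟩
  obtain ⟨x, hx, hxy⟩ := this
  exact ((ENNReal.ofReal_pos.2 (neg_pos.2 (hs.neg x hxy))).trans_le (le_sNeg x hx)).ne'

lemma sPos_ne_zero {κ : Kernel I (PathSpace I)} (hI : I.OrdConnected) (hy : y ∈ I)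
    (hs : IsScale κ y s) (hab : IsExhaustion I y a b) (hB : B ∈ closure (Real.toEReal '' I))
    (hBy : (y : EReal) < B) : sPos s B ≠ 0 := by
  have : ∃ x : I, ((x : ℝ) : EReal) ≤ B ∧ y < (x : ℝ) := by
    rcases hab.right_cases hB with ⟨n, hn⟩ | ⟨rfl, -⟩
    · lift B to ℝ using ⟨(hn.trans_lt (EReal.coe_lt_top _)).ne, hBy.ne_bot⟩
      exact ⟨⟨B, hI.out hy (b n).2 ⟨EReal.coe_le_coe_iff.1 hBy.le, EReal.coe_le_coe_iff.1 hn⟩⟩,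
        le_rfl, EReal.coe_lt_coe_iff.1 hBy⟩
    · exact ⟨b 0, le_rightEnd _, hab.gt 0⟩
  obtain ⟨x, hx, hxy⟩ := this
  exact ((ENNReal.ofReal_pos.2 (hs.pos x hxy)).trans_le (le_sPos x hx)).ne'

end Paths

lemma eq_smul_dirac_add_smul_dirac {X : Type*} [MeasurableSpace X] [MeasurableSingletonClass X]
    {ν : Measure X} {A B : X} (hAB : A ≠ B) (h : ∀ᵐ x ∂ν, x = A ∨ x = B) :
    ν = ν {A} • Measure.dirac A + ν {B} • Measure.dirac B := by
  have h1 : ν = ν.restrict ({A} ∪ {B}) := (Measure.restrict_eq_self_of_ae_mem h).symm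
  nth_rewrite 1 [h1]
  rw [Measure.restrict_union (disjoint_singleton.2 hAB) (measurableSet_singleton B),
    Measure.restrict_singleton, Measure.restrict_singleton]

/-! ### Stopped laws, and the exit laws of deterministic thresholds. -/

namespace IsRegularDiffusion

variable {Ω : Type*} {mΩ : MeasurableSpace Ω} {F : Filtration ℝ≥0 mΩ} {P : Measure Ω}
  {I : Set ℝ} {y : ℝ} {κ : Kernel I (PathSpace I)} {Y : Ω → PathSpace I}

lemma isStoppingTime_exitTime (hY : IsRegularDiffusion F P I y κ Y) {A B : Ω → EReal}
    (hA : Measurable[F 0] A) (hB : Measurable[F 0] B) :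
    IsStoppingTime F fun ω => exitTime (A ω) (B ω) (Y ω) := by
  intro t
  simp only [exitTime_le_iff]
  have h1 := measurableSet_exists_le (m := F t) (Z := fun ω u => (((Y ω).1 u : ℝ) : EReal))
    (A := A) (t := t) (σ := fun _ => ((0 : ℝ≥0) : WithTop ℝ≥0))
    (fun ω => continuous_coe_real_ereal.comp (continuous_path (Y ω)))
    (hA.mono (F.mono zero_le) le_rfl)
    (fun u hu => measurable_coe_real_ereal.comp
      (measurable_subtype_coe.comp (hY.measurable_coord_le hu)))
    (fun u _ => MeasurableSet.const _)
  have h2 := measurableSet_exists_le (m := F t) (Z := fun ω u => -(((Y ω).1 u : ℝ) : EReal))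
    (A := fun ω => -B ω) (t := t) (σ := fun _ => ((0 : ℝ≥0) : WithTop ℝ≥0))
    (fun ω => continuous_neg.comp (continuous_coe_real_ereal.comp (continuous_path (Y ω))))
    ((hB.mono (F.mono zero_le) le_rfl).neg)
    (fun u hu => (measurable_coe_real_ereal.comp
      (measurable_subtype_coe.comp (hY.measurable_coord_le hu))).neg)
    (fun u _ => MeasurableSet.const _)
  simp only [zero_le_coe, true_and, EReal.neg_le_neg_iff] at h1 h2
  exact h1.union h2

lemma measurable_stoppedPath (hY : IsRegularDiffusion F P I y κ Y) {τ : Ω → WithTop ℝ≥0}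
    (hτ : IsStoppingTime F τ) (t : ℝ≥0) : Measurable fun ω => stoppedPath (Y ω) (τ ω) t :=
  measurable_coe_real_ereal.comp (measurable_subtype_coe.comp
    (hY.measurable_stopped (measurable_const.min hτ.measurable')))

/-- Limit along integer times; only almost everywhere, since the value is arbitrary where the path
does not converge. -/
lemma aemeasurable_stoppedAt (hY : IsRegularDiffusion F P I y κ Y) {τ : Ω → WithTop ℝ≥0}
    (hτ : τ ∈ stoppingTimes F P Y) : AEMeasurable (stoppedAt Y τ) P := by
  refine aemeasurable_of_tendsto_metrizable_ae (atTop : Filter ℕ)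
    (f := fun (n : ℕ) ω => stoppedPath (Y ω) (τ ω) n)
    (fun n => (hY.measurable_stoppedPath hτ.1 n).aemeasurable) ?_
  filter_upwards [hτ.2] with ω ⟨L, hL⟩
  rw [stoppedAt, hL.limUnder_eq]
  exact hL.comp tendsto_natCast_atTop_atTop

lemma isProbabilityMeasure_stoppedLaw (hY : IsRegularDiffusion F P I y κ Y)
    [IsProbabilityMeasure P] {τ : Ω → WithTop ℝ≥0} (hτ : τ ∈ stoppingTimes F P Y) :
    IsProbabilityMeasure (stoppedLaw P Y τ) :=
  Measure.isProbabilityMeasure_map (hY.aemeasurable_stoppedAt hτ)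

lemma lintegral_stoppedLaw (hY : IsRegularDiffusion F P I y κ Y) {τ : Ω → WithTop ℝ≥0}
    (hτ : τ ∈ stoppingTimes F P Y) {f : EReal → ℝ≥0∞} (hf : Measurable f) :
    ∫⁻ x, f x ∂(stoppedLaw P Y τ) = ∫⁻ ω, f (stoppedAt Y τ ω) ∂P :=
  lintegral_map' hf.aemeasurable (hY.aemeasurable_stoppedAt hτ)

lemma ae_stoppedLaw_mem_closure (hY : IsRegularDiffusion F P I y κ Y) {τ : Ω → WithTop ℝ≥0}
    (hτ : τ ∈ stoppingTimes F P Y) :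
    ∀ᵐ x ∂(stoppedLaw P Y τ), x ∈ closure (Real.toEReal '' I) := by
  refine (ae_map_iff (hY.aemeasurable_stoppedAt hτ)
    (show MeasurableSet {x | x ∈ closure (Real.toEReal '' I)} from
      isClosed_closure.measurableSet)).2 ?_
  filter_upwards [hτ.2] with ω ⟨L, hL⟩
  rw [stoppedAt, hL.limUnder_eq]
  exact isClosed_closure.mem_of_tendsto hL
    (Eventually.of_forall fun t => stoppedPath_mem_closure _ _ t)

variable {s : I → ℝ} {a b : ℕ → I}

/-- A right end at finite distance bounds the scale above on all of `I`, whatever the stopping time.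
-/
lemma lintegral_sNeg_stoppedLaw_le (hY : IsRegularDiffusion F P I y κ Y) [IsProbabilityMeasure P]
    (hs : IsScale κ y s) (hab : IsExhaustion I y a b) {τ : Ω → WithTop ℝ≥0}
    (hτ : τ ∈ stoppingTimes F P Y) (h : sPos s (rightEnd I) ≠ ⊤) :
    ∫⁻ x, sNeg s x ∂(stoppedLaw P Y τ) ≤ ∫⁻ x, sPos s x ∂(stoppedLaw P Y τ) := by
  rw [hY.lintegral_stoppedLaw hτ measurable_sNeg, hY.lintegral_stoppedLaw hτ measurable_sPos]
  exact hY.lintegral_sNeg_le hs hab hτ h fun n =>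
    Eventually.of_forall fun ω => le_sPos _ (le_rightEnd _)

lemma lintegral_sPos_stoppedLaw_le (hY : IsRegularDiffusion F P I y κ Y) [IsProbabilityMeasure P]
    (hs : IsScale κ y s) (hab : IsExhaustion I y a b) {τ : Ω → WithTop ℝ≥0}
    (hτ : τ ∈ stoppingTimes F P Y) (h : sNeg s (leftEnd I) ≠ ⊤) :
    ∫⁻ x, sPos s x ∂(stoppedLaw P Y τ) ≤ ∫⁻ x, sNeg s x ∂(stoppedLaw P Y τ) := by
  rw [hY.lintegral_stoppedLaw hτ measurable_sNeg, hY.lintegral_stoppedLaw hτ measurable_sPos]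
  exact hY.lintegral_sPos_le hs hab hτ h fun n =>
    Eventually.of_forall fun ω => le_sNeg _ (leftEnd_le _)

lemma ae_stoppedLaw_ne_leftEnd (hY : IsRegularDiffusion F P I y κ Y) [IsProbabilityMeasure P]
    (hs : IsScale κ y s) (hab : IsExhaustion I y a b) {τ : Ω → WithTop ℝ≥0}
    (hτ : τ ∈ stoppingTimes F P Y) (h : sNeg s (leftEnd I) = ⊤) :
    ∀ᵐ x ∂(stoppedLaw P Y τ), x ≠ leftEnd I := by
  refine (ae_map_iff (hY.aemeasurable_stoppedAt hτ)
    (show MeasurableSet {x | x ≠ leftEnd I} from (measurableSet_singleton _).compl)).2 ?_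
  filter_upwards [hτ.2, hY.ae_goodPath hs hab] with ω ⟨L, hL⟩ hω
  rw [stoppedAt, hL.limUnder_eq]
  exact hω.ne_leftEnd hab hs.mono h hL

lemma ae_stoppedLaw_ne_rightEnd (hY : IsRegularDiffusion F P I y κ Y) [IsProbabilityMeasure P]
    (hs : IsScale κ y s) (hab : IsExhaustion I y a b) {τ : Ω → WithTop ℝ≥0}
    (hτ : τ ∈ stoppingTimes F P Y) (h : sPos s (rightEnd I) = ⊤) :
    ∀ᵐ x ∂(stoppedLaw P Y τ), x ≠ rightEnd I := by
  refine (ae_map_iff (hY.aemeasurable_stoppedAt hτ)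
    (show MeasurableSet {x | x ≠ rightEnd I} from (measurableSet_singleton _).compl)).2 ?_
  filter_upwards [hτ.2, hY.ae_goodPath hs hab] with ω ⟨L, hL⟩ hω
  rw [stoppedAt, hL.limUnder_eq]
  exact hω.ne_rightEnd hab hs.mono h hL

section Exit

variable {A B : EReal}

lemma exitTime_mem_stoppingTimes (hY : IsRegularDiffusion F P I y κ Y) [IsProbabilityMeasure P]
    (hs : IsScale κ y s) (hab : IsExhaustion I y a b) (h : (A, B) ∈ thresholds I y)
    (hfin : sNeg s A ≠ ⊤ ∨ sPos s B ≠ ⊤) :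
    (fun ω => exitTime A B (Y ω)) ∈ stoppingTimes F P Y := by
  refine ⟨hY.isStoppingTime_exitTime measurable_const measurable_const, ?_⟩
  filter_upwards [hY.ae_goodPath hs hab] with ω hω
  obtain ⟨L, -, hL⟩ := hω.tendsto_exit hab h.1.1 h.1.2 h.2.1 h.2.2 hfin
  exact ⟨L, hL⟩

lemma ae_exitLaw (hY : IsRegularDiffusion F P I y κ Y) [IsProbabilityMeasure P]
    (hs : IsScale κ y s) (hab : IsExhaustion I y a b) (h : (A, B) ∈ thresholds I y)
    (hfin : sNeg s A ≠ ⊤ ∨ sPos s B ≠ ⊤) :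
    ∀ᵐ x ∂(stoppedLaw P Y fun ω => exitTime A B (Y ω)), x = A ∨ x = B := by
  refine (ae_map_iff (hY.aemeasurable_stoppedAt (hY.exitTime_mem_stoppingTimes hs hab h hfin))
    (show MeasurableSet {x | x = A ∨ x = B} from
      (measurableSet_singleton A).union (measurableSet_singleton B))).2 ?_
  filter_upwards [hY.ae_goodPath hs hab] with ω hω
  obtain ⟨L, hLAB, hL⟩ := hω.tendsto_exit hab h.1.1 h.1.2 h.2.1 h.2.2 hfin
  rw [stoppedAt, hL.limUnder_eq]
  exact hLAB

/-- Until the exit the path stays in `[A, B]`. Finiteness of the scale at one threshold therefore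
suffices for the domination, even if `I` extends to infinite scale. -/
lemma exitLaw_bounds (hY : IsRegularDiffusion F P I y κ Y) [IsProbabilityMeasure P]
    (hab : IsExhaustion I y a b) (h : (A, B) ∈ thresholds I y) (n : ℕ) : ∀ᵐ ω ∂P,
      ENNReal.ofReal (s ((Y ω).1
        (min (exitTime A B (Y ω)) (hitEither (a n : ℝ) (b n) (Y ω))).untopA)) ≤ sPos s B ∧
      ENNReal.ofReal (-s ((Y ω).1
        (min (exitTime A B (Y ω)) (hitEither (a n : ℝ) (b n) (Y ω))).untopA)) ≤ sNeg s A := by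
  filter_upwards [hY.initial, hY.ae_hitEither_ne_top (a n) (b n) (hab.mem_uIcc n n)] with ω h0 hT
  obtain ⟨v, hv⟩ := WithTop.ne_top_iff_exists.1 (ne_top_of_le_ne_top hT
    (min_le_right (exitTime A B (Y ω)) (hitEither (a n : ℝ) (b n) (Y ω))))
  have hm := path_mem_Icc_of_le_exitTime h0 h.1.2 h.2.2 (v := v) (hv ▸ min_le_left _ _)
  rw [← hv]
  exact ⟨le_sPos _ hm.2, le_sNeg _ hm.1⟩

/-- The law at the exit from `(A, B)` is carried by `A` and `B`, with weights that are inversely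
proportional to their distances from `y` in scale. -/
lemma exists_exitLaw_eq (hY : IsRegularDiffusion F P I y κ Y) [IsProbabilityMeasure P]
    (hs : IsScale κ y s) (hab : IsExhaustion I y a b) (h : (A, B) ∈ thresholds I y)
    (hA : A < y) (hB : (y : EReal) < B) (hfin : sNeg s A ≠ ⊤ ∨ sPos s B ≠ ⊤) :
    ∃ p q : ℝ≥0∞, p + q = 1 ∧
      (stoppedLaw P Y fun ω => exitTime A B (Y ω)) = p • Measure.dirac A + q • Measure.dirac B ∧
      (sPos s B ≠ ⊤ → p * sNeg s A ≤ q * sPos s B) ∧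
      (sNeg s A ≠ ⊤ → q * sPos s B ≤ p * sNeg s A) := by
  have hτ := hY.exitTime_mem_stoppingTimes hs hab h hfin
  have hν := eq_smul_dirac_add_smul_dirac (hA.trans hB).ne (hY.ae_exitLaw hs hab h hfin)
  have := hY.isProbabilityMeasure_stoppedLaw hτ
  set ν := stoppedLaw P Y fun ω => exitTime A B (Y ω)
  have hneg : ∫⁻ ω, sNeg s (stoppedAt Y (fun ω => exitTime A B (Y ω)) ω) ∂P = ν {A} * sNeg s A := by
    rw [← hY.lintegral_stoppedLaw hτ measurable_sNeg]
    change ∫⁻ x, sNeg s x ∂ν = _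
    rw [hν, lintegral_add_measure, lintegral_smul_measure, lintegral_smul_measure,
      lintegral_dirac, lintegral_dirac, ← hν, hs.sNeg_eq_zero hB.le, smul_zero, add_zero,
      smul_eq_mul]
  have hpos : ∫⁻ ω, sPos s (stoppedAt Y (fun ω => exitTime A B (Y ω)) ω) ∂P = ν {B} * sPos s B := by
    rw [← hY.lintegral_stoppedLaw hτ measurable_sPos]
    change ∫⁻ x, sPos s x ∂ν = _
    rw [hν, lintegral_add_measure, lintegral_smul_measure, lintegral_smul_measure,
      lintegral_dirac, lintegral_dirac, ← hν, hs.sPos_eq_zero hA.le, smul_zero, zero_add,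
      smul_eq_mul]
  refine ⟨ν {A}, ν {B}, ?_, hν, fun hf => ?_, fun hf => ?_⟩
  · have h1 := congrArg (fun m : Measure EReal => m univ) hν
    simpa using h1.symm
  · rw [← hneg, ← hpos]
    exact hY.lintegral_sNeg_le hs hab hτ hf fun n =>
      (hY.exitLaw_bounds (s := s) hab h n).mono fun ω h => h.1
  · rw [← hneg, ← hpos]
    exact hY.lintegral_sPos_le hs hab hτ hf fun n =>
      (hY.exitLaw_bounds (s := s) hab h n).mono fun ω h => h.2

/-- The two inequalities give `p * s⁻(A) = q * s⁺(B)`, to be solved with `p + q = 1`. The factor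
kept on the left is the density used in `thresholdLaw`. -/
lemma smul_exitLaw (hY : IsRegularDiffusion F P I y κ Y) [IsProbabilityMeasure P]
    (hs : IsScale κ y s) (hab : IsExhaustion I y a b) (h : (A, B) ∈ thresholds I y)
    (hA : A < y) (hB : (y : EReal) < B) (hfA : sNeg s A ≠ ⊤) (hfB : sPos s B ≠ ⊤) :
    (sNeg s A + sPos s B) • (stoppedLaw P Y fun ω => exitTime A B (Y ω)) =
      sPos s B • Measure.dirac A + sNeg s A • Measure.dirac B := by
  obtain ⟨p, q, hpq, hν, h1, h2⟩ := hY.exists_exitLaw_eq hs hab h hA hB (Or.inl hfA)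
  have heq := le_antisymm (h1 hfB) (h2 hfA)
  rw [hν, smul_add, smul_smul, smul_smul]
  congr 2
  · calc (sNeg s A + sPos s B) * p = p * sNeg s A + sPos s B * p := by ring
      _ = sPos s B * (p + q) := by rw [heq]; ring
      _ = _ := by rw [hpq, mul_one]
  · calc (sNeg s A + sPos s B) * q = sNeg s A * q + q * sPos s B := by ring
      _ = sNeg s A * (p + q) := by rw [← heq]; ring
      _ = _ := by rw [hpq, mul_one]

/-- A positive mass at `B` would contribute infinite mean on one side against a finite one on the
other. So a one-sided threshold is reached almost surely. -/
lemma exitLaw_eq_dirac_left (hY : IsRegularDiffusion F P I y κ Y) [IsProbabilityMeasure P]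
    (hs : IsScale κ y s) (hab : IsExhaustion I y a b) (h : (A, B) ∈ thresholds I y)
    (hA : A < y) (hB : (y : EReal) < B) (hfA : sNeg s A ≠ ⊤) (hfB : sPos s B = ⊤) :
    (stoppedLaw P Y fun ω => exitTime A B (Y ω)) = Measure.dirac A := by
  obtain ⟨p, q, hpq, hν, -, h2⟩ := hY.exists_exitLaw_eq hs hab h hA hB (Or.inl hfA)
  have hp : p ≠ ⊤ := ne_top_of_le_ne_top ENNReal.one_ne_top (hpq ▸ le_self_add)
  have hq : q = 0 := by
    by_contra hq
    have := h2 hfA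
    rw [hfB, ENNReal.mul_top hq, top_le_iff] at this
    exact ENNReal.mul_ne_top hp hfA this
  rw [hq, add_zero] at hpq
  rw [hν, hq, hpq, one_smul, zero_smul, add_zero]

lemma exitLaw_eq_dirac_right (hY : IsRegularDiffusion F P I y κ Y) [IsProbabilityMeasure P]
    (hs : IsScale κ y s) (hab : IsExhaustion I y a b) (h : (A, B) ∈ thresholds I y)
    (hA : A < y) (hB : (y : EReal) < B) (hfA : sNeg s A = ⊤) (hfB : sPos s B ≠ ⊤) :
    (stoppedLaw P Y fun ω => exitTime A B (Y ω)) = Measure.dirac B := by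
  obtain ⟨p, q, hpq, hν, h1, -⟩ := hY.exists_exitLaw_eq hs hab h hA hB (Or.inr hfB)
  have hq : q ≠ ⊤ := ne_top_of_le_ne_top ENNReal.one_ne_top (hpq ▸ le_add_self)
  have hp : p = 0 := by
    by_contra hp
    have := h1 hfB
    rw [hfA, ENNReal.mul_top hp, top_le_iff] at this
    exact ENNReal.mul_ne_top hq hfB this
  rw [hp, zero_add] at hpq
  rw [hν, hp, hpq, one_smul, zero_smul, zero_add]

end Exit

lemma mem_closure_coe (hY : IsRegularDiffusion F P I y κ Y) :
    (y : EReal) ∈ closure (Real.toEReal '' I) := subset_closure (mem_image_of_mem _ hY.mem)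

lemma mem_thresholds_self (hY : IsRegularDiffusion F P I y κ Y) :
    ((y : EReal), (y : EReal)) ∈ thresholds I y :=
  ⟨⟨hY.mem_closure_coe, le_refl (y : EReal)⟩, ⟨hY.mem_closure_coe, le_refl (y : EReal)⟩⟩

lemma exitLaw_self (hY : IsRegularDiffusion F P I y κ Y) [IsProbabilityMeasure P]
    (hs : IsScale κ y s) (hab : IsExhaustion I y a b) :
    (stoppedLaw P Y fun ω => exitTime (y : EReal) y (Y ω)) = Measure.dirac (y : EReal) := by
  have hfin : sNeg s (y : EReal) ≠ ⊤ := by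
    rw [hs.sNeg_eq_zero le_rfl]; exact ENNReal.zero_ne_top
  have h1 := hY.ae_exitLaw hs hab hY.mem_thresholds_self (Or.inl hfin)
  have := hY.isProbabilityMeasure_stoppedLaw
    (hY.exitTime_mem_stoppingTimes hs hab hY.mem_thresholds_self (Or.inl hfin))
  set ν := stoppedLaw P Y fun ω => exitTime (y : EReal) y (Y ω)
  have h2 : ∀ᵐ x ∂ν, x ∈ ({(y : EReal)} : Set EReal) := h1.mono fun x h => or_self_iff.1 h
  have h3 : ν {(y : EReal)} = 1 := (mem_ae_iff_prob_eq_one (measurableSet_singleton _)).1 h2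
  rw [← Measure.restrict_eq_self_of_ae_mem h2, Measure.restrict_singleton, h3, one_smul]

end IsRegularDiffusion

/-! ### The mixture of threshold laws that reproduces a given law. -/

section Mixture

variable {ν : Measure EReal} {y l r : EReal} {u v : EReal → ℝ≥0∞} {k c₁ c₂ : ℝ≥0∞}

/-- The law on pairs of thresholds that mixes two-sided thresholds, with density proportional to
the distance `u + v` of the thresholds in scale, one-sided thresholds, and immediate stopping. -/
noncomputable def thresholdLaw (ν : Measure EReal) (y l r : EReal) (u v : EReal → ℝ≥0∞)
    (k c₁ c₂ : ℝ≥0∞) : Measure (EReal × EReal) :=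
  k • ((ν.restrict (Iio y)).prod (ν.restrict (Ioi y))).withDensity (fun θ => u θ.1 + v θ.2) +
    c₁ • (ν.restrict (Iio y)).map (fun a => (a, r)) +
    c₂ • (ν.restrict (Ioi y)).map (fun b => (l, b)) + ν {y} • Measure.dirac (y, y)

/-- `G θ` stands for the mass that the exit law from `θ` gives to `C`. The weights are tested
against the masses `ν (Iio y ∩ C)` and `ν (Ioi y ∩ C)` rather than required to be one, so that a
side without mass imposes nothing. -/
lemma lintegral_thresholdLaw [IsFiniteMeasure ν] (hu : Measurable u) (hv : Measurable v)
    {G : EReal × EReal → ℝ≥0∞} (hG : Measurable G) {C : Set EReal} (hC : MeasurableSet C)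
    {p q : EReal → Prop} (hp : ∀ᵐ a ∂ν.restrict (Iio y), p a)
    (hq : ∀ᵐ b ∂ν.restrict (Ioi y), q b)
    (hG₀ : ∀ a b, p a → q b → (u a + v b) * G (a, b) =
      v b * C.indicator 1 a + u a * C.indicator 1 b)
    (hG₁ : c₁ ≠ 0 → ∀ a, p a → G (a, r) = C.indicator 1 a)
    (hG₂ : c₂ ≠ 0 → ∀ b, q b → G (l, b) = C.indicator 1 b)
    (hGy : G (y, y) = C.indicator 1 y)
    (h₁ : (k * ∫⁻ b in Ioi y, v b ∂ν + c₁) * ν (Iio y ∩ C) = ν (Iio y ∩ C))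
    (h₂ : (k * ∫⁻ a in Iio y, u a ∂ν + c₂) * ν (Ioi y ∩ C) = ν (Ioi y ∩ C)) :
    ∫⁻ θ, G θ ∂(thresholdLaw ν y l r u v k c₁ c₂) = ν C := by
  have hI : Measurable (C.indicator (1 : EReal → ℝ≥0∞)) := measurable_one.indicator hC
  have hIint : ∀ S : Set EReal, MeasurableSet S →
      ∫⁻ a in S, C.indicator 1 a ∂ν = ν (S ∩ C) := by
    intro S hS
    rw [lintegral_indicator_one hC, Measure.restrict_apply hC, inter_comm]
  -- The density cancels the denominator of the exit probabilities, and what remains is a sum of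
  -- products of functions of one variable.
  have e0 : ∫⁻ θ, G θ ∂((ν.restrict (Iio y)).prod (ν.restrict (Ioi y))).withDensity
      (fun θ => u θ.1 + v θ.2) = (∫⁻ b in Ioi y, v b ∂ν) * ν (Iio y ∩ C) +
        (∫⁻ a in Iio y, u a ∂ν) * ν (Ioi y ∩ C) := by
    rw [lintegral_withDensity_eq_lintegral_mul _
      (show Measurable (fun θ : EReal × EReal => u θ.1 + v θ.2) from
        (hu.comp measurable_fst).add (hv.comp measurable_snd)) hG]
    have e : ∀ᵐ θ ∂(ν.restrict (Iio y)).prod (ν.restrict (Ioi y)),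
        ((fun θ : EReal × EReal => u θ.1 + v θ.2) * G) θ =
          C.indicator 1 θ.1 * v θ.2 + u θ.1 * C.indicator 1 θ.2 := by
      filter_upwards [Measure.quasiMeasurePreserving_fst.ae hp,
        Measure.quasiMeasurePreserving_snd.ae hq] with θ h1 h2
      rw [mul_comm (C.indicator 1 θ.1)]
      exact hG₀ θ.1 θ.2 h1 h2
    rw [lintegral_congr_ae e, lintegral_add_left (show Measurable (fun θ : EReal × EReal =>
        C.indicator 1 θ.1 * v θ.2) from (hI.comp measurable_fst).mul (hv.comp measurable_snd)),
      lintegral_prod_mul hI.aemeasurable hv.aemeasurable,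
      lintegral_prod_mul hu.aemeasurable hI.aemeasurable, hIint _ measurableSet_Iio,
      hIint _ measurableSet_Ioi, mul_comm (ν (Iio y ∩ C))]
  have e1 : c₁ * ∫⁻ θ, G θ ∂(ν.restrict (Iio y)).map (fun a => (a, r)) = c₁ * ν (Iio y ∩ C) := by
    rcases eq_or_ne c₁ 0 with h | h
    · rw [h, zero_mul, zero_mul]
    · rw [lintegral_map hG (by fun_prop), lintegral_congr_ae (hp.mono (hG₁ h)),
        hIint _ measurableSet_Iio]
  have e2 : c₂ * ∫⁻ θ, G θ ∂(ν.restrict (Ioi y)).map (fun b => (l, b)) = c₂ * ν (Ioi y ∩ C) := by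
    rcases eq_or_ne c₂ 0 with h | h
    · rw [h, zero_mul, zero_mul]
    · rw [lintegral_map hG (by fun_prop), lintegral_congr_ae (hq.mono (hG₂ h)),
        hIint _ measurableSet_Ioi]
  have e3 : ν {y} * C.indicator 1 y = ν ({y} ∩ C) := by
    rw [← hIint _ (measurableSet_singleton y), Measure.restrict_singleton, lintegral_smul_measure,
      lintegral_dirac, smul_eq_mul]
  have hsplit : ν C = ν (Iio y ∩ C) + ν (Ioi y ∩ C) + ν ({y} ∩ C) := by
    rw [← measure_union (by
        rw [Set.disjoint_left]; rintro x ⟨hx, -⟩ ⟨hx', -⟩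
        exact lt_asymm (show x < y from hx) hx') (measurableSet_Ioi.inter hC),
      ← measure_union (by
        rw [Set.disjoint_left]; rintro x (⟨hx, -⟩ | ⟨hx, -⟩) ⟨rfl, -⟩ <;>
        exact lt_irrefl x hx) ((measurableSet_singleton y).inter hC), ← union_inter_distrib_right,
      ← union_inter_distrib_right]
    congr 1
    ext x
    simp only [mem_inter_iff, mem_union, mem_Iio, mem_Ioi, mem_singleton_iff]
    have := lt_trichotomy x y
    tauto
  rw [thresholdLaw, lintegral_add_measure, lintegral_add_measure, lintegral_add_measure,
    lintegral_smul_measure, lintegral_smul_measure, lintegral_smul_measure, lintegral_smul_measure,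
    lintegral_dirac, smul_eq_mul, smul_eq_mul, smul_eq_mul, smul_eq_mul, e0, e1, e2, hGy, e3,
    hsplit]
  congr 1
  calc _ = (k * ∫⁻ b in Ioi y, v b ∂ν + c₁) * ν (Iio y ∩ C) +
        (k * ∫⁻ a in Iio y, u a ∂ν + c₂) * ν (Ioi y ∩ C) := by ring
    _ = _ := by rw [h₁, h₂]

lemma ae_thresholdLaw [IsFiniteMeasure ν] {p q : EReal → Prop}
    (hp : ∀ᵐ a ∂ν.restrict (Iio y), p a) (hq : ∀ᵐ b ∂ν.restrict (Ioi y), q b)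
    {S : Set (EReal × EReal)} (hS : MeasurableSet S) (h₀ : ∀ a b, p a → q b → (a, b) ∈ S)
    (h₁ : c₁ ≠ 0 → ∀ a, p a → (a, r) ∈ S) (h₂ : c₂ ≠ 0 → ∀ b, q b → (l, b) ∈ S)
    (hy : (y, y) ∈ S) : ∀ᵐ θ ∂(thresholdLaw ν y l r u v k c₁ c₂), θ ∈ S := by
  rw [thresholdLaw, ae_add_measure_iff, ae_add_measure_iff, ae_add_measure_iff]
  refine ⟨⟨⟨?_, ?_⟩, ?_⟩, ?_⟩
  · refine Measure.ae_smul_measure ((withDensity_absolutelyContinuous _ _).ae_le ?_) k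
    filter_upwards [Measure.quasiMeasurePreserving_fst.ae hp,
      Measure.quasiMeasurePreserving_snd.ae hq] with θ k1 k2 using h₀ θ.1 θ.2 k1 k2
  · rcases eq_or_ne c₁ 0 with h | h
    · rw [h, zero_smul]; exact ae_zero.le trivial
    · exact Measure.ae_smul_measure ((ae_map_iff (by fun_prop) hS).2 (hp.mono (h₁ h))) _
  · rcases eq_or_ne c₂ 0 with h | h
    · rw [h, zero_smul]; exact ae_zero.le trivial
    · exact Measure.ae_smul_measure ((ae_map_iff (by fun_prop) hS).2 (hq.mono (h₂ h))) _
  · exact Measure.ae_smul_measure ((ae_dirac_iff hS).2 hy) _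

/-- The weights of the mixture. -/
lemma exists_mixture_weights {m₁ m₂ n₁ n₂ α β : ℝ≥0∞} (hα : m₁ ≤ α) (hβ : m₂ ≤ β)
    (h₁ : α ≠ ⊤ → m₂ ≤ m₁) (h₂ : β ≠ ⊤ → m₁ ≤ m₂) (hn₁ : m₁ = 0 → n₁ = 0)
    (hn₂ : m₂ = 0 → n₂ = 0) :
    ∃ k c₁ c₂ : ℝ≥0∞, (c₁ ≠ 0 → β = ⊤) ∧ (c₂ ≠ 0 → α = ⊤) ∧
      (∀ n ≤ n₁, (k * m₂ + c₁) * n = n) ∧ ∀ n ≤ n₂, (k * m₁ + c₂) * n = n := by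
  -- Here `n₁ = n₂ = 0`, so no weights are needed.
  have hzero : m₁ = 0 → m₂ = 0 → ∃ k c₁ c₂ : ℝ≥0∞, (c₁ ≠ 0 → β = ⊤) ∧ (c₂ ≠ 0 → α = ⊤) ∧
      (∀ n ≤ n₁, (k * m₂ + c₁) * n = n) ∧ ∀ n ≤ n₂, (k * m₁ + c₂) * n = n := by
    intro h h'
    refine ⟨0, 0, 0, by simp, by simp, fun n hn => ?_, fun n hn => ?_⟩
    · rw [hn₁ h] at hn; simp [nonpos_iff_eq_zero.1 hn]
    · rw [hn₂ h'] at hn; simp [nonpos_iff_eq_zero.1 hn]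
  by_cases ha : α = ⊤
  · by_cases hb : β = ⊤
    · exact ⟨0, 1, 1, fun _ => hb, fun _ => ha, by simp, by simp⟩
    · have hle := h₂ hb
      have hm : m₂ ≠ ⊤ := ne_top_of_le_ne_top hb hβ
      by_cases hm0 : m₂ = 0
      · exact hzero (nonpos_iff_eq_zero.1 (hle.trans hm0.le)) hm0
      -- The two-sided part uses up the side below `y` and only the fraction `m₁ / m₂` of the side
      -- above it; `c₂` supplies the rest.
      refine ⟨m₂⁻¹, 0, 1 - m₂⁻¹ * m₁, by simp, fun _ => ha, fun n _ => ?_, fun n _ => ?_⟩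
      · rw [ENNReal.inv_mul_cancel hm0 hm, add_zero, one_mul]
      · rw [add_tsub_cancel_of_le, one_mul]
        calc m₂⁻¹ * m₁ ≤ m₂⁻¹ * m₂ := by gcongr
          _ = 1 := ENNReal.inv_mul_cancel hm0 hm
  · have hle := h₁ ha
    have hm : m₁ ≠ ⊤ := ne_top_of_le_ne_top ha hα
    by_cases hm0 : m₁ = 0
    · exact hzero hm0 (nonpos_iff_eq_zero.1 (hle.trans hm0.le))
    refine ⟨m₁⁻¹, 1 - m₁⁻¹ * m₂, 0, fun hc => ?_, by simp, fun n _ => ?_, fun n _ => ?_⟩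
    · by_contra hb
      rw [le_antisymm hle (h₂ hb), ENNReal.inv_mul_cancel hm0 hm, tsub_self] at hc
      exact hc rfl
    · rw [add_tsub_cancel_of_le, one_mul]
      calc m₁⁻¹ * m₂ ≤ m₁⁻¹ * m₁ := by gcongr
        _ = 1 := ENNReal.inv_mul_cancel hm0 hm
    · rw [ENNReal.inv_mul_cancel hm0 hm, add_zero, one_mul]

end Mixture

/-! ### Realizing a given law of thresholds. -/

section Randomization

open unitInterval

/-- A measurable function of a real random variable with an atomless law is uniform. -/
lemma exists_measurable_map_eq_volume {μ : Measure ℝ} [IsProbabilityMeasure μ]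
    (hμ : ∀ x, μ {x} = 0) : ∃ f : ℝ → I, Measurable f ∧ μ.map f = volume := by
  -- The distribution function itself is the map; a jump would be an atom.
  have hcont : Continuous (cdf μ) := by
    refine continuous_iff_continuousAt.2 fun x => ?_
    rw [(monotone_cdf μ).continuousAt_iff_leftLim_eq_rightLim, StieltjesFunction.rightLim_eq]
    have h1 : (cdf μ).measure {x} = 0 := by rw [measure_cdf]; exact hμ x
    rw [StieltjesFunction.measure_singleton, ENNReal.ofReal_eq_zero] at h1
    exact le_antisymm ((monotone_cdf μ).leftLim_le le_rfl) (by linarith)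
  have hmem : ∀ x, cdf μ x ∈ I := fun x => ⟨cdf_nonneg μ x, cdf_le_one μ x⟩
  have hf : Measurable fun x => (⟨cdf μ x, hmem x⟩ : I) := hcont.measurable.subtype_mk
  refine ⟨fun x => ⟨cdf μ x, hmem x⟩, hf, ?_⟩
  have := Measure.isProbabilityMeasure_map (μ := μ) hf.aemeasurable
  refine Measure.ext_of_Iic _ _ fun t => ?_
  rw [Measure.map_apply hf measurableSet_Iic, unitInterval.volume_Iic]
  have hpre : (fun x => (⟨cdf μ x, hmem x⟩ : I)) ⁻¹' Iic t = {x | cdf μ x ≤ t} := by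
    ext x; exact Iff.rfl
  rw [hpre]
  rcases eq_or_lt_of_le t.2.2 with h1 | h1
  · have : {x | cdf μ x ≤ t} = univ := eq_univ_of_forall fun x => (cdf_le_one μ x).trans h1.ge
    rw [this, measure_univ, h1, ENNReal.ofReal_one]
  have hclosed : IsClosed {x | cdf μ x ≤ t} := isClosed_Iic.preimage hcont
  obtain ⟨z, hz⟩ := ((tendsto_cdf_atTop μ).eventually (eventually_gt_nhds h1)).exists
  have hbdd : BddAbove {x | cdf μ x ≤ t} := by
    refine ⟨z, fun x hx => ?_⟩
    by_contra hc
    exact (hz.trans_le (monotone_cdf μ (not_le.1 hc).le)).not_ge hx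
  rcases {x | cdf μ x ≤ t}.eq_empty_or_nonempty with he | hne
  · have h0 : (t : ℝ) = 0 := by
      refine le_antisymm ?_ t.2.1
      refine ge_of_tendsto' (tendsto_cdf_atBot μ) fun x => ?_
      by_contra hc
      have : x ∈ {x | cdf μ x ≤ t} := (not_le.1 hc).le
      rw [he] at this
      exact this
    rw [he, measure_empty, h0, ENNReal.ofReal_zero]
  · have hmax := hclosed.csSup_mem hne hbdd
    set x₀ := sSup {x | cdf μ x ≤ t}
    have heq : {x | cdf μ x ≤ t} = Iic x₀ := by
      ext x
      exact ⟨fun h => le_csSup hbdd h, fun h => (monotone_cdf μ h).trans hmax⟩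
    rw [heq, ← ofReal_cdf]
    congr 1
    -- To the right of `x₀` the distribution function exceeds `t`, so by continuity it is at least
    -- `t` at `x₀`.
    refine le_antisymm hmax ?_
    refine ge_of_tendsto (hcont.tendsto x₀ |>.mono_left (nhdsWithin_le_nhds (s := Ioi x₀))) ?_
    filter_upwards [self_mem_nhdsWithin] with x hx
    by_contra hc
    exact (le_csSup hbdd (not_le.1 hc).le).not_gt hx

/-- The atomless variable becomes uniform, and a uniform variable is mapped to any law on a standard
Borel space. -/
lemma IsRich.exists_map_eq {Ω : Type*} {mΩ : MeasurableSpace Ω} {F : Filtration ℝ≥0 mΩ}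
    {P : Measure Ω} [IsProbabilityMeasure P] {J : Set ℝ} {Y : Ω → PathSpace J} (h : IsRich F P Y)
    {X : Type*} [MeasurableSpace X] [StandardBorelSpace X] (μ : Measure X)
    [IsProbabilityMeasure μ] :
    ∃ Θ : Ω → X, Measurable[F 0] Θ ∧ IndepFun Θ Y P ∧ P.map Θ = μ := by
  obtain ⟨U, hU, hatom, hind⟩ := h
  have hU' : Measurable U := hU.mono (F.le 0) le_rfl
  have := Measure.isProbabilityMeasure_map (μ := P) hU'.aemeasurable
  obtain ⟨f, hf, hfm⟩ := exists_measurable_map_eq_volume (μ := P.map U) fun x => by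
    rw [Measure.map_apply hU' (measurableSet_singleton x)]; exact hatom x
  have : Nonempty X := μ.nonempty_of_neZero
  obtain ⟨g, hg, hgm⟩ := Measure.exists_measurable_map_eq μ
  refine ⟨fun ω => g (f (U ω)), hg.comp (hf.comp hU), hind.comp (hg.comp hf) measurable_id, ?_⟩
  rw [← hgm, ← hfm, Measure.map_map hf hU', Measure.map_map hg (hf.comp hU')]
  rfl

end Randomization

/-! ### Joint measurability of the exit value in thresholds and path. -/

section ExitValue

variable {I : Set ℝ} {y : ℝ}

/-- Obtained as a stopping time for the constant filtration on the product space. -/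
lemma measurable_exitTime :
    Measurable fun q : (EReal × EReal) × PathSpace I => exitTime q.1.1 q.1.2 q.2 := by
  have hcoord : ∀ u : ℝ≥0, Measurable fun q : (EReal × EReal) × PathSpace I =>
      ((q.2.1 u : ℝ) : EReal) := fun u =>
    measurable_coe_real_ereal.comp ((measurable_path u).comp measurable_snd)
  have hst : IsStoppingTime (Filtration.const ℝ≥0 (inferInstance : MeasurableSpace ((EReal × EReal) × PathSpace I))
      le_rfl)
      fun q : (EReal × EReal) × PathSpace I => exitTime q.1.1 q.1.2 q.2 := by
    intro t
    simp only [exitTime_le_iff]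
    have h1 := measurableSet_exists_le
      (Z := fun (q : (EReal × EReal) × PathSpace I) u => ((q.2.1 u : ℝ) : EReal))
      (A := fun q => q.1.1) (t := t) (σ := fun _ => ((0 : ℝ≥0) : WithTop ℝ≥0))
      (fun q => continuous_coe_real_ereal.comp (continuous_path q.2))
      (measurable_fst.comp measurable_fst) (fun u _ => hcoord u)
      (fun u _ => MeasurableSet.const _)
    have h2 := measurableSet_exists_le
      (Z := fun (q : (EReal × EReal) × PathSpace I) u => -((q.2.1 u : ℝ) : EReal))
      (A := fun q => -q.1.2) (t := t) (σ := fun _ => ((0 : ℝ≥0) : WithTop ℝ≥0))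
      (fun q => continuous_neg.comp (continuous_coe_real_ereal.comp (continuous_path q.2)))
      (measurable_snd.comp measurable_fst).neg (fun u _ => (hcoord u).neg)
      (fun u _ => MeasurableSet.const _)
    simp only [zero_le_coe, true_and, EReal.neg_le_neg_iff] at h1 h2
    exact h1.union h2
  exact hst.measurable'

/-- The value at which a path leaves the interval between two thresholds. -/
noncomputable def exitValue (q : (EReal × EReal) × PathSpace I) : EReal :=
  limsup (fun n : ℕ => stoppedPath q.2 (exitTime q.1.1 q.1.2 q.2) n) atTop

lemma measurable_exitValue :
    Measurable (exitValue : (EReal × EReal) × PathSpace I → EReal) := by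
  refine Measurable.limsup fun n => ?_
  exact measurable_coe_real_ereal.comp (measurable_subtype_coe.comp (measurable_eval.comp
    (((measurable_const.min measurable_exitTime).untopA).prodMk measurable_snd)))

/-- Replaces the limit by an upper limit along integers, which is measurable everywhere and so can
be integrated over the thresholds. -/
lemma stoppedAt_eq_exitValue {Ω : Type*} {Y : Ω → PathSpace I} {A B : Ω → EReal} {ω : Ω} {L : EReal}
    (h : Tendsto (stoppedPath (Y ω) (exitTime (A ω) (B ω) (Y ω))) atTop (𝓝 L)) :
    stoppedAt Y (fun ω => exitTime (A ω) (B ω) (Y ω)) ω = exitValue ((A ω, B ω), Y ω) := by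
  rw [stoppedAt, h.limUnder_eq]
  exact (h.comp (tendsto_natCast_atTop_atTop (R := ℝ≥0))).limsup_eq.symm

/-- Pairs of thresholds from between which the diffusion exits almost surely, possibly at time
infinity. -/
def regularThresholds (I : Set ℝ) (y : ℝ) (s : I → ℝ) : Set (EReal × EReal) :=
  {θ | θ ∈ thresholds I y ∧ (sNeg s θ.1 ≠ ⊤ ∨ sPos s θ.2 ≠ ⊤)}

lemma measurableSet_thresholds : MeasurableSet (thresholds I y) :=
  (isClosed_closure.measurableSet.inter measurableSet_Iic).prod
    (isClosed_closure.measurableSet.inter measurableSet_Ici)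

lemma measurableSet_regularThresholds {s : I → ℝ} :
    MeasurableSet (regularThresholds I y s) := by
  refine measurableSet_thresholds.inter (MeasurableSet.union ?_ ?_)
  · exact (measurable_sNeg.comp measurable_fst) (measurableSet_singleton _).compl
  · exact (measurable_sPos.comp measurable_snd) (measurableSet_singleton _).compl

end ExitValue

/-! ### Randomized thresholds attain every attainable law. -/

namespace IsRegularDiffusion

variable {Ω : Type*} {mΩ : MeasurableSpace Ω} {F : Filtration ℝ≥0 mΩ} {P : Measure Ω}
  {I : Set ℝ} {y : ℝ} {κ : Kernel I (PathSpace I)} {Y : Ω → PathSpace I}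
  {s : I → ℝ} {a b : ℕ → I}

section Randomized

variable {Θ : Ω → EReal × EReal}

lemma ae_tendsto_randomized (hY : IsRegularDiffusion F P I y κ Y) [IsProbabilityMeasure P]
    (hs : IsScale κ y s) (hab : IsExhaustion I y a b)
    (hreg : ∀ᵐ ω ∂P, Θ ω ∈ regularThresholds I y s) :
    ∀ᵐ ω ∂P, ∃ L, Tendsto (stoppedPath (Y ω) (exitTime (Θ ω).1 (Θ ω).2 (Y ω))) atTop (𝓝 L) := by
  filter_upwards [hreg, hY.ae_goodPath hs hab] with ω hθ hω
  obtain ⟨L, -, hL⟩ := hω.tendsto_exit hab hθ.1.1.1 hθ.1.1.2 hθ.1.2.1 hθ.1.2.2 hθ.2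
  exact ⟨L, hL⟩

lemma exitTime_randomized_mem (hY : IsRegularDiffusion F P I y κ Y) [IsProbabilityMeasure P]
    (hs : IsScale κ y s) (hab : IsExhaustion I y a b) (hΘ : Measurable[F 0] Θ)
    (hreg : ∀ᵐ ω ∂P, Θ ω ∈ regularThresholds I y s) :
    (fun ω => exitTime (Θ ω).1 (Θ ω).2 (Y ω)) ∈ stoppingTimes F P Y :=
  ⟨hY.isStoppingTime_exitTime (measurable_fst.comp hΘ) (measurable_snd.comp hΘ),
    hY.ae_tendsto_randomized hs hab hreg⟩

lemma stoppedLaw_exitTime_apply (hY : IsRegularDiffusion F P I y κ Y) [IsProbabilityMeasure P]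
    (hs : IsScale κ y s) (hab : IsExhaustion I y a b) {θ : EReal × EReal}
    (hθ : θ ∈ regularThresholds I y s) {C : Set EReal} (hC : MeasurableSet C) :
    P.map Y {w | exitValue (θ, w) ∈ C} = stoppedLaw P Y (fun ω => exitTime θ.1 θ.2 (Y ω)) C := by
  have hm : Measurable fun w : PathSpace I => exitValue (θ, w) :=
    measurable_exitValue.comp measurable_prodMk_left
  rw [stoppedLaw, Measure.map_apply_of_aemeasurable
      (hY.aemeasurable_stoppedAt (hY.exitTime_mem_stoppingTimes hs hab hθ.1 hθ.2)) hC,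
    Measure.map_apply hY.measurable
      (show MeasurableSet {w | exitValue (θ, w) ∈ C} from hm hC)]
  refine measure_congr ?_
  filter_upwards [hY.ae_tendsto_randomized (Θ := fun _ => θ) hs hab
    (Eventually.of_forall fun _ => hθ)] with ω ⟨L, hL⟩
  exact congrArg C (stoppedAt_eq_exitValue (A := fun _ => θ.1) (B := fun _ => θ.2) hL).symm

/-- The law at a randomized threshold time is the mixture of the laws at the threshold times. -/
lemma stoppedLaw_randomized_apply (hY : IsRegularDiffusion F P I y κ Y) [IsProbabilityMeasure P]
    (hs : IsScale κ y s) (hab : IsExhaustion I y a b) (hΘ : Measurable[F 0] Θ)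
    (hind : IndepFun Θ Y P) (hreg : ∀ᵐ ω ∂P, Θ ω ∈ regularThresholds I y s)
    {C : Set EReal} (hC : MeasurableSet C) :
    stoppedLaw P Y (fun ω => exitTime (Θ ω).1 (Θ ω).2 (Y ω)) C =
      ∫⁻ θ, P.map Y {w | exitValue (θ, w) ∈ C} ∂(P.map Θ) := by
  have hΘ' : Measurable Θ := hΘ.mono (F.le 0) le_rfl
  have hCm : MeasurableSet ((exitValue : (EReal × EReal) × PathSpace I → EReal) ⁻¹' C) :=
    measurable_exitValue hC
  have := Measure.isProbabilityMeasure_map (μ := P) hY.measurable.aemeasurable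
  rw [stoppedLaw, Measure.map_apply_of_aemeasurable
      (hY.aemeasurable_stoppedAt (hY.exitTime_randomized_mem hs hab hΘ hreg)) hC]
  calc _ = P ((fun ω => (Θ ω, Y ω)) ⁻¹' (exitValue ⁻¹' C)) := by
        refine measure_congr ?_
        filter_upwards [hY.ae_tendsto_randomized hs hab hreg] with ω ⟨L, hL⟩
        exact congrArg C (stoppedAt_eq_exitValue (A := fun ω => (Θ ω).1)
          (B := fun ω => (Θ ω).2) hL)
    -- Independence enters here: the joint law of thresholds and path is a product.
    _ = (P.map Θ).prod (P.map Y) (exitValue ⁻¹' C) := by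
        rw [← (indepFun_iff_map_prod_eq_prod_map_map hΘ'.aemeasurable
          hY.measurable.aemeasurable).1 hind,
          Measure.map_apply (hΘ'.prodMk hY.measurable) hCm]
    _ = _ := Measure.prod_apply hCm

end Randomized

/-- Each attainable law is a mixture of the laws at threshold times. -/
lemma exists_thresholdLaw (hY : IsRegularDiffusion F P I y κ Y) [IsProbabilityMeasure P]
    (hs : IsScale κ y s) (hab : IsExhaustion I y a b) {τ : Ω → WithTop ℝ≥0}
    (hτ : τ ∈ stoppingTimes F P Y) :
    ∃ M : Measure (EReal × EReal), IsProbabilityMeasure M ∧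
      (∀ᵐ θ ∂M, θ ∈ regularThresholds I y s) ∧ ∀ C, MeasurableSet C →
        ∫⁻ θ, P.map Y {w | exitValue (θ, w) ∈ C} ∂M = stoppedLaw P Y τ C := by
  have := Measure.isProbabilityMeasure_map (μ := P) hY.measurable.aemeasurable
  have := hY.isProbabilityMeasure_stoppedLaw hτ
  have hcl := hY.ae_stoppedLaw_mem_closure hτ
  have hleft := hY.ae_stoppedLaw_ne_leftEnd hs hab hτ
  have hright := hY.ae_stoppedLaw_ne_rightEnd hs hab hτ
  have hle₁ := hY.lintegral_sNeg_stoppedLaw_le hs hab hτ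
  have hle₂ := hY.lintegral_sPos_stoppedLaw_le hs hab hτ
  set ν := stoppedLaw P Y τ
  let K : Set EReal := closure (Real.toEReal '' I)
  have hne : (Real.toEReal '' I).Nonempty := ⟨_, mem_image_of_mem _ hY.mem⟩
  have hl : leftEnd I ∈ K := (isGLB_sInf _).mem_closure hne
  have hr : rightEnd I ∈ K := (isLUB_sSup _).mem_closure hne
  have hlt₁ : leftEnd I < y :=
    (leftEnd_le (a 0)).trans_lt (EReal.coe_lt_coe_iff.2 (hab.lt 0))
  have hlt₂ : (y : EReal) < rightEnd I :=
    (EReal.coe_lt_coe_iff.2 (hab.gt 0)).trans_le (le_rightEnd (b 0))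
  have hneg : ∫⁻ x, sNeg s x ∂ν = ∫⁻ x in Iio (y : EReal), sNeg s x ∂ν := by
    refine (setLIntegral_eq_of_support_subset fun x hx => ?_).symm
    by_contra hc
    exact hx (hs.sNeg_eq_zero (not_lt.1 hc))
  have hpos : ∫⁻ x, sPos s x ∂ν = ∫⁻ x in Ioi (y : EReal), sPos s x ∂ν := by
    refine (setLIntegral_eq_of_support_subset fun x hx => ?_).symm
    by_contra hc
    exact hx (hs.sPos_eq_zero (not_lt.1 hc))
  let p : EReal → Prop := fun x => x ∈ K ∧ x < y ∧ sNeg s x ≠ ⊤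
  let q : EReal → Prop := fun x => x ∈ K ∧ (y : EReal) < x ∧ sPos s x ≠ ⊤
  -- Infinite scale can occur only at the end itself, which then carries no mass.
  have hp : ∀ᵐ x ∂ν.restrict (Iio (y : EReal)), p x := by
    refine (ae_restrict_iff' measurableSet_Iio).2 ?_
    by_cases h : sNeg s (leftEnd I) = ⊤
    · filter_upwards [hcl, hleft h] with x hx hxl hxy
      exact ⟨hx, hxy, sNeg_ne_top_of_leftEnd_lt hs.mono
        ((leftEnd_le_of_mem_closure hx).lt_of_ne' hxl)⟩
    · filter_upwards [hcl] with x hx hxy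
      exact ⟨hx, hxy, ne_top_of_le_ne_top h (sNeg_anti (leftEnd_le_of_mem_closure hx))⟩
  have hq : ∀ᵐ x ∂ν.restrict (Ioi (y : EReal)), q x := by
    refine (ae_restrict_iff' measurableSet_Ioi).2 ?_
    by_cases h : sPos s (rightEnd I) = ⊤
    · filter_upwards [hcl, hright h] with x hx hxr hxy
      exact ⟨hx, hxy, sPos_ne_top_of_lt_rightEnd hs.mono
        ((le_rightEnd_of_mem_closure hx).lt_of_ne hxr)⟩
    · filter_upwards [hcl] with x hx hxy
      exact ⟨hx, hxy, ne_top_of_le_ne_top h (sPos_mono (le_rightEnd_of_mem_closure hx))⟩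
  obtain ⟨k, c₁, c₂, hc₁, hc₂, hw₁, hw₂⟩ := exists_mixture_weights
    (m₁ := ∫⁻ x in Iio (y : EReal), sNeg s x ∂ν) (m₂ := ∫⁻ x in Ioi (y : EReal), sPos s x ∂ν)
    (n₁ := ν (Iio (y : EReal))) (n₂ := ν (Ioi (y : EReal)))
    (α := sNeg s (leftEnd I)) (β := sPos s (rightEnd I))
    (by
      refine (lintegral_mono_ae (hp.mono fun x hx =>
        sNeg_anti (leftEnd_le_of_mem_closure hx.1))).trans ?_
      rw [setLIntegral_const]
      exact mul_le_of_le_one_right' prob_le_one)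
    (by
      refine (lintegral_mono_ae (hq.mono fun x hx =>
        sPos_mono (le_rightEnd_of_mem_closure hx.1))).trans ?_
      rw [setLIntegral_const]
      exact mul_le_of_le_one_right' prob_le_one)
    (fun h => hneg ▸ hpos ▸ hle₂ h) (fun h => hneg ▸ hpos ▸ hle₁ h)
    (fun h => by
      rw [lintegral_eq_zero_iff measurable_sNeg] at h
      rw [← Measure.restrict_eq_zero, ← ae_eq_bot, ← eventually_false_iff_eq_bot]
      filter_upwards [h, hp] with x hx hpx
      exact sNeg_ne_zero hY.ordConnected hY.mem hs hab hpx.1 hpx.2.1 hx)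
    (fun h => by
      rw [lintegral_eq_zero_iff measurable_sPos] at h
      rw [← Measure.restrict_eq_zero, ← ae_eq_bot, ← eventually_false_iff_eq_bot]
      filter_upwards [h, hq] with x hx hqx
      exact sPos_ne_zero hY.ordConnected hY.mem hs hab hqx.1 hqx.2.1 hx)
  have hmem : ∀ {A B : EReal}, A ∈ K → A ≤ y → B ∈ K → (y : EReal) ≤ B →
      (A, B) ∈ thresholds I y := fun h1 h2 h3 h4 => ⟨⟨h1, h2⟩, ⟨h3, h4⟩⟩
  have hyy : ((y : EReal), (y : EReal)) ∈ regularThresholds I y s :=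
    ⟨hY.mem_thresholds_self, Or.inl (by rw [hs.sNeg_eq_zero le_rfl]; exact ENNReal.zero_ne_top)⟩
  have hreg₀ : ∀ A B, p A → q B → (A, B) ∈ regularThresholds I y s := fun A B hA hB =>
    ⟨hmem hA.1 hA.2.1.le hB.1 hB.2.1.le, Or.inl hA.2.2⟩
  have hreg₁ : ∀ A, p A → (A, rightEnd I) ∈ regularThresholds I y s := fun A hA =>
    ⟨hmem hA.1 hA.2.1.le hr hlt₂.le, Or.inl hA.2.2⟩
  have hreg₂ : ∀ B, q B → (leftEnd I, B) ∈ regularThresholds I y s := fun B hB =>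
    ⟨hmem hl hlt₁.le hB.1 hB.2.1.le, Or.inr hB.2.2⟩
  have hdirac : ∀ {C : Set EReal} (x : EReal), MeasurableSet C →
      Measure.dirac x C = C.indicator 1 x := fun x hC => Measure.dirac_apply' x hC
  have hint : ∀ C, MeasurableSet C → ∫⁻ θ, P.map Y {w | exitValue (θ, w) ∈ C}
      ∂(thresholdLaw ν y (leftEnd I) (rightEnd I) (sNeg s) (sPos s) k c₁ c₂) = ν C := by
    intro C hC
    refine lintegral_thresholdLaw (G := fun θ => P.map Y {w | exitValue (θ, w) ∈ C})
      measurable_sNeg measurable_sPos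
      (measurable_measure_prodMk_left (measurable_exitValue hC)) hC hp hq
      (fun A B hA hB => ?_) (fun h A hA => ?_) (fun h B hB => ?_) ?_
      (hw₁ _ (measure_mono inter_subset_left)) (hw₂ _ (measure_mono inter_subset_left))
    · have h1 := congrArg (fun m : Measure EReal => m C)
        (hY.smul_exitLaw hs hab (hreg₀ A B hA hB).1 hA.2.1 hB.2.1 hA.2.2 hB.2.2)
      simp only [Measure.smul_apply, Measure.add_apply, smul_eq_mul, hdirac _ hC] at h1
      change _ * P.map Y {w | exitValue ((A, B), w) ∈ C} = _
      rw [hY.stoppedLaw_exitTime_apply hs hab (hreg₀ A B hA hB) hC, h1]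
    · rw [hY.stoppedLaw_exitTime_apply hs hab (hreg₁ A hA) hC, hY.exitLaw_eq_dirac_left hs hab
        (hreg₁ A hA).1 hA.2.1 hlt₂ hA.2.2 (hc₁ h), hdirac _ hC]
    · rw [hY.stoppedLaw_exitTime_apply hs hab (hreg₂ B hB) hC, hY.exitLaw_eq_dirac_right hs hab
        (hreg₂ B hB).1 hlt₁ hB.2.1 (hc₂ h) hB.2.2, hdirac _ hC]
    · rw [hY.stoppedLaw_exitTime_apply hs hab hyy hC, hY.exitLaw_self hs hab, hdirac _ hC]
  refine ⟨thresholdLaw ν y (leftEnd I) (rightEnd I) (sNeg s) (sPos s) k c₁ c₂, ⟨?_⟩, ?_, hint⟩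
  -- Total mass one is the mixture identity for the whole space.
  · have h1 := hint univ MeasurableSet.univ
    simpa using h1
  · exact ae_thresholdLaw hp hq measurableSet_regularThresholds hreg₀ (fun _ => hreg₁)
      (fun _ => hreg₂) hyy

/-- Each attainable law is attained by a randomized threshold time. -/
lemma exists_randomizedThresholdTime (hY : IsRegularDiffusion F P I y κ Y)
    [IsProbabilityMeasure P] (hF : IsRich F P Y) {τ : Ω → WithTop ℝ≥0}
    (hτ : τ ∈ stoppingTimes F P Y) :
    ∃ σ ∈ randomizedThresholdTimes F P y Y, stoppedLaw P Y σ = stoppedLaw P Y τ := by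
  obtain ⟨s, hs⟩ := hY.exists_isScale
  obtain ⟨a, b, hab⟩ := hY.exists_isExhaustion
  obtain ⟨M, hM, hreg, hint⟩ := hY.exists_thresholdLaw hs hab hτ
  obtain ⟨Θ, hΘ, hind, hmap⟩ := hF.exists_map_eq M
  have hΘ' : Measurable Θ := hΘ.mono (F.le 0) le_rfl
  classical
  -- Thresholds must be admissible for every `ω`, not just almost surely; immediate stopping is the
  -- default on the null set.
  let g : EReal × EReal → thresholds I y := fun θ =>
    if h : θ ∈ thresholds I y then ⟨θ, h⟩ else ⟨_, hY.mem_thresholds_self⟩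
  have hg : Measurable g := Measurable.dite measurable_id measurable_const measurableSet_thresholds
  have hregΘ : ∀ᵐ ω ∂P, Θ ω ∈ regularThresholds I y s := by
    rw [← hmap] at hreg
    exact (ae_map_iff hΘ'.aemeasurable measurableSet_regularThresholds).1 hreg
  have hgΘ : (fun ω => (g (Θ ω)).1) =ᵐ[P] Θ := by
    filter_upwards [hregΘ] with ω hω
    simp [g, hω.1]
  have hm : Measurable[F 0] fun ω => (g (Θ ω)).1 := measurable_subtype_coe.comp (hg.comp hΘ)
  have hreg' : ∀ᵐ ω ∂P, (g (Θ ω)).1 ∈ regularThresholds I y s := by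
    filter_upwards [hregΘ, hgΘ] with ω hω h
    rwa [h]
  refine ⟨fun ω => exitTime (g (Θ ω)).1.1 (g (Θ ω)).1.2 (Y ω),
    ⟨hY.exitTime_randomized_mem hs hab hm hreg', fun ω => g (Θ ω), hg.comp hΘ,
      hind.comp hg measurable_id, fun ω => rfl⟩, Measure.ext fun C hC => ?_⟩
  rw [hY.stoppedLaw_randomized_apply hs hab hm
    (hind.comp (measurable_subtype_coe.comp hg) measurable_id) hreg' hC, ← hint C hC,
    Measure.map_congr hgΘ, hmap]

end IsRegularDiffusion

end ThresholdStopping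
open ThresholdStopping in
theorem theorem1 {Ω : Type*} {mΩ : MeasurableSpace Ω} (P : Measure Ω) [IsProbabilityMeasure P]
    (F : Filtration ℝ≥0 mΩ) (I : Set ℝ) (y : ℝ) (κ : Kernel I (PathSpace I))
    (Y : Ω → PathSpace I) (hY : IsRegularDiffusion F P I y κ Y) (hF : IsRich F P Y)
    (V : (Ω → WithTop ℝ≥0) → ℝ) (hV : LawInvariant F P Y V) :
    optimalValue V (stoppingTimes F P Y) = optimalValue V (randomizedThresholdTimes F P y Y) := by
  obtain ⟨H, hH⟩ := hV
  refine le_antisymm (iSup₂_le fun τ hτ => ?_) (biSup_mono fun τ hτ => hτ.1)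
  obtain ⟨σ, hσ, hlaw⟩ := hY.exists_randomizedThresholdTime hF hτ
  have hVσ : V τ = V σ := by
    rw [hH τ hτ, hH σ hσ.1]
    exact congrArg H (Subtype.ext hlaw.symm)
  rw [hVσ]
  exact le_iSup₂ (f := fun τ _ => (V τ : EReal)) σ hσ
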